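/- Let $G$ be a discrete group. All rings are associative, not necessarily unital, carry a $G$-action by ring automorphisms, and are quadratik (every element is a finite sum of products). A right functional $B$-module $(\mathcal E,S)$ over a $G$-ring $(B,\beta)$ is a right $B$-module with a $G$-action $S$ by additive maps, $S_g(\xi b)=S_g(\xi)\beta_g(b)$, and a $G$-invariant left $B$-submodule $\Theta_B(\mathcal E)\subseteq \mathrm{Hom}_B(\mathcal E,B)$ of functionals. $\mathcal K_B(\mathcal E)$ is the ring of finite sums of the operators $\theta_{\eta,\phi}(\xi)=\eta\,\phi(\xi)$ ($\eta\in\mathcal E$, $\phi\in\Theta_B(\mathcal E)$), with the action $\mathrm{Ad}(S)$. $\mathcal E$ is cofull if every element is a finite sum of elements $\xi\phi(\eta)$, and separated by functionals if $\phi(\xi)=0$ for all $\phi\in\Theta_B(\mathcal E)$ implies $\xi=0$. A ring $B$ is a functional module over itself with the left multiplications by elements of $B$ as functionals. In direct sums $\bigoplus_i\mathcal E_i$ (finite support) the functionals are $\bigoplus_i\phi_i$ for arbitrary families $\phi_i\in\Theta_B(\mathcal E_i)$. The internal tensor product $\mathcal E\otimes_\pi\mathcal F$ is $\mathcal E\otimes_{\mathbb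 Z}\mathcal F$ modulo all $\sum\xi_i\otimes\eta_i$ with $\sum\pi(\phi(\xi_i))\eta_i=0$ for every $\phi\in\Theta(\mathcal E)$; its functionals are the finite sums of $\xi\otimes\eta\mapsto\psi(\pi(\phi(\xi))\eta)$. The crossed product $B\rtimes_\beta G$ consists of the finite formal sums $\sum_g b_g\rtimes g$ with $(a\rtimes g)(b\rtimes h)=a\beta_g(b)\rtimes gh$; $B$ acts on it from the left through $b\mapsto b\rtimes 1$, and $V_g(b\rtimes h):=\beta_g(b)\rtimes gh$. Let $\mathbb H_B=\bigoplus_{i\in I}B$ with a $G$-action of the form $\beta\oplus T$ with respect to $B\oplus\bigoplus_{i\ne i_0}B$. If $\mathcal E\oplus\mathbb H_B$ is cofull, the ring homomorphism $e:B\to\mathcal K_B(\mathcal E\oplus\mathbb H_B)$ letting $e(b)$ act as left multiplication by $b$ on the coordinate $i_0$ and as zero on all other summands is called a corner embedding; so is its composition with an equivariant ring isomorphism of the target. $GK^G$ is the additive category whose objects are the $G$-equivariant quadratik rings and whose morphisms are generated under composition, addition and subtraction by the equivariant ring homomorphisms, a formal inverse $e^{-1}$ for every corner embedding $e$, and a morphism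 $\Delta_{\mathcal S}:M\to B$ for every equivariant split exact sequence $\mathcal S:0\to B\xrightarrow{j}M\xrightarrow{f}A\to0$ with split $s$. The relations (compositions being written from left to right) are: composition and identities of ring homomorphisms; $1_{A\oplus B}=p_Ai_A+p_Bi_B$; $f_0=f_1$ for homotopic homomorphisms, where $f_0,f_1:A\to B$ are homotopic if there is an equivariant ring homomorphism $f:A\to B\otimes_{\mathbb Z} C([0,1],\mathbb C)$ whose evaluations at $0$ and $1$ are $a\mapsto f_0(a)\otimes1$ and $a\mapsto f_1(a)\otimes 1$ in $B\otimes_{\mathbb Z}\mathbb C$; $ee^{-1}=1$, $e^{-1}e=1$; $j\Delta_{\mathcal S}=1_B$, $\Delta_{\mathcal S}j+fs=1_M$. $GK$ is this category for the trivial group. **Proposition.** Let $(\mathcal E,S)$ be a cofull functional $(B,\beta)$-module. Then $\mathcal E\otimes_B(B\rtimes_\beta G)$ is cofull, and the formula $$\sigma(T\rtimes g)=(T\otimes1)\circ(S_g\otimes V_g)$$ defines a surjective ring homomorphism $$\sigma:\mathcal K_B(\mathcal E)\rtimes_{\mathrm{Ad}(S)}G\to\mathcal K_{B\rtimes_\beta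 G}\big(\mathcal E\otimes_B(B\rtimes_\beta G)\big),$$ whose kernel consists of all $\sum_gT_g\rtimes g$ with $\phi\circ T_g=0$ for all $g\in G$, $\phi\in\Theta_B(\mathcal E)$. In particular, $\sigma$ is a ring isomorphism if $\mathcal E$ is separated by functionals. **Corollary.** (i) Let $e:B\to\mathcal K_B(\mathcal E\oplus\mathbb H_B)$ be a corner embedding as above, where the cofull module $\mathcal E\oplus\mathbb H_B$ is separated by functionals. Put $R:=B\rtimes_\beta G$. Let $X:(\mathcal E\oplus\mathbb H_B)\otimes_BR\to(\mathcal E\otimes_BR)\oplus\mathbb H_R$ be the canonical additive bijection $(\xi\oplus(b_i)_i)\otimes x\mapsto(\xi\otimes x)\oplus(b_ix)_i$, where $\mathbb H_R=\bigoplus_{i\in I}R$. Then $(\mathcal E\otimes_BR)\oplus\mathbb H_R$ is cofull, $\pi(T)=XTX^{-1}$ defines an injective ring homomorphism $$\pi:\mathcal K_R\big((\mathcal E\oplus\mathbb H_B)\otimes_BR\big)\to\mathcal K_R\big((\mathcal E\otimes_BR)\oplus\mathbb H_R\big),$$ which is an isomorphism if $I$ is finite, $\sigma$ is an isomorphism for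 the module $\mathcal E\oplus\mathbb H_B$, and $\pi\circ\sigma\circ(e\rtimes1)$ is the corner embedding $R\to\mathcal K_R((\mathcal E\otimes_BR)\oplus\mathbb H_R)$ at the coordinate $i_0$; the latter is injective if $e$ is. (ii) For every equivariant corner embedding $e:A\to K$ (any $I$, separated or not), $e\rtimes1:A\rtimes G\to K\rtimes G$, $a\rtimes g\mapsto e(a)\rtimes g$, is a corner embedding up to isomorphism. **Descent functor.** There is exactly one additive functor $j^G:GK^G\to GK$ with $j^G(A)=A\rtimes G$ on objects, $j^G(\pi)=\pi\rtimes1$ for equivariant ring homomorphisms $\pi$, $j^G(e^{-1})=(j^G(e))^{-1}$ for corner embeddings $e$ (in particular $j^G(e)$ is invertible), and $j^G(\Delta_{\mathcal S})=\Delta_{\mathcal S\rtimes G}$ for split exact sequences $\mathcal S$, where $\mathcal S\rtimes G$ is the split exact sequence of crossed products. -/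

import Mathlib

open CategoryTheory TensorProduct

universe u

namespace GKT

noncomputable section

/-! ### Quadratik rings with an action of a discrete group -/

/-- A (not necessarily unital) ring is quadratik if every element is a finite sum of products. -/
def IsQuadratik (A : Type u) [NonUnitalRing A] : Prop :=
  ∀ a : A, a ∈ AddSubgroup.closure {z : A | ∃ b c : A, z = b * c}

/-- Objects of the category of `G`-equivariant quadratik rings. -/
structure QRing (G : Type u) [Group G] where
  carrier : Type u
  [ring : NonUnitalRing carrier]
  action : G →* RingAut carrier
  quadratik : IsQuadratik carrier

attribute [instance] QRing.ring

instance (G : Type u) [Group G] : CoeSort (QRing G) (Type u) := ⟨QRing.carrier⟩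

/-- `G`-equivariant ring homomorphisms. -/
@[ext]
structure EHom {G : Type u} [Group G] (A B : QRing G) where
  toHom : A →ₙ+* B
  equivariant : ∀ (g : G) (a : A), toHom (A.action g a) = B.action g (toHom a)

namespace EHom

variable {G : Type u} [Group G]

def id (A : QRing G) : EHom A A := ⟨NonUnitalRingHom.id A, fun _ _ => rfl⟩

/-- Composition in the order "first `f`, then `h`". -/
def comp {A B C : QRing G} (f : EHom A B) (h : EHom B C) : EHom A C :=
  ⟨h.toHom.comp f.toHom, fun g a => by
    simp [f.equivariant, h.equivariant]⟩

end EHom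

/-! ### Functional modules and compact operators -/

/-- A right functional module over a ring `A`: a right `A`-module together with a distinguished
left `A`-submodule `functionals` of the module homomorphisms from it to `A`. -/
structure FModule (A : Type u) [NonUnitalRing A] where
  carrier : Type u
  [addCommGroup : AddCommGroup carrier]
  act : carrier →+ A →+ carrier
  act_mul : ∀ ξ a b, act ξ (a * b) = act (act ξ a) b
  functionals : AddSubgroup (carrier →+ A)
  functionals_act : ∀ φ ∈ functionals, ∀ ξ a, φ (act ξ a) = φ ξ * a
  functionals_smul : ∀ (a : A), ∀ φ ∈ functionals, (AddMonoidHom.mulLeft a).comp φ ∈ functionals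

attribute [instance] FModule.addCommGroup

instance (A : Type u) [NonUnitalRing A] : CoeSort (FModule A) (Type u) := ⟨FModule.carrier⟩

namespace FModule

variable {A : Type u} [NonUnitalRing A]

/-- Every element is a finite sum of elements `ξ φ(η)`. -/
def Cofull (E : FModule A) : Prop :=
  ∀ ζ : E, ζ ∈ AddSubgroup.closure
    {z : E | ∃ (ξ η : E), ∃ φ ∈ E.functionals, z = E.act ξ (φ η)}

/-- The functionals separate the points. -/
def Separated (E : FModule A) : Prop :=
  ∀ ξ : E, (∀ φ ∈ E.functionals, φ ξ = 0) → ξ = 0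

/-- The elementary operator `θ_{η,φ} : ξ ↦ η φ(ξ)`. -/
def theta (E : FModule A) (η : E) (φ : E →+ A) : AddMonoid.End E := (E.act η).comp φ

@[simp] theorem theta_apply (E : FModule A) (η : E) (φ : E →+ A) (ξ : E) :
    E.theta η φ ξ = E.act η (φ ξ) := rfl

/-- The ring of compact operators: finite sums of elementary operators. -/
def compacts (E : FModule A) : NonUnitalSubring (AddMonoid.End E) where
  __ := AddSubgroup.closure {T : AddMonoid.End E | ∃ η : E, ∃ φ ∈ E.functionals, T = E.theta η φ}
  mul_mem' := by
    intro a b ha hb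
    change a ∈ AddSubgroup.closure _ at ha
    change b ∈ AddSubgroup.closure _ at hb
    change a * b ∈ AddSubgroup.closure _
    induction ha using AddSubgroup.closure_induction with
    | zero => simp
    | add x y _ _ hx hy => rw [add_mul]; exact add_mem hx hy
    | neg x _ hx => rw [neg_mul]; exact neg_mem hx
    | mem x hx =>
      obtain ⟨η, φ, hφ, rfl⟩ := hx
      induction hb using AddSubgroup.closure_induction with
      | zero => simp
      | add x y _ _ hx hy => rw [mul_add]; exact add_mem hx hy
      | neg x _ hx => rw [mul_neg]; exact neg_mem hx
      | mem x hx =>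
        obtain ⟨ζ, ψ, hψ, rfl⟩ := hx
        refine AddSubgroup.subset_closure ⟨E.act η (φ ζ), ψ, hψ, ?_⟩
        ext ξ
        simp [E.functionals_act φ hφ, E.act_mul]

theorem mem_compacts {E : FModule A} {T : AddMonoid.End E} : T ∈ E.compacts ↔
    T ∈ AddSubgroup.closure {T : AddMonoid.End E | ∃ η : E, ∃ φ ∈ E.functionals, T = E.theta η φ} :=
  Iff.rfl

/-- The ring of adjointable operators: module homomorphisms `T` with `φ ∘ T` a distinguished
functional for every distinguished functional `φ`. -/
def adjointable (E : FModule A) : Subring (AddMonoid.End E) where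
  carrier := {T | (∀ ξ a, T (E.act ξ a) = E.act (T ξ) a) ∧
    ∀ φ ∈ E.functionals, AddMonoidHom.comp φ T ∈ E.functionals}
  mul_mem' := by
    rintro S T ⟨hS, hS'⟩ ⟨hT, hT'⟩
    exact ⟨fun ξ a => by simp [hS, hT], fun φ hφ => hT' _ (hS' φ hφ)⟩
  one_mem' := ⟨fun _ _ => rfl, fun _ h => h⟩
  add_mem' := by
    rintro S T ⟨hS, hS'⟩ ⟨hT, hT'⟩
    refine ⟨fun ξ a => ?_, fun φ hφ => ?_⟩
    · change S _ + T _ = E.act (S ξ + T ξ) a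
      rw [hS, hT, map_add]
      rfl
    have : AddMonoidHom.comp φ (S + T) = AddMonoidHom.comp φ S + AddMonoidHom.comp φ T :=
      AddMonoidHom.ext fun ξ => map_add φ _ _
    rw [this]
    exact add_mem (hS' φ hφ) (hT' φ hφ)
  zero_mem' := by
    refine ⟨fun _ _ => by simp, fun φ _ => ?_⟩
    have : AddMonoidHom.comp φ (0 : AddMonoid.End E) = 0 :=
      AddMonoidHom.ext fun ξ => map_zero φ
    rw [this]
    exact zero_mem _
  neg_mem' := by
    rintro S ⟨hS, hS'⟩
    refine ⟨fun ξ a => ?_, fun φ hφ => ?_⟩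
    · change -S _ = E.act (-S ξ) a
      rw [hS, map_neg]
      rfl
    have : AddMonoidHom.comp φ (-S) = -AddMonoidHom.comp φ S :=
      AddMonoidHom.ext fun ξ => map_neg φ _
    rw [this]
    exact neg_mem (hS' φ hφ)

/-- The ring `A` as a right functional module over itself; the functionals are the left
multiplications by elements of `A`. -/
def self (A : Type u) [NonUnitalRing A] : FModule A where
  carrier := A
  act := AddMonoidHom.mul
  act_mul ξ a b := (mul_assoc ξ a b).symm
  functionals := (AddMonoidHom.mul : A →+ A →+ A).range
  functionals_act := by
    rintro _ ⟨c, rfl⟩ ξ a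
    exact (mul_assoc c ξ a).symm
  functionals_smul := by
    rintro a _ ⟨c, rfl⟩
    exact ⟨a * c, by ext ξ; exact mul_assoc a c ξ⟩

/-- The direct sum of two functional modules, with functionals `φ ⊕ ψ`. -/
def prod (E F : FModule A) : FModule A where
  carrier := E × F
  act := AddMonoidHom.mk' (fun ξ => (E.act ξ.1).prod (F.act ξ.2)) (by
    intro ξ η; ext <;> simp)
  act_mul ξ a b := by simp [E.act_mul, F.act_mul]
  functionals :=
    { carrier := {χ | ∃ φ ∈ E.functionals, ∃ ψ ∈ F.functionals, χ = φ.coprod ψ}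
      add_mem' := by
        rintro _ _ ⟨φ, hφ, ψ, hψ, rfl⟩ ⟨φ', hφ', ψ', hψ', rfl⟩
        refine ⟨φ + φ', add_mem hφ hφ', ψ + ψ', add_mem hψ hψ', ?_⟩
        ext ξ
        exact add_add_add_comm _ _ _ _
      zero_mem' := ⟨0, zero_mem _, 0, zero_mem _, by ext <;> simp⟩
      neg_mem' := by
        rintro _ ⟨φ, hφ, ψ, hψ, rfl⟩
        refine ⟨-φ, neg_mem hφ, -ψ, neg_mem hψ, ?_⟩
        ext ξ
        exact neg_add _ _ }
  functionals_act := by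
    rintro _ ⟨φ, hφ, ψ, hψ, rfl⟩ ξ a
    simp [E.functionals_act φ hφ, F.functionals_act ψ hψ, add_mul]
  functionals_smul := by
    rintro a _ ⟨φ, hφ, ψ, hψ, rfl⟩
    refine ⟨_, E.functionals_smul a φ hφ, _, F.functionals_smul a ψ hψ, ?_⟩
    ext ξ
    exact mul_add a _ _

/-- The functional `η ↦ ∑ i, c i * η i` on finitely supported families. -/
def rowFunctional (A : Type u) [NonUnitalRing A] (I : Type u) : (I → A) →+ ((I →₀ A) →+ A) :=
  AddMonoidHom.mk' (fun c => Finsupp.liftAddHom fun i => AddMonoidHom.mulLeft (c i)) (by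
    intro c d; ext i a; simp [add_mul])

/-- The direct sum `⨁_{i ∈ I} A` of copies of the functional module `A`: finitely supported
families, with functionals `⨁ φ_i` for arbitrary families of functionals `φ_i` on `A`. -/
def copies (A : Type u) [NonUnitalRing A] (I : Type u) : FModule A where
  carrier := I →₀ A
  act := AddMonoidHom.flip (AddMonoidHom.mk'
    (fun a => Finsupp.mapRange.addMonoidHom (AddMonoidHom.mulRight a)) (by
      intro a b; ext i x j; simp [mul_add]))
  act_mul ξ a b := by ext i; simp [mul_assoc]
  functionals := (rowFunctional A I).range
  functionals_act := by
    rintro _ ⟨c, rfl⟩ ξ a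
    induction ξ using Finsupp.induction_linear with
    | zero => simp
    | add x y hx hy => simp only [map_add, AddMonoidHom.add_apply, hx, hy, add_mul]
    | single i x =>
      have h : (Finsupp.mapRange.addMonoidHom (AddMonoidHom.mulRight a) (Finsupp.single i x) :
          I →₀ A) = Finsupp.single i (x * a) := by simp
      change rowFunctional A I c (Finsupp.mapRange.addMonoidHom (AddMonoidHom.mulRight a)
        (Finsupp.single i x)) = rowFunctional A I c (Finsupp.single i x) * a
      rw [h]
      simp only [rowFunctional, AddMonoidHom.mk'_apply, Finsupp.liftAddHom_apply_single,
        AddMonoidHom.coe_mulLeft, mul_assoc]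
  functionals_smul := by
    rintro a _ ⟨c, rfl⟩
    exact ⟨fun i => a * c i, by ext i x; simp [rowFunctional, mul_assoc]⟩

/-- The coordinate `i` of an element of `⨁_{i ∈ I} A`. -/
def coord {I : Type u} (i : I) : copies A I →+ A := Finsupp.applyAddHom (M := A) i

/-- The inclusion of the summand with index `i` of `⨁_{i ∈ I} A`. -/
def single {I : Type u} (i : I) : A →+ copies A I := Finsupp.singleAddHom (M := A) i

theorem copies_ext {I : Type u} {ξ η : copies A I} (h : ∀ i, coord i ξ = coord i η) : ξ = η :=
  Finsupp.ext h

@[simp] theorem coord_act {I : Type u} (η : copies A I) (a : A) (i : I) :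
    coord i ((copies A I).act η a) = coord i η * a := rfl

@[simp] theorem coord_single_same {I : Type u} (i : I) (a : A) : coord i (single i a) = a :=
  Finsupp.single_eq_same

theorem coord_single_of_ne {I : Type u} {i k : I} (h : k ≠ i) (a : A) :
    coord k (single i a) = 0 := Finsupp.single_eq_of_ne h

/-! ### The internal tensor product -/

section tensor

variable {B : Type u} [NonUnitalRing B] (E : FModule A) (F : FModule B)
  (π : A →ₙ+* F.adjointable)

/-- The map `E ⊗ F → F`, `ξ ⊗ η ↦ π(φ(ξ)) η`. -/
def tensorEval (φ : E →+ A) : (E ⊗[ℤ] F) →+ F :=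
  TensorProduct.liftAddHom
    (AddMonoidHom.comp (F.adjointable.subtype.toAddMonoidHom.comp π.toAddMonoidHom) φ :
      E →+ F →+ F)
    (by
      intro r ξ η
      simp only [map_zsmul]
      rfl)

@[simp] theorem tensorEval_tmul (φ : E →+ A) (ξ : E) (η : F) :
    tensorEval E F π φ (ξ ⊗ₜ η) = (π (φ ξ) : AddMonoid.End F) η := rfl

/-- The subgroup of all `∑ ξᵢ ⊗ ηᵢ` such that `∑ π(φ(ξᵢ)) ηᵢ = 0` for all functionals `φ`. -/
def tensorNull : AddSubgroup (E ⊗[ℤ] F) where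
  carrier := {t | ∀ φ ∈ E.functionals, tensorEval E F π φ t = 0}
  add_mem' := fun hs ht φ hφ => by rw [map_add, hs φ hφ, ht φ hφ, add_zero]
  zero_mem' := fun φ _ => map_zero _
  neg_mem' := fun ht φ hφ => by rw [map_neg, ht φ hφ, neg_zero]

/-- Right multiplication by `b` on `E ⊗ F`. -/
def tensorRight (b : B) : (E ⊗[ℤ] F) →+ (E ⊗[ℤ] F) :=
  (TensorProduct.map (LinearMap.id : E →ₗ[ℤ] E)
    (AddMonoidHom.toIntLinearMap (F.act.flip b))).toAddMonoidHom

@[simp] theorem tensorRight_tmul (b : B) (ξ : E) (η : F) :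
    tensorRight E F b (ξ ⊗ₜ η) = ξ ⊗ₜ F.act η b := rfl

theorem tensorEval_right (φ : E →+ A) (b : B) (t : E ⊗[ℤ] F) :
    tensorEval E F π φ (tensorRight E F b t) = F.act (tensorEval E F π φ t) b := by
  induction t using TensorProduct.induction_on with
  | zero => simp
  | add x y hx hy => simp only [map_add, hx, hy, AddMonoidHom.add_apply]
  | tmul ξ η => simpa using (π (φ ξ)).2.1 η b

/-- The right multiplication on the internal tensor product. -/
def tensorAct : ((E ⊗[ℤ] F) ⧸ tensorNull E F π) →+ B →+ ((E ⊗[ℤ] F) ⧸ tensorNull E F π) :=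
  AddMonoidHom.flip (AddMonoidHom.mk'
    (fun b => QuotientAddGroup.map (tensorNull E F π) (tensorNull E F π) (tensorRight E F b) (by
      intro t ht φ hφ
      rw [tensorEval_right, ht φ hφ]; simp)) (by
    intro a b
    ext t
    induction t using TensorProduct.induction_on with
    | zero => simp
    | add x y hx hy => simp only [map_add, hx, hy]
    | tmul ξ η =>
      change ((ξ ⊗ₜ[ℤ] F.act η (a + b) : E ⊗[ℤ] F) : (E ⊗[ℤ] F) ⧸ tensorNull E F π)
        = ((ξ ⊗ₜ[ℤ] F.act η a : E ⊗[ℤ] F) : (E ⊗[ℤ] F) ⧸ tensorNull E F π)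
          + ((ξ ⊗ₜ[ℤ] F.act η b : E ⊗[ℤ] F) : (E ⊗[ℤ] F) ⧸ tensorNull E F π)
      rw [map_add, TensorProduct.tmul_add]; rfl))

theorem tensorAct_mk (t : E ⊗[ℤ] F) (b : B) :
    tensorAct E F π (QuotientAddGroup.mk t) b = QuotientAddGroup.mk (tensorRight E F b t) := rfl

/-- The functional `φ ⊗ ψ`, `ξ ⊗ η ↦ ψ(π(φ(ξ)) η)`. -/
def tensorFunctional (φ : E.functionals) (ψ : F →+ B) :
    ((E ⊗[ℤ] F) ⧸ tensorNull E F π) →+ B :=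
  QuotientAddGroup.lift (tensorNull E F π) (ψ.comp (tensorEval E F π φ)) (by
    intro t ht
    simp [ht φ.1 φ.2])

theorem tensorFunctional_mk (φ : E.functionals) (ψ : F →+ B) (t : E ⊗[ℤ] F) :
    tensorFunctional E F π φ ψ (QuotientAddGroup.mk t) = ψ (tensorEval E F π φ t) := rfl

/-- The internal tensor product `E ⊗_π F`, a right functional `B`-module, whose functionals are the
finite sums of functionals `φ ⊗ ψ`. -/
def tensor : FModule B where
  carrier := (E ⊗[ℤ] F) ⧸ tensorNull E F π
  act := tensorAct E F π
  act_mul := by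
    intro ξ a b
    obtain ⟨t, rfl⟩ := QuotientAddGroup.mk_surjective ξ
    simp only [tensorAct_mk]
    congr 1
    induction t using TensorProduct.induction_on with
    | zero => simp
    | add x y hx hy => simp only [map_add, hx, hy]
    | tmul ξ η => simp [F.act_mul]
  functionals := AddSubgroup.closure
    {χ | ∃ (φ : E.functionals) (ψ : F.functionals), χ = tensorFunctional E F π φ ψ}
  functionals_act := by
    intro χ hχ ξ a
    obtain ⟨t, rfl⟩ := QuotientAddGroup.mk_surjective ξ
    induction hχ using AddSubgroup.closure_induction with
    | zero => simp
    | add x y _ _ hx hy => simp only [AddMonoidHom.add_apply, hx, hy, add_mul]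
    | neg x _ hx => simp only [AddMonoidHom.neg_apply, hx, neg_mul]
    | mem x hx =>
      obtain ⟨φ, ψ, rfl⟩ := hx
      rw [tensorAct_mk, tensorFunctional_mk, tensorFunctional_mk, tensorEval_right,
        F.functionals_act _ ψ.2]
  functionals_smul := by
    intro a χ hχ
    induction hχ using AddSubgroup.closure_induction with
    | zero =>
      rw [AddMonoidHom.comp_zero]; exact zero_mem _
    | add x y _ _ hx hy => rw [AddMonoidHom.comp_add]; exact add_mem hx hy
    | neg x _ hx =>
      have : (AddMonoidHom.mulLeft a).comp (-x) = -(AddMonoidHom.mulLeft a).comp x := by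
        ext; simp
      rw [this]; exact neg_mem hx
    | mem x hx =>
      obtain ⟨φ, ψ, rfl⟩ := hx
      refine AddSubgroup.subset_closure ⟨φ, ⟨_, F.functionals_smul a ψ ψ.2⟩, ?_⟩
      ext t
      rfl

/-- The class of `ξ ⊗ η` in the internal tensor product. -/
def tmk (ξ : E) (η : F) : tensor E F π :=
  (QuotientAddGroup.mk (ξ ⊗ₜ[ℤ] η) : (E ⊗[ℤ] F) ⧸ tensorNull E F π)

end tensor

end FModule

/-! ### Group actions on functional modules -/

/-- A `G`-action on a functional module over a `G`-ring, leaving the functionals invariant. -/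
structure ModAction {G : Type u} [Group G] {A : Type u} [NonUnitalRing A] (α : G →* RingAut A)
    (E : FModule A) where
  S : G →* AddMonoid.End E
  S_act : ∀ g ξ a, S g (E.act ξ a) = E.act (S g ξ) (α g a)
  invariant : ∀ (g : G), ∀ φ ∈ E.functionals,
    ((α g : A ≃+ A).toAddMonoidHom.comp φ).comp (S g⁻¹) ∈ E.functionals

namespace ModAction

variable {G : Type u} [Group G] {A : Type u} [NonUnitalRing A] {α : G →* RingAut A}
  {E F : FModule A}

theorem S_inv_apply (S : ModAction α E) (g : G) (ξ : E) : S.S g⁻¹ (S.S g ξ) = ξ := by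
  have h : S.S g⁻¹ * S.S g = 1 := by rw [← map_mul]; simp
  exact DFunLike.congr_fun h ξ

theorem S_apply_inv (S : ModAction α E) (g : G) (ξ : E) : S.S g (S.S g⁻¹ ξ) = ξ := by
  have h : S.S g * S.S g⁻¹ = 1 := by rw [← map_mul]; simp
  exact DFunLike.congr_fun h ξ

theorem conj_mem (S : ModAction α E) (g : G) {T : AddMonoid.End E} (hT : T ∈ E.compacts) :
    S.S g * T * S.S g⁻¹ ∈ E.compacts := by
  rw [FModule.mem_compacts] at hT
  induction hT using AddSubgroup.closure_induction with
  | zero => simp [zero_mem]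
  | add x y _ _ hx hy => rw [mul_add, add_mul]; exact add_mem hx hy
  | neg x _ hx => rw [mul_neg, neg_mul]; exact neg_mem hx
  | mem x hx =>
    obtain ⟨η, φ, hφ, rfl⟩ := hx
    refine AddSubgroup.subset_closure ⟨S.S g η, _, S.invariant g φ hφ, ?_⟩
    refine AddMonoidHom.ext fun ξ => ?_
    exact S.S_act g η _

/-- The action `Ad(S)` on the compact operators, `(g, T) ↦ S_g ∘ T ∘ S_{g⁻¹}`. -/
def Ad (S : ModAction α E) : G →* RingAut E.compacts where
  toFun g :=
    { toFun := fun T => ⟨S.S g * T * S.S g⁻¹, S.conj_mem g T.2⟩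
      invFun := fun T => ⟨S.S g⁻¹ * T * S.S g, by simpa using S.conj_mem g⁻¹ T.2⟩
      left_inv := fun T => by ext ξ; simp [S_inv_apply]
      right_inv := fun T => by ext ξ; simp [S_apply_inv]
      map_mul' := fun T U => by ext ξ; simp [S_inv_apply]
      map_add' := fun T U => by
        refine Subtype.ext ?_
        change S.S g * ((T : AddMonoid.End E) + U) * S.S g⁻¹ =
          S.S g * (T : AddMonoid.End E) * S.S g⁻¹ + S.S g * (U : AddMonoid.End E) * S.S g⁻¹
        rw [mul_add, add_mul] }
  map_one' := by ext T ξ; simp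
  map_mul' g h := by ext T ξ; simp

/-- The diagonal action on a direct sum. -/
def prod (S : ModAction α E) (T : ModAction α F) : ModAction α (E.prod F) where
  S :=
    { toFun := fun g => AddMonoidHom.prodMap (S.S g) (T.S g)
      map_one' := by
        refine AddMonoidHom.ext fun ξ => ?_
        change (S.S 1 ξ.1, T.S 1 ξ.2) = ξ
        simp
      map_mul' := fun g h => by
        refine AddMonoidHom.ext fun ξ => ?_
        change (S.S (g * h) ξ.1, T.S (g * h) ξ.2) = (S.S g (S.S h ξ.1), T.S g (T.S h ξ.2))
        simp }
  S_act g ξ a := Prod.ext (S.S_act g ξ.1 a) (T.S_act g ξ.2 a)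
  invariant := by
    rintro g _ ⟨φ, hφ, ψ, hψ, rfl⟩
    refine ⟨_, S.invariant g φ hφ, _, T.invariant g ψ hψ, ?_⟩
    refine AddMonoidHom.ext fun ξ => ?_
    exact map_add (α g) _ _

/-- The action on `⨁_{i ∈ I} A` is of the form `α ⊕ T` with respect to the decomposition
`A ⊕ ⨁_{i ≠ i₀} A`; the coordinate `i₀` is then the distinguished one. -/
def IsDistinguished {I : Type u} (U : ModAction α (FModule.copies A I)) (i₀ : I) : Prop :=
  (∀ g (a : A), U.S g (FModule.single i₀ a) = FModule.single i₀ (α g a)) ∧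
  ∀ g (η : FModule.copies A I), FModule.coord i₀ η = 0 → FModule.coord i₀ (U.S g η) = 0

theorem IsDistinguished.coord_S {I : Type u} {U : ModAction α (FModule.copies A I)} {i₀ : I}
    (hU : U.IsDistinguished i₀) (g : G) (η : FModule.copies A I) :
    FModule.coord i₀ (U.S g η) = α g (FModule.coord i₀ η) := by
  have h := hU.2 g (η - FModule.single i₀ (FModule.coord i₀ η)) (by simp)
  rw [map_sub, hU.1, map_sub, FModule.coord_single_same, sub_eq_zero] at h
  exact h

end ModAction

/-! ### Corner embeddings -/

section corner

variable {A : Type u} [NonUnitalRing A]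

/-- The operator `ξ ⊕ η ↦ 0 ⊕ a η_{i₀}` (in the coordinate `i₀`) on `E ⊕ ⨁_{i ∈ I} A`. -/
def cornerOp (E : FModule A) (I : Type u) (i₀ : I) (a : A) :
    AddMonoid.End (E.prod (FModule.copies A I)) :=
  AddMonoidHom.comp (AddMonoidHom.inr E (FModule.copies A I))
    ((FModule.single i₀).comp ((AddMonoidHom.mulLeft a).comp
      ((FModule.coord i₀).comp (AddMonoidHom.snd E (FModule.copies A I)))))

theorem cornerOp_add (E : FModule A) (I : Type u) (i₀ : I) (a b : A) :
    cornerOp E I i₀ (a + b) = cornerOp E I i₀ a + cornerOp E I i₀ b := by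
  refine AddMonoidHom.ext fun x => ?_
  refine Prod.ext (add_zero (0 : E)).symm ?_
  change FModule.single i₀ ((a + b) * FModule.coord i₀ x.2)
    = FModule.single i₀ (a * FModule.coord i₀ x.2) + FModule.single i₀ (b * FModule.coord i₀ x.2)
  rw [add_mul, map_add]

theorem rowFunctional_single {I : Type u} [DecidableEq I] (i₀ : I) (c : A)
    (η : FModule.copies A I) :
    FModule.rowFunctional A I (Pi.single i₀ c) η = c * FModule.coord i₀ η := by
  refine Finsupp.induction_linear (motive := fun η : FModule.copies A I =>
    FModule.rowFunctional A I (Pi.single i₀ c) η = c * FModule.coord i₀ η) η ?_ ?_ ?_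
  · exact (map_zero _).trans (by rw [show FModule.coord i₀ (0 : I →₀ A) = (0 : A) from rfl, mul_zero])
  · intro x y hx hy
    rw [show FModule.coord i₀ (x + y) = FModule.coord i₀ x + FModule.coord i₀ y from rfl, mul_add,
      ← hx, ← hy]
    exact map_add _ _ _
  · intro i x
    change FModule.rowFunctional A I (Pi.single i₀ c) (Finsupp.single i x) =
      c * FModule.coord i₀ (FModule.single i x)
    by_cases h : i = i₀
    · subst h; simp [FModule.rowFunctional]
    · rw [FModule.coord_single_of_ne (Ne.symm h)]; simp [FModule.rowFunctional, h]

theorem cornerOp_mem (hA : IsQuadratik A) (E : FModule A) (I : Type u) (i₀ : I) (a : A) :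
    cornerOp E I i₀ a ∈ (E.prod (FModule.copies A I)).compacts := by
  classical
  let f : A →+ AddMonoid.End (E.prod (FModule.copies A I)) :=
    AddMonoidHom.mk' (cornerOp E I i₀) (cornerOp_add E I i₀)
  change f a ∈ _
  have ha := hA a
  induction ha using AddSubgroup.closure_induction with
  | zero => rw [map_zero]; exact zero_mem _
  | add x y _ _ hx hy => rw [map_add]; exact add_mem hx hy
  | neg x _ hx => rw [map_neg]; exact neg_mem hx
  | mem x hx =>
    obtain ⟨b, c, rfl⟩ := hx
    refine AddSubgroup.subset_closure ⟨((0, FModule.single i₀ b) : E × FModule.copies A I),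
      (0 : E →+ A).coprod (FModule.rowFunctional A I (Pi.single i₀ c)),
      ⟨0, zero_mem _, _, ⟨_, rfl⟩, rfl⟩, ?_⟩
    refine AddMonoidHom.ext fun x => Prod.ext ?_ (FModule.copies_ext fun i => ?_)
    · exact (DFunLike.congr_fun (map_zero E.act) _).symm
    · change FModule.coord i (FModule.single i₀ (b * c * FModule.coord i₀ x.2)) =
        FModule.coord i (FModule.single i₀ b) *
          ((0 : E →+ A) x.1 + FModule.rowFunctional A I (Pi.single i₀ c) x.2)
      rw [rowFunctional_single]
      by_cases h : i = i₀
      · subst h; simp [mul_assoc]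
      · simp [FModule.coord_single_of_ne h]

/-- The corner homomorphism `A → K_A(E ⊕ ⨁_{i ∈ I} A)`, acting by multiplication on the
coordinate `i₀`. -/
def cornerHom (hA : IsQuadratik A) (E : FModule A) (I : Type u) (i₀ : I) :
    A →ₙ+* (E.prod (FModule.copies A I)).compacts where
  toFun a := ⟨cornerOp E I i₀ a, cornerOp_mem hA E I i₀ a⟩
  map_mul' a b := by
    refine Subtype.ext (AddMonoidHom.ext fun x => Prod.ext rfl ?_)
    change FModule.single i₀ (a * b * FModule.coord i₀ x.2)
      = FModule.single i₀ (a * FModule.coord i₀ (FModule.single i₀ (b * FModule.coord i₀ x.2)))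
    simp [mul_assoc]
  map_zero' := by
    refine Subtype.ext (AddMonoidHom.ext fun x => Prod.ext rfl ?_)
    change FModule.single i₀ (0 * FModule.coord i₀ x.2) = 0
    simp
  map_add' a b := Subtype.ext (cornerOp_add E I i₀ a b)

theorem cornerHom_equivariant {G : Type u} [Group G] {α : G →* RingAut A} (hA : IsQuadratik A)
    {E : FModule A} (S : ModAction α E) {I : Type u} {i₀ : I}
    (U : ModAction α (FModule.copies A I)) (hU : U.IsDistinguished i₀) (g : G) (a : A) :
    cornerHom hA E I i₀ (α g a) = (S.prod U).Ad g (cornerHom hA E I i₀ a) := by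
  refine Subtype.ext (AddMonoidHom.ext fun x => Prod.ext (map_zero (S.S g)).symm ?_)
  change FModule.single i₀ (α g a * FModule.coord i₀ x.2)
    = U.S g (FModule.single i₀ (a * FModule.coord i₀ (U.S g⁻¹ x.2)))
  have h : α g (α g⁻¹ (FModule.coord i₀ x.2)) = FModule.coord i₀ x.2 := by
    rw [← RingAut.mul_apply, ← map_mul]; simp
  rw [hU.1, hU.coord_S, map_mul (α g), h]

end corner

/-- An equivariant homomorphism `e : A → K` is a corner embedding if, up to an equivariant ring
isomorphism `K ≅ K_A(E ⊕ H_A)`, it is the multiplication on the distinguished coordinate of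
`H_A = ⨁_{i ∈ I} A`, where `E ⊕ H_A` is cofull. -/
def IsCorner {G : Type u} [Group G] {A K : QRing G} (e : EHom A K) : Prop :=
  ∃ (E : FModule A) (S : ModAction A.action E) (I : Type u) (i₀ : I)
    (U : ModAction A.action (FModule.copies A I)) (_ : U.IsDistinguished i₀)
    (_ : (E.prod (FModule.copies A I)).Cofull)
    (κ : K ≃+* (E.prod (FModule.copies A I)).compacts),
    (∀ g x, κ (K.action g x) = (S.prod U).Ad g (κ x)) ∧
    ∀ a, κ (e.toHom a) = cornerHom A.quadratik E I i₀ a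

/-! ### Crossed products -/

section crossed

variable {G : Type u} [Group G] {A : Type u} [NonUnitalRing A]

/-- The crossed product `A ⋊_α G`: finitely supported functions `G → A`;
`Crossed.mk α a g` is the element `a ⋊ g`. -/
def Crossed (_α : G →* RingAut A) : Type u := G →₀ A

namespace Crossed

variable (α : G →* RingAut A)

instance : AddCommGroup (Crossed α) := inferInstanceAs (AddCommGroup (G →₀ A))

/-- The element `a ⋊ g`. -/
def mk (a : A) (g : G) : Crossed α := (Finsupp.single g a : G →₀ A)

/-- The coefficient at `g`. -/
def coeff {α : G →* RingAut A} (x : Crossed α) (g : G) : A := (show G →₀ A from x) g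

/-- The additive map out of the crossed product with given values on the `a ⋊ g`. -/
def lift {M : Type u} [AddCommGroup M] (f : G → A →+ M) : Crossed α →+ M :=
  Finsupp.liftAddHom (M := A) (N := M) f

@[simp] theorem lift_mk {M : Type u} [AddCommGroup M] (f : G → A →+ M) (a : A) (g : G) :
    lift α f (mk α a g) = f g a := Finsupp.liftAddHom_apply_single _ _ _

def mkHom (g : G) : A →+ Crossed α := Finsupp.singleAddHom g

@[simp] theorem mkHom_apply (a : A) (g : G) : mkHom α g a = mk α a g := rfl

theorem induction {α : G →* RingAut A} {p : Crossed α → Prop} (x : Crossed α) (h0 : p 0)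
    (hadd : ∀ x y, p x → p y → p (x + y)) (hmk : ∀ a g, p (mk α a g)) : p x :=
  Finsupp.induction_linear (motive := p) x h0 hadd (fun g a => hmk a g)

/-- Convolution: `(a ⋊ g) (b ⋊ h) = a α_g(b) ⋊ g h`. -/
def mulHom : Crossed α →+ Crossed α →+ Crossed α :=
  lift α fun g => AddMonoidHom.mk' (fun a => lift α fun h =>
    (mkHom α (g * h)).comp ((AddMonoidHom.mulLeft a).comp (α g : A ≃+ A).toAddMonoidHom)) (by
      intro a b
      refine AddMonoidHom.ext fun x => ?_
      induction x using induction with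
      | h0 => simp
      | hadd x y hx hy => rw [map_add, hx, hy, map_add]
      | hmk c h =>
        simp only [AddMonoidHom.add_apply, lift_mk, AddMonoidHom.comp_apply,
          AddMonoidHom.coe_mulLeft, add_mul, map_add])

instance : Mul (Crossed α) := ⟨fun x y => mulHom α x y⟩

theorem mul_def (x y : Crossed α) : x * y = mulHom α x y := rfl

theorem mk_mul_mk (a b : A) (g h : G) :
    mk α a g * mk α b h = mk α (a * α g b) (g * h) := by
  rw [mul_def, mulHom, lift_mk]
  simp

instance : NonUnitalRing (Crossed α) where
  left_distrib x y z := by simp [mul_def]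
  right_distrib x y z := by simp [mul_def]
  zero_mul x := by simp [mul_def]
  mul_zero x := by simp [mul_def]
  mul_assoc x y z := by
    have hl : ∀ x y z : Crossed α, (x + y) * z = x * z + y * z := by simp [mul_def]
    have hr : ∀ x y z : Crossed α, x * (y + z) = x * y + x * z := by simp [mul_def]
    have h0 : ∀ x : Crossed α, 0 * x = 0 := by simp [mul_def]
    have h1 : ∀ x : Crossed α, x * 0 = 0 := by simp [mul_def]
    induction x using induction with
    | h0 => simp only [h0]
    | hadd x x' hx hx' => simp only [hl, hx, hx']
    | hmk a g =>
      induction y using induction with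
      | h0 => simp only [h0, h1]
      | hadd y y' hy hy' => simp only [hl, hr, hy, hy']
      | hmk b h =>
        induction z using induction with
        | h0 => simp only [h1]
        | hadd z z' hz hz' => simp only [hr, hz, hz']
        | hmk c k => simp [mk_mul_mk, mul_assoc]

theorem quadratik (hA : IsQuadratik A) : IsQuadratik (Crossed α) := by
  intro x
  induction x using induction with
  | h0 => exact zero_mem _
  | hadd x y hx hy => exact add_mem hx hy
  | hmk a g =>
    change mkHom α g a ∈ _
    have ha := hA a
    induction ha using AddSubgroup.closure_induction with
    | zero => rw [map_zero]; exact zero_mem _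
    | add x y _ _ hx hy => rw [map_add]; exact add_mem hx hy
    | neg x _ hx => rw [map_neg]; exact neg_mem hx
    | mem x hx =>
      obtain ⟨b, c, rfl⟩ := hx
      refine AddSubgroup.subset_closure ⟨mk α b g, mk α (α g⁻¹ c) 1, ?_⟩
      have h : α g (α g⁻¹ c) = c := by
        rw [← RingAut.mul_apply, ← map_mul]; simp
      rw [mk_mul_mk, h, mul_one]
      rfl

/-- The homomorphism `π ⋊ 1`, `a ⋊ g ↦ π(a) ⋊ g`, of an equivariant homomorphism `π`. -/
def map {B : Type u} [NonUnitalRing B] {α : G →* RingAut A} {β : G →* RingAut B}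
    (π : A →ₙ+* B) (hπ : ∀ g a, π (α g a) = β g (π a)) : Crossed α →ₙ+* Crossed β where
  __ := lift α fun g => (mkHom β g).comp π.toAddMonoidHom
  map_mul' x y := by
    change lift α (fun g => (mkHom β g).comp π.toAddMonoidHom) (x * y) =
      lift α (fun g => (mkHom β g).comp π.toAddMonoidHom) x *
      lift α (fun g => (mkHom β g).comp π.toAddMonoidHom) y
    induction x using induction with
    | h0 => simp
    | hadd x x' hx hx' => simp only [add_mul, map_add, hx, hx']
    | hmk a g =>
      induction y using induction with
      | h0 => simp
      | hadd y y' hy hy' => simp only [mul_add, map_add, hy, hy']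
      | hmk b h =>
        rw [mk_mul_mk, lift_mk, lift_mk, lift_mk]
        change mk β (π (a * α g b)) (g * h) = mk β (π a) g * mk β (π b) h
        rw [mk_mul_mk, map_mul, hπ]

theorem map_mk {B : Type u} [NonUnitalRing B] {α : G →* RingAut A} {β : G →* RingAut B}
    (π : A →ₙ+* B) (hπ : ∀ g a, π (α g a) = β g (π a)) (a : A) (g : G) :
    map π hπ (mk α a g) = mk β (π a) g := lift_mk _ _ _ _

theorem coeff_map {B : Type u} [NonUnitalRing B] {α : G →* RingAut A} {β : G →* RingAut B}
    (π : A →ₙ+* B) (hπ : ∀ g a, π (α g a) = β g (π a)) (x : Crossed α) (g : G) :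
    coeff (map π hπ x) g = π (coeff x g) := by
  classical
  induction x using induction with
  | h0 => rw [map_zero]; exact (map_zero π).symm
  | hadd x y hx hy =>
    rw [map_add]
    change coeff (map π hπ x) g + coeff (map π hπ y) g = π (coeff x g + coeff y g)
    rw [hx, hy, map_add]
  | hmk a h =>
    rw [map_mk]
    change (Finsupp.single h (π a) : G →₀ B) g = π ((Finsupp.single h a : G →₀ A) g)
    rw [Finsupp.single_apply, Finsupp.single_apply]
    split_ifs <;> simp

theorem ext {α : G →* RingAut A} {x y : Crossed α} (h : ∀ g, coeff x g = coeff y g) : x = y :=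
  Finsupp.ext h

theorem map_injective {B : Type u} [NonUnitalRing B] {α : G →* RingAut A} {β : G →* RingAut B}
    (π : A →ₙ+* B) (hπ : ∀ g a, π (α g a) = β g (π a)) (h : Function.Injective π) :
    Function.Injective (map π hπ) := fun x y hxy => ext fun g => h (by
  rw [← coeff_map π hπ, ← coeff_map π hπ, hxy])

theorem map_exact {B C : Type u} [NonUnitalRing B] [NonUnitalRing C] {α : G →* RingAut A}
    {β : G →* RingAut B} {γ : G →* RingAut C}
    (j : A →ₙ+* B) (hj : ∀ g a, j (α g a) = β g (j a))
    (f : B →ₙ+* C) (hf : ∀ g a, f (β g a) = γ g (f a)) (h : ∀ m, f m = 0 ↔ ∃ a, j a = m)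
    (x : Crossed β) : map f hf x = 0 ↔ ∃ y, map j hj y = x := by
  classical
  constructor
  · intro hx
    have hx' : ∀ g, ∃ a, j a = coeff x g := fun g => (h _).1 (by
      rw [← coeff_map f hf, hx]; rfl)
    choose a ha using hx'
    refine ⟨∑ g ∈ (show G →₀ B from x).support, mk α (a g) g, ?_⟩
    rw [map_sum]
    simp only [map_mk, ha]
    exact Finsupp.sum_single (show G →₀ B from x)
  · rintro ⟨y, rfl⟩
    refine ext fun g => ?_
    rw [coeff_map, coeff_map]
    exact (h _).2 ⟨_, rfl⟩

/-- The operator `V_g` on `A ⋊ G`, `V_g(b ⋊ h) = α_g(b) ⋊ g h`. -/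
def V (g : G) : Crossed α →+ Crossed α :=
  lift α fun h => (mkHom α (g * h)).comp (α g : A ≃+ A).toAddMonoidHom

theorem V_mk (g : G) (b : A) (h : G) : V α g (mk α b h) = mk α (α g b) (g * h) := lift_mk _ _ _ _

/-- The left multiplication of `A` on the functional `A ⋊ G`-module `A ⋊ G`,
`a (b ⋊ h) = a b ⋊ h`. -/
def leftMul : A →ₙ+* (FModule.self (Crossed α)).adjointable where
  toFun a := ⟨(AddMonoidHom.mulLeft (mk α a 1) : Crossed α →+ Crossed α), by
    refine ⟨fun ξ b => (mul_assoc (mk α a 1) ξ b).symm, ?_⟩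
    rintro _ ⟨c, rfl⟩
    exact ⟨c * mk α a 1, AddMonoidHom.ext fun ξ => mul_assoc c (mk α a 1) ξ⟩⟩
  map_mul' a b := by
    refine Subtype.ext (AddMonoidHom.ext fun (x : Crossed α) => ?_)
    change mk α (a * b) 1 * x = mk α a 1 * (mk α b 1 * x)
    rw [← mul_assoc, mk_mul_mk]
    simp
  map_zero' := by
    refine Subtype.ext (AddMonoidHom.ext fun (x : Crossed α) => ?_)
    change mkHom α 1 0 * x = 0
    rw [map_zero, zero_mul]
  map_add' a b := by
    refine Subtype.ext (AddMonoidHom.ext fun (x : Crossed α) => ?_)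
    change mkHom α 1 (a + b) * x = mkHom α 1 a * x + mkHom α 1 b * x
    rw [map_add, add_mul]

end Crossed

/-- The functional `A ⋊ G`-module `E ⊗_A (A ⋊ G)`. -/
def descentModule (α : G →* RingAut A) (E : FModule A) : FModule (Crossed α) :=
  FModule.tensor E (FModule.self (Crossed α)) (Crossed.leftMul α)

/-- The element `ξ ⊗ x` of `E ⊗_A (A ⋊ G)`. -/
def descentTmul (α : G →* RingAut A) (E : FModule A) (ξ : E) (x : Crossed α) :
    descentModule α E :=
  FModule.tmk E (FModule.self (Crossed α)) (Crossed.leftMul α) ξ x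

/-- `σ(T ⋊ g) = (T ⊗ 1) ∘ (S_g ⊗ V_g)`, as operators on `E ⊗_A (A ⋊ G)`. -/
def IsDescentIso {α : G →* RingAut A} {E : FModule A} (S : ModAction α E)
    (σ : Crossed S.Ad → (descentModule α E).compacts) : Prop :=
  ∀ (T : E.compacts) (g : G) (ξ : E) (x : Crossed α),
    (σ (Crossed.mk S.Ad T g) : AddMonoid.End (descentModule α E)) (descentTmul α E ξ x) =
      descentTmul α E ((T : AddMonoid.End E) (S.S g ξ)) (Crossed.V α g x)

end crossed

/-! ### Constructions with equivariant quadratik rings -/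

section rings

variable {G : Type u} [Group G]

/-- The direct sum of two equivariant rings. -/
def QRing.prod (A B : QRing G) : QRing G where
  carrier := A × B
  action :=
    { toFun := fun g => RingEquiv.prodCongr (A.action g) (B.action g)
      map_one' := by ext x <;> simp
      map_mul' := fun g h => by ext x <;> simp }
  quadratik := by
    intro x
    have h1 : ∀ a : A, ((a, 0) : A × B) ∈
        AddSubgroup.closure {z : A × B | ∃ b c : A × B, z = b * c} := by
      intro a
      change AddMonoidHom.inl A B a ∈ _
      have h := A.quadratik a
      induction h using AddSubgroup.closure_induction with
      | zero => rw [map_zero]; exact zero_mem _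
      | add x y _ _ hx hy => rw [map_add]; exact add_mem hx hy
      | neg x _ hx => rw [map_neg]; exact neg_mem hx
      | mem x hx =>
        obtain ⟨b, c, rfl⟩ := hx
        exact AddSubgroup.subset_closure ⟨(b, 0), (c, 0), by ext <;> simp⟩
    have h2 : ∀ a : B, ((0, a) : A × B) ∈
        AddSubgroup.closure {z : A × B | ∃ b c : A × B, z = b * c} := by
      intro a
      change AddMonoidHom.inr A B a ∈ _
      have h := B.quadratik a
      induction h using AddSubgroup.closure_induction with
      | zero => rw [map_zero]; exact zero_mem _
      | add x y _ _ hx hy => rw [map_add]; exact add_mem hx hy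
      | neg x _ hx => rw [map_neg]; exact neg_mem hx
      | mem x hx =>
        obtain ⟨b, c, rfl⟩ := hx
        exact AddSubgroup.subset_closure ⟨(0, b), (0, c), by ext <;> simp⟩
    have hx : x = (x.1, 0) + (0, x.2) := by ext <;> simp
    rw [hx]
    exact add_mem (h1 _) (h2 _)

def EHom.fst (A B : QRing G) : EHom (A.prod B) A := ⟨NonUnitalRingHom.fst A B, fun _ _ => rfl⟩

def EHom.snd (A B : QRing G) : EHom (A.prod B) B := ⟨NonUnitalRingHom.snd A B, fun _ _ => rfl⟩

def EHom.inl (A B : QRing G) : EHom A (A.prod B) :=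
  ⟨NonUnitalRingHom.prod (NonUnitalRingHom.id A) 0, fun g _ =>
    Prod.ext rfl (map_zero (B.action g)).symm⟩

def EHom.inr (A B : QRing G) : EHom B (A.prod B) :=
  ⟨NonUnitalRingHom.prod 0 (NonUnitalRingHom.id B), fun g _ =>
    Prod.ext (map_zero (A.action g)).symm rfl⟩

/-- Evaluation at time `t`, as a map `B ⊗ C[0,1] → B ⊗ ℂ`. -/
def evalAt (B : Type u) [NonUnitalRing B] (t : unitInterval) :
    B ⊗[ℤ] C(unitInterval, ℂ) →ₗ[ℤ] B ⊗[ℤ] ℂ :=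
  TensorProduct.map LinearMap.id
    (AddMonoidHom.toIntLinearMap ⟨⟨fun f => f t, rfl⟩, fun _ _ => rfl⟩)

/-- Two equivariant homomorphisms `f₀, f₁ : A → B` are homotopic if there is an equivariant ring
homomorphism `f : A → B ⊗ C[0,1]` (trivial action on `C[0,1] = C([0,1], ℂ)`) whose evaluations at
the end points are `a ↦ f₀(a) ⊗ 1` and `a ↦ f₁(a) ⊗ 1` in `B ⊗ ℂ`. -/
def Homotopic {A B : QRing G} (f₀ f₁ : EHom A B) : Prop :=
  ∃ f : A →ₙ+* (B ⊗[ℤ] C(unitInterval, ℂ)),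
    (∀ g a, f (A.action g a) = TensorProduct.map
      (AddMonoidHom.toIntLinearMap (B.action g : B ≃+ B).toAddMonoidHom) LinearMap.id (f a)) ∧
    (∀ a, evalAt B 0 (f a) = f₀.toHom a ⊗ₜ[ℤ] (1 : ℂ)) ∧
    ∀ a, evalAt B 1 (f a) = f₁.toHom a ⊗ₜ[ℤ] (1 : ℂ)

/-- Equivariant split exact sequences `0 → B → M → A → 0` with split `s : A → M`. -/
structure SplitExact (G : Type u) [Group G] where
  B : QRing G
  M : QRing G
  A : QRing G
  j : EHom B M
  f : EHom M A
  s : EHom A M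
  injective : Function.Injective j.toHom
  exact : ∀ m, f.toHom m = 0 ↔ ∃ b, j.toHom b = m
  split : ∀ a, f.toHom (s.toHom a) = a

end rings

/-! ### The category `GK^G` -/

/-- Words in the generating morphisms: equivariant ring homomorphisms, formal inverses of corner
embeddings, formal splits `Δ` of split exact sequences, identities, composition and addition. -/
inductive Word (G : Type u) [Group G] : QRing G → QRing G → Type (u + 1)
  | hom {A B : QRing G} (f : EHom A B) : Word G A B
  | cornerInv {A K : QRing G} (e : EHom A K) (he : IsCorner e) : Word G K A
  | delta (s : SplitExact G) : Word G s.M s.B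
  | one (A : QRing G) : Word G A A
  | comp {A B C : QRing G} (x : Word G A B) (y : Word G B C) : Word G A C
  | zero (A B : QRing G) : Word G A B
  | add {A B : QRing G} (x y : Word G A B) : Word G A B
  | neg {A B : QRing G} (x : Word G A B) : Word G A B

/-- The relations of `GK^G`. Composition is written from left to right. -/
inductive Rel {G : Type u} [Group G] : {A B : QRing G} → Word G A B → Word G A B → Prop
  -- equivalence relation and congruence
  | refl {A B : QRing G} (x : Word G A B) : Rel x x
  | symm {A B : QRing G} {x y : Word G A B} : Rel x y → Rel y x
  | trans {A B : QRing G} {x y z : Word G A B} : Rel x y → Rel y z → Rel x z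
  | comp_congr {A B C : QRing G} {x x' : Word G A B} {y y' : Word G B C} :
      Rel x x' → Rel y y' → Rel (x.comp y) (x'.comp y')
  | add_congr {A B : QRing G} {x x' y y' : Word G A B} :
      Rel x x' → Rel y y' → Rel (x.add y) (x'.add y')
  | neg_congr {A B : QRing G} {x x' : Word G A B} : Rel x x' → Rel x.neg x'.neg
  -- category with bilinear composition
  | comp_assoc {A B C D : QRing G} (x : Word G A B) (y : Word G B C) (z : Word G C D) :
      Rel ((x.comp y).comp z) (x.comp (y.comp z))
  | one_comp {A B : QRing G} (x : Word G A B) : Rel ((Word.one A).comp x) x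
  | comp_one {A B : QRing G} (x : Word G A B) : Rel (x.comp (Word.one B)) x
  | add_assoc {A B : QRing G} (x y z : Word G A B) : Rel ((x.add y).add z) (x.add (y.add z))
  | add_comm {A B : QRing G} (x y : Word G A B) : Rel (x.add y) (y.add x)
  | zero_add {A B : QRing G} (x : Word G A B) : Rel ((Word.zero A B).add x) x
  | neg_add {A B : QRing G} (x : Word G A B) : Rel (x.neg.add x) (Word.zero A B)
  | comp_add {A B C : QRing G} (x : Word G A B) (y z : Word G B C) :
      Rel (x.comp (y.add z)) ((x.comp y).add (x.comp z))
  | add_comp {A B C : QRing G} (x y : Word G A B) (z : Word G B C) :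
      Rel ((x.add y).comp z) ((x.comp z).add (y.comp z))
  -- composition of ring homomorphisms
  | hom_comp {A B C : QRing G} (f : EHom A B) (h : EHom B C) :
      Rel ((Word.hom f).comp (Word.hom h)) (Word.hom (f.comp h))
  -- unit
  | hom_id (A : QRing G) : Rel (Word.hom (EHom.id A)) (Word.one A)
  -- additive category
  | biprod (A B : QRing G) :
      Rel (Word.one (A.prod B))
        (((Word.hom (EHom.fst A B)).comp (Word.hom (EHom.inl A B))).add
          ((Word.hom (EHom.snd A B)).comp (Word.hom (EHom.inr A B))))
  -- homotopy invariance
  | homotopy {A B : QRing G} (f₀ f₁ : EHom A B) :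
      Homotopic f₀ f₁ → Rel (Word.hom f₀) (Word.hom f₁)
  -- stability
  | corner_left {A K : QRing G} (e : EHom A K) (he : IsCorner e) :
      Rel ((Word.hom e).comp (Word.cornerInv e he)) (Word.one A)
  | corner_right {A K : QRing G} (e : EHom A K) (he : IsCorner e) :
      Rel ((Word.cornerInv e he).comp (Word.hom e)) (Word.one K)
  -- split exactness
  | split_left (s : SplitExact G) :
      Rel ((Word.hom s.j).comp (Word.delta s)) (Word.one s.B)
  | split_right (s : SplitExact G) :
      Rel (((Word.delta s).comp (Word.hom s.j)).add ((Word.hom s.f).comp (Word.hom s.s)))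
        (Word.one s.M)

/-- The objects of the category `GK^G`: all `G`-equivariant quadratik rings. -/
@[ext]
structure GK (G : Type u) [Group G] where
  ring : QRing G

namespace GK

variable {G : Type u} [Group G]

instance setoid (A B : QRing G) : Setoid (Word G A B) :=
  ⟨Rel, ⟨Rel.refl, Rel.symm, Rel.trans⟩⟩

/-- Morphisms of `GK^G`: words modulo relations. -/
def Hom (A B : GK G) : Type (u + 1) := Quotient (setoid A.ring B.ring)

/-- The morphism represented by a word. -/
def cls {A B : GK G} (x : Word G A.ring B.ring) : Hom A B := Quotient.mk _ x

instance (A B : GK G) : Zero (Hom A B) := ⟨cls (Word.zero A.ring B.ring)⟩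

instance (A B : GK G) : Add (Hom A B) :=
  ⟨Quotient.map₂ Word.add (fun _ _ h _ _ h' => Rel.add_congr h h')⟩

instance (A B : GK G) : Neg (Hom A B) := ⟨Quotient.map Word.neg (fun _ _ h => Rel.neg_congr h)⟩

instance (A B : GK G) : AddCommGroup (Hom A B) where
  add_assoc := by rintro ⟨x⟩ ⟨y⟩ ⟨z⟩; exact Quotient.sound (Rel.add_assoc x y z)
  add_comm := by rintro ⟨x⟩ ⟨y⟩; exact Quotient.sound (Rel.add_comm x y)
  zero_add := by rintro ⟨x⟩; exact Quotient.sound (Rel.zero_add x)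
  add_zero := by
    rintro ⟨x⟩; exact Quotient.sound ((Rel.add_comm _ _).trans (Rel.zero_add x))
  neg_add_cancel := by rintro ⟨x⟩; exact Quotient.sound (Rel.neg_add x)
  nsmul := nsmulRec
  zsmul := zsmulRec

/-- Composition of morphisms, from left to right. -/
def comp {A B C : GK G} (x : Hom A B) (y : Hom B C) : Hom A C :=
  Quotient.map₂ Word.comp (fun _ _ h _ _ h' => Rel.comp_congr h h') x y

instance : Category.{u + 1} (GK G) where
  Hom A B := Hom A B
  id A := cls (Word.one A.ring)
  comp x y := comp x y
  id_comp := by rintro A B ⟨x⟩; exact Quotient.sound (Rel.one_comp x)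
  comp_id := by rintro A B ⟨x⟩; exact Quotient.sound (Rel.comp_one x)
  assoc := by rintro A B C D ⟨x⟩ ⟨y⟩ ⟨z⟩; exact Quotient.sound (Rel.comp_assoc x y z)

instance (A B : GK G) : AddCommGroup (A ⟶ B) := inferInstanceAs (AddCommGroup (Hom A B))

instance : Preadditive (GK G) where
  add_comp := by rintro A B C ⟨x⟩ ⟨y⟩ ⟨z⟩; exact Quotient.sound (Rel.add_comp x y z)
  comp_add := by rintro A B C ⟨x⟩ ⟨y⟩ ⟨z⟩; exact Quotient.sound (Rel.comp_add x y z)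

/-- The class of an equivariant ring homomorphism. -/
def ofHom {A B : QRing G} (f : EHom A B) : (⟨A⟩ : GK G) ⟶ ⟨B⟩ := cls (Word.hom f)

/-- The synthetical morphism `e⁻¹` of a corner embedding `e`. -/
def cornerInv {A K : QRing G} (e : EHom A K) (he : IsCorner e) : (⟨K⟩ : GK G) ⟶ ⟨A⟩ :=
  cls (Word.cornerInv e he)

/-- The synthetical morphism `Δ` of a split exact sequence. -/
def delta (s : SplitExact G) : (⟨s.M⟩ : GK G) ⟶ ⟨s.B⟩ := cls (Word.delta s)

end GK

/-! ### Descent -/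

section descent

variable {G : Type u} [Group G]

/-- The crossed product `A ⋊ G` as a non-equivariant quadratik ring (that is, with an action of
the trivial group). -/
def descObj (A : QRing G) : QRing PUnit.{u + 1} where
  carrier := Crossed A.action
  action := 1
  quadratik := Crossed.quadratik A.action A.quadratik

/-- The non-equivariant homomorphism `π ⋊ 1`. -/
def descHom {A B : QRing G} (π : EHom A B) : EHom (descObj A) (descObj B) where
  toHom := Crossed.map π.toHom π.equivariant
  equivariant _ _ := rfl

/-- The split exact sequence of the crossed products of a split exact sequence. -/
def descSplit (s : SplitExact G) : SplitExact PUnit.{u + 1} where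
  B := descObj s.B
  M := descObj s.M
  A := descObj s.A
  j := descHom s.j
  f := descHom s.f
  s := descHom s.s
  injective := Crossed.map_injective _ s.j.equivariant s.injective
  exact := Crossed.map_exact _ s.j.equivariant _ s.f.equivariant s.exact
  split x := by
    induction x using Crossed.induction with
    | h0 => exact (congrArg _ (map_zero _)).trans (map_zero _)
    | hadd x y hx hy =>
      exact (congrArg _ (map_add _ x y)).trans ((map_add _ _ _).trans (congrArg₂ (· + ·) hx hy))
    | hmk a g =>
      change Crossed.map _ s.f.equivariant (Crossed.map _ s.s.equivariant (Crossed.mk _ a g)) = _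
      rw [Crossed.map_mk, Crossed.map_mk, s.split]

/-- The defining properties of the descent functor `j^G : GK^G → GK`. -/
structure IsDescentFunctor (F : GK G ⥤ GK PUnit.{u + 1}) : Prop where
  additive : F.Additive
  obj_eq : ∀ A : QRing G, F.obj ⟨A⟩ = ⟨descObj A⟩
  map_ofHom : ∀ {A B : QRing G} (π : EHom A B),
    F.map (GK.ofHom π) =
      eqToHom (obj_eq A) ≫ GK.ofHom (descHom π) ≫ eqToHom (obj_eq B).symm
  map_cornerInv : ∀ {A K : QRing G} (e : EHom A K) (he : IsCorner e),
    ∃ _ : IsIso (GK.ofHom (descHom e)),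
      F.map (GK.cornerInv e he) =
        eqToHom (obj_eq K) ≫ inv (GK.ofHom (descHom e)) ≫ eqToHom (obj_eq A).symm
  map_delta : ∀ s : SplitExact G,
    F.map (GK.delta s) =
      eqToHom (obj_eq s.M) ≫ GK.delta (descSplit s) ≫ eqToHom (obj_eq s.B).symm

end descent

end

end GKT

open GKT

namespace GKT

noncomputable section

/-! ### Compact operators and cofull modules -/

namespace FModule

variable {A : Type u} [NonUnitalRing A] {E : FModule A}

/-! Write `R = A ⋊ G` and `H` for the direct sum of the copies of `A`. By construction of the
internal tensor product, the evaluations `ξ ⊗ x ↦ φ(ξ) x` separate the points of `E ⊗_A R`. Equality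
of vectors and well-definedness of maps are therefore tested inside `R`, where coefficients can be
compared.

Proposition. The operators `T ⊗ 1` and `S_g ⊗ V_g` form a covariant pair, which integrates to
`descentRep`. The central identity is `descentRep_thetaHom_act`: `θ_{ηa,φ} ⋊ g` acts as `z ↦ η ⊗ (a
⋊ g) φ'(z)`, where `φ'` is the translate of `φ` by `g⁻¹`. Since the vectors `η a` span `E`, all
values of the representation are sums of operators `z ↦ η ⊗ r φ(z)`. These are compact because `R`
is quadratik, and they span the compact operators, which gives surjectivity. The kernel is read off
from `coeff_descentRep`: the coefficient at `g h` of `φ(σ(x)(ξ ⊗ (b ⋊ h)))` is `φ(x_g S_g(ξ b))`.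

Corollary (i). If `E ⊕ H` is separated, an element of `A` all of whose left multiples vanish is
zero, and this makes `X` well defined. A functional `r (φ ⊕ (c_i))` is carried by `X` to `r φ ⊕ (r
(c_i ⋊ 1))`, so conjugation preserves compactness. Going back, a family in `R` has to be cut into
its single entries, which works for finite `I`.

Corollary (ii). Here neither separation nor finiteness is available, so the tensor product is
replaced by the module `crossModule` of formal sums `ξ ⋊ g`. On it `K_A(E) ⋊ G` acts faithfully,
with image exactly the compact operators. Moreover only the coordinate `i₀` is split off; the other
copies of `A` are absorbed into the complement. The descended corner embedding thus gets a one-point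
index set.

Descent functor. Crossed products send generators of `GK^G` to generators of `GK`, which defines the
functor on words. The relations that need an argument are those for corner embeddings, for
biproducts (through `(A × B) ⋊ G ≅ A ⋊ G × B ⋊ G`) and for homotopies. Uniqueness holds because
every morphism is represented by a word in generators whose images are prescribed. -/

theorem theta_mem_adjointable (η : E) {φ : E →+ A} (hφ : φ ∈ E.functionals) :
    E.theta η φ ∈ E.adjointable := by
  refine ⟨fun ξ a => ?_, fun ψ hψ => ?_⟩
  · simp only [theta_apply, E.functionals_act φ hφ, E.act_mul]
  · have h : AddMonoidHom.comp ψ (E.theta η φ) = (AddMonoidHom.mulLeft (ψ η)).comp φ :=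
      AddMonoidHom.ext fun ξ => E.functionals_act ψ hψ η (φ ξ)
    rw [h]
    exact E.functionals_smul _ φ hφ

/-- This is what lets `T ⊗ 1` descend to the internal tensor product: `φ ∘ T` has to be a
distinguished functional again. -/
theorem compacts_le_adjointable {T : AddMonoid.End E} (hT : T ∈ E.compacts) :
    T ∈ E.adjointable := by
  rw [mem_compacts] at hT
  refine (AddSubgroup.closure_le (K := E.adjointable.toAddSubgroup)).2 ?_ hT
  rintro _ ⟨η, φ, hφ, rfl⟩
  exact theta_mem_adjointable η hφ

theorem compacts_act (T : E.compacts) (ξ : E) (a : A) :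
    (T : AddMonoid.End E) (E.act ξ a) = E.act ((T : AddMonoid.End E) ξ) a :=
  (compacts_le_adjointable T.2).1 ξ a

theorem theta_mem (η : E) {φ : E →+ A} (hφ : φ ∈ E.functionals) : E.theta η φ ∈ E.compacts :=
  AddSubgroup.subset_closure ⟨η, φ, hφ, rfl⟩

/-- Every element is a finite sum of elements `ξ a`. -/
def Nondegenerate (E : FModule A) : Prop :=
  ∀ ζ : E, ζ ∈ AddSubgroup.closure {z : E | ∃ (ξ : E) (a : A), z = E.act ξ a}

/-- The arguments about `σ` use only this weaker property. It also passes from `E ⊕ F` to `E`, where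
cofullness may be lost because the functionals of `F` drop out. -/
theorem Cofull.nondegenerate (h : E.Cofull) : E.Nondegenerate := fun ζ => by
  refine AddSubgroup.closure_mono ?_ (h ζ)
  rintro _ ⟨ξ, η, φ, _, rfl⟩
  exact ⟨ξ, φ η, rfl⟩

/-- Induction on a nondegenerate module. -/
theorem Nondegenerate.induction (h : E.Nondegenerate) {p : E → Prop} (h0 : p 0)
    (hadd : ∀ x y, p x → p y → p (x + y)) (hneg : ∀ x, p x → p (-x))
    (hact : ∀ ξ a, p (E.act ξ a)) (ζ : E) : p ζ := by
  have hζ := h ζ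
  induction hζ using AddSubgroup.closure_induction with
  | zero => exact h0
  | add x y _ _ hx hy => exact hadd x y hx hy
  | neg x _ hx => exact hneg x hx
  | mem x hx => obtain ⟨ξ, a, rfl⟩ := hx; exact hact ξ a

theorem Nondegenerate.hom_ext (h : E.Nondegenerate) {M : Type*} [AddGroup M] {f f' : E →+ M}
    (hact : ∀ ξ a, f (E.act ξ a) = f' (E.act ξ a)) (ζ : E) : f ζ = f' ζ :=
  h.induction (p := fun ζ => f ζ = f' ζ) (by simp) (by intro x y hx hy; simp [hx, hy])
    (by intro x hx; simp [hx]) hact ζ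

end FModule

/-! ### Crossed products and covariant representations -/

namespace Crossed

variable {G : Type u} [Group G] {A : Type u} [NonUnitalRing A] (α : G →* RingAut A)

theorem hom_ext {α : G →* RingAut A} {M : Type*} [AddGroup M] {f f' : Crossed α →+ M}
    (h : ∀ a g, f (mk α a g) = f' (mk α a g)) (x : Crossed α) : f x = f' x := by
  induction x using Crossed.induction with
  | h0 => simp
  | hadd x y hx hy => simp [hx, hy]
  | hmk a g => exact h a g

theorem mk_add (a b : A) (g : G) : mk α (a + b) g = mk α a g + mk α b g :=
  map_add (mkHom α g) a b

theorem mk_neg (a : A) (g : G) : mk α (-a) g = -mk α a g := map_neg (mkHom α g) a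

@[simp] theorem mk_zero (g : G) : mk α 0 g = 0 := map_zero (mkHom α g)

@[simp] theorem coeff_add {α : G →* RingAut A} (x y : Crossed α) (g : G) :
    coeff (x + y) g = coeff x g + coeff y g := rfl

@[simp] theorem coeff_zero {α : G →* RingAut A} (g : G) : coeff (0 : Crossed α) g = 0 := rfl

@[simp] theorem coeff_mk_same (a : A) (g : G) : coeff (mk α a g) g = a :=
  Finsupp.single_eq_same

theorem coeff_mk_of_ne (a : A) {g h : G} (hgh : h ≠ g) : coeff (mk α a g) h = 0 :=
  Finsupp.single_eq_of_ne hgh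

theorem coeff_mk_mul_of_mul (a : A) (k g h : G) :
    coeff (mk α a (k * h)) (g * h) = coeff (mk α a k) g := by
  by_cases hk : g = k
  · subst hk; simp
  · rw [coeff_mk_of_ne α a hk, coeff_mk_of_ne α a fun h' => hk (mul_right_cancel h')]

theorem mul_induction {α : G →* RingAut A} (hA : IsQuadratik A) {p : Crossed α → Prop} (h0 : p 0)
    (hadd : ∀ x y, p x → p y → p (x + y)) (hneg : ∀ x, p x → p (-x))
    (hmul : ∀ x y, p (x * y)) (x : Crossed α) : p x := by
  have hx := quadratik α hA x
  induction hx using AddSubgroup.closure_induction with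
  | zero => exact h0
  | add x y _ _ hx hy => exact hadd x y hx hy
  | neg x _ hx => exact hneg x hx
  | mem x hx => obtain ⟨y, z, rfl⟩ := hx; exact hmul y z

/-- `V_g` plays the role of left multiplication by `1 ⋊ g`, which need not be an element since `A`
need not be unital; hence it commutes with right multiplications. -/
theorem V_mul_right (g : G) (x y : Crossed α) : V α g (x * y) = V α g x * y := by
  let f : Crossed α →+ Crossed α →+ Crossed α := AddMonoidHom.mul
  refine hom_ext (f := (V α g).comp (f.flip y)) (f' := (f.flip y).comp (V α g)) (fun a h => ?_) x
  refine hom_ext (f := (V α g).comp (f (mk α a h))) (f' := f (V α g (mk α a h))) (fun b k => ?_) y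
  change V α g (mk α a h * mk α b k) = V α g (mk α a h) * mk α b k
  simp only [mk_mul_mk, V_mk, map_mul, mul_assoc, RingAut.mul_apply]

theorem V_mul (g h : G) (x : Crossed α) : V α (g * h) x = V α g (V α h x) := by
  refine hom_ext (f := V α (g * h)) (f' := (V α g).comp (V α h)) (fun a k => ?_) x
  simp [V_mk, mul_assoc, RingAut.mul_apply]

theorem V_one (x : Crossed α) : V α 1 x = x := by
  refine hom_ext (f := V α 1) (f' := AddMonoidHom.id _) (fun a k => ?_) x
  simp [V_mk]

/-- Once a coefficient `a` stands to its left, the multiplier `V_h` is absorbed into a genuine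
element of the crossed product. -/
theorem mk_mul_V (a : A) (g h : G) (x : Crossed α) :
    mk α a g * V α h x = mk α a (g * h) * x := by
  let f : Crossed α →+ Crossed α →+ Crossed α := AddMonoidHom.mul
  refine hom_ext (f := (f (mk α a g)).comp (V α h)) (f' := f (mk α a (g * h))) (fun b k => ?_) x
  change mk α a g * V α h (mk α b k) = mk α a (g * h) * mk α b k
  simp only [V_mk, mk_mul_mk, map_mul, mul_assoc, RingAut.mul_apply]

/-- The homomorphism `a ⋊ g ↦ ρ(a) W_g` of a covariant representation `(ρ, W)`. -/
def covariantHom {N : Type u} [AddCommGroup N] (ρ : A →ₙ+* AddMonoid.End N)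
    (W : G →* AddMonoid.End N) (h : ∀ g a, W g * ρ a = ρ (α g a) * W g) :
    Crossed α →ₙ+* AddMonoid.End N where
  __ := lift α fun g => (AddMonoidHom.mulRight (W g)).comp ρ.toAddMonoidHom
  map_mul' x y := by
    set l : Crossed α →+ AddMonoid.End N :=
      lift α fun g => (AddMonoidHom.mulRight (W g)).comp ρ.toAddMonoidHom with hl
    change l (x * y) = l x * l y
    induction x using Crossed.induction with
    | h0 => simp
    | hadd x x' hx hx' => simp only [add_mul, map_add, hx, hx']
    | hmk a g =>
      induction y using Crossed.induction with
      | h0 => simp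
      | hadd y y' hy hy' => simp only [mul_add, map_add, hy, hy']
      | hmk b k =>
        rw [mk_mul_mk, hl, lift_mk, lift_mk, lift_mk]
        change ρ (a * α g b) * W (g * k) = ρ a * W g * (ρ b * W k)
        rw [map_mul, map_mul, mul_assoc, mul_assoc, ← mul_assoc (W g), h, mul_assoc]

theorem covariantHom_mk {N : Type u} [AddCommGroup N] (ρ : A →ₙ+* AddMonoid.End N)
    (W : G →* AddMonoid.End N) (h : ∀ g a, W g * ρ a = ρ (α g a) * W g) (a : A) (g : G) :
    covariantHom α ρ W h (mk α a g) = ρ a * W g := lift_mk _ _ _ _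

end Crossed

/-! ### The module `E ⊗_A (A ⋊ G)` -/

section descentModule

variable {G : Type u} [Group G] {A : Type u} [NonUnitalRing A] (α : G →* RingAut A)
  (E : FModule A)

/-- The evaluation `ξ ⊗ x ↦ φ(ξ) x`. -/
def descentEval (φ : E.functionals) : descentModule α E →+ Crossed α :=
  FModule.tensorFunctional E (FModule.self (Crossed α)) (Crossed.leftMul α) φ
    (AddMonoidHom.id (Crossed α))

@[simp] theorem descentEval_tmul (φ : E.functionals) (ξ : E) (x : Crossed α) :
    descentEval α E φ (descentTmul α E ξ x) = Crossed.mk α (φ.1 ξ) 1 * x := rfl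

variable {α E}

/-- The subgroup divided out is precisely the common kernel of the evaluations. -/
theorem descent_ext {z w : descentModule α E}
    (h : ∀ φ, descentEval α E φ z = descentEval α E φ w) : z = w := by
  obtain ⟨s, rfl⟩ := QuotientAddGroup.mk_surjective z
  obtain ⟨t, rfl⟩ := QuotientAddGroup.mk_surjective w
  refine QuotientAddGroup.eq.2 fun φ hφ => ?_
  have hst := h ⟨φ, hφ⟩
  rw [map_add, map_neg]
  exact neg_add_eq_zero.2 hst

theorem descent_induction {p : descentModule α E → Prop} (h0 : p 0)
    (hadd : ∀ z w, p z → p w → p (z + w)) (htmul : ∀ ξ x, p (descentTmul α E ξ x))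
    (z : descentModule α E) : p z := by
  obtain ⟨t, rfl⟩ := QuotientAddGroup.mk_surjective z
  induction t using TensorProduct.induction_on with
  | zero => exact h0
  | add s t hs ht => exact hadd _ _ hs ht
  | tmul ξ x => exact htmul ξ x

theorem descent_hom_ext {M : Type*} [AddGroup M] {f f' : descentModule α E →+ M}
    (h : ∀ ξ x, f (descentTmul α E ξ x) = f' (descentTmul α E ξ x)) (z) : f z = f' z :=
  descent_induction (p := fun z => f z = f' z) (by simp) (by intro z w hz hw; simp [hz, hw]) h z

theorem descent_end_ext {T U : AddMonoid.End (descentModule α E)}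
    (h : ∀ ξ x, T (descentTmul α E ξ x) = U (descentTmul α E ξ x)) : T = U :=
  AddMonoidHom.ext (descent_hom_ext h)

variable (α E)

/-- The bilinear map `(ξ, x) ↦ ξ ⊗ x`. -/
def descentTmulHom : E →+ Crossed α →+ descentModule α E :=
  AddMonoidHom.mk' (fun ξ => AddMonoidHom.mk' (descentTmul α E ξ) fun x y => by
      refine descent_ext fun φ => ?_
      simp [mul_add])
    fun ξ η => AddMonoidHom.ext fun x => by
      refine descent_ext fun φ => ?_
      simp [Crossed.mk_add, add_mul]

@[simp] theorem descentTmulHom_apply (ξ : E) (x : Crossed α) :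
    descentTmulHom α E ξ x = descentTmul α E ξ x := rfl

/-- The tensor product is formed over `ℤ`; balancedness over `A` is a consequence of the quotient,
both sides having the evaluations `φ(ξ) a x`. -/
theorem descentTmul_act (ξ : E) (a : A) (x : Crossed α) :
    descentTmul α E (E.act ξ a) x = descentTmul α E ξ (Crossed.mk α a 1 * x) := by
  refine descent_ext fun φ => ?_
  simp [E.functionals_act φ.1 φ.2, ← mul_assoc, Crossed.mk_mul_mk]

theorem descent_act_tmul (ξ : E) (x y : Crossed α) :
    (descentModule α E).act (descentTmul α E ξ x) y = descentTmul α E ξ (x * y) := rfl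

/-- The functionals of `A ⋊ G` over itself are left multiplications by elements `c`, so `φ ⊗ ψ` is
the evaluation at `φ` followed by multiplication with `c`. -/
theorem descent_functionals : (descentModule α E).functionals = AddSubgroup.closure
    {χ | ∃ (c : Crossed α) (φ : E.functionals),
      χ = (AddMonoidHom.mulLeft c).comp (descentEval α E φ)} := by
  change AddSubgroup.closure _ = _
  congr 1
  ext χ
  constructor
  · rintro ⟨φ, ⟨_, ⟨c, rfl⟩⟩, rfl⟩
    exact ⟨c, φ, AddMonoidHom.ext fun z => by
      obtain ⟨t, rfl⟩ := QuotientAddGroup.mk_surjective z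
      rfl⟩
  · rintro ⟨c, φ, rfl⟩
    exact ⟨φ, ⟨_, ⟨c, rfl⟩⟩, AddMonoidHom.ext fun z => by
      obtain ⟨t, rfl⟩ := QuotientAddGroup.mk_surjective z
      rfl⟩

theorem mulLeft_comp_descentEval_mem (c : Crossed α) (φ : E.functionals) :
    (AddMonoidHom.mulLeft c).comp (descentEval α E φ) ∈ (descentModule α E).functionals := by
  rw [descent_functionals]
  exact AddSubgroup.subset_closure ⟨c, φ, rfl⟩

variable {α E}

/-- The additive map `E ⊗ (A ⋊ G) → N` induced by a biadditive map. -/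
def tensorLift {N : Type u} [AddCommGroup N] (f : E →+ Crossed α →+ N) :
    E ⊗[ℤ] FModule.self (Crossed α) →+ N :=
  TensorProduct.liftAddHom (N := FModule.self (Crossed α)) f fun r ξ x => 
    (DFunLike.congr_fun (map_zsmul f r ξ) x).trans (map_zsmul (f ξ) r x).symm

/-- Additive maps out of `E ⊗_A (A ⋊ G)`: a biadditive map `f` descends if the target is separated
by the maps `q` such that `q ∘ f` factors through an evaluation `ξ ⊗ x ↦ φ(ξ) x`. -/
def descentLift {N : Type u} [AddCommGroup N] (f : E →+ Crossed α →+ N)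
    (hf : ∀ n : N, (∀ (q : N →+ Crossed α) (φ : E.functionals) (w : Crossed α →+ Crossed α),
      (∀ ξ x, q (f ξ x) = w (Crossed.mk α (φ.1 ξ) 1 * x)) → q n = 0) → n = 0) :
    descentModule α E →+ N :=
  QuotientAddGroup.lift
    (FModule.tensorNull E (FModule.self (Crossed α)) (Crossed.leftMul α)) (tensorLift f) (by
      intro t ht
      refine hf _ fun q φ w hw => ?_
      have key : q.comp (tensorLift f) = AddMonoidHom.comp w
          (FModule.tensorEval E (FModule.self (Crossed α)) (Crossed.leftMul α) φ.1) := by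
        refine AddMonoidHom.ext fun t => ?_
        induction t using TensorProduct.induction_on with
        | zero => rw [map_zero, map_zero]
        | add s t hs ht => rw [map_add, map_add, hs, ht]
        | tmul ξ x => exact hw ξ x
      refine (DFunLike.congr_fun key t).trans ?_
      exact (congrArg w (ht φ.1 φ.2)).trans (map_zero w))

/-- The operator `f ⊗ v` on `E ⊗_A (A ⋊ G)`. -/
def descentOp (f : AddMonoid.End E) (v : Crossed α →+ Crossed α)
    (h : ∀ φ : E.functionals, ∃ (φ' : E.functionals) (w : Crossed α →+ Crossed α),
      ∀ ξ x, Crossed.mk α (φ.1 (f ξ)) 1 * v x = w (Crossed.mk α (φ'.1 ξ) 1 * x)) :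
    AddMonoid.End (descentModule α E) :=
  descentLift ((AddMonoidHom.comp (descentTmulHom α E) f).compl₂ v) fun n hn => by
    refine descent_ext fun φ => ?_
    obtain ⟨φ', w, hw⟩ := h φ
    rw [map_zero]
    -- The evaluations of the target module serve as the separating maps `q`.
    exact hn (descentEval α E φ) φ' w hw

@[simp] theorem descentOp_tmul (f : AddMonoid.End E) (v : Crossed α →+ Crossed α) (h) (ξ : E)
    (x : Crossed α) : descentOp f v h (descentTmul α E ξ x) = descentTmul α E (f ξ) (v x) := rfl

end descentModule

/-! ### The homomorphism `σ`: construction, surjectivity and kernel -/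

section descentIso

variable {G : Type u} [Group G] {A : Type u} [NonUnitalRing A] {α : G →* RingAut A}
  {E : FModule A}

/-- The action `T ↦ T ⊗ 1` of the compact operators on `E ⊗_A (A ⋊ G)`. -/
def descentCompacts (α : G →* RingAut A) (E : FModule A) :
    E.compacts →ₙ+* AddMonoid.End (descentModule α E) where
  toFun T := descentOp (T : AddMonoid.End E) (AddMonoidHom.id _) fun φ =>
    ⟨⟨_, (FModule.compacts_le_adjointable T.2).2 φ.1 φ.2⟩, AddMonoidHom.id _, fun _ _ => rfl⟩
  map_mul' _ _ := descent_end_ext fun _ _ => rfl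
  map_zero' := descent_end_ext fun _ x =>
    DFunLike.congr_fun (map_zero (descentTmulHom α E)) x
  map_add' T U := descent_end_ext fun ξ x =>
    DFunLike.congr_fun (map_add (descentTmulHom α E) ((T : AddMonoid.End E) ξ)
      ((U : AddMonoid.End E) ξ)) x

namespace ModAction

variable (S : ModAction α E)

/-- The functional `α_g ∘ φ ∘ S_{g⁻¹}`. -/
def translate (g : G) (φ : E.functionals) : E.functionals := ⟨_, S.invariant g φ.1 φ.2⟩

theorem translate_apply (g : G) (φ : E.functionals) (ξ : E) :
    (S.translate g φ).1 ξ = α g (φ.1 (S.S g⁻¹ ξ)) := rfl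

theorem translate_inv_translate (g : G) (φ : E.functionals) :
    S.translate g⁻¹ (S.translate g φ) = φ := by
  refine Subtype.ext (AddMonoidHom.ext fun ξ => ?_)
  rw [translate_apply, translate_apply, inv_inv, S.S_inv_apply, ← RingAut.mul_apply, ← map_mul]
  simp

/-- Both sides equal `(φ(S_g ξ) ⋊ g) x`. This makes `S_g ⊗ V_g` well defined: its evaluation at `φ`
factors through the evaluation at a translate of `φ`. -/
theorem mk_mul_V_translate (g : G) (φ : E.functionals) (ξ : E) (x : Crossed α) :
    Crossed.mk α (φ.1 (S.S g ξ)) 1 * Crossed.V α g x =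
      Crossed.V α g (Crossed.mk α ((S.translate g⁻¹ φ).1 ξ) 1 * x) := by
  rw [Crossed.V_mul_right, Crossed.V_mk, Crossed.mk_mul_V, translate_apply, inv_inv,
    ← RingAut.mul_apply, ← map_mul]
  simp

/-- The action `S ⊗ V` on `E ⊗_A (A ⋊ G)`. -/
def descent : G →* AddMonoid.End (descentModule α E) where
  toFun g := descentOp (S.S g) (Crossed.V α g) fun φ =>
    ⟨S.translate g⁻¹ φ, Crossed.V α g, S.mk_mul_V_translate g φ⟩
  map_one' := descent_end_ext fun ξ x => by
    rw [descentOp_tmul, map_one, Crossed.V_one]; rfl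
  map_mul' g h := descent_end_ext fun ξ x => by
    rw [descentOp_tmul, map_mul, Crossed.V_mul]; rfl

theorem descent_mul_compacts (g : G) (T : E.compacts) :
    S.descent g * descentCompacts α E T = descentCompacts α E (S.Ad g T) * S.descent g :=
  descent_end_ext fun ξ x => by
    change descentTmul α E (S.S g ((T : AddMonoid.End E) ξ)) (Crossed.V α g x) =
      descentTmul α E (S.S g ((T : AddMonoid.End E) (S.S g⁻¹ (S.S g ξ)))) (Crossed.V α g x)
    rw [S.S_inv_apply]

/-- The homomorphism `T ⋊ g ↦ (T ⊗ 1) ∘ (S_g ⊗ V_g)`, with values in the additive maps. -/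
def descentRep : Crossed S.Ad →ₙ+* AddMonoid.End (descentModule α E) :=
  Crossed.covariantHom S.Ad (descentCompacts α E) S.descent S.descent_mul_compacts

theorem descentRep_mk_tmul (T : E.compacts) (g : G) (ξ : E) (x : Crossed α) :
    S.descentRep (Crossed.mk S.Ad T g) (descentTmul α E ξ x) =
      descentTmul α E ((T : AddMonoid.End E) (S.S g ξ)) (Crossed.V α g x) := by
  have h := Crossed.covariantHom_mk S.Ad (descentCompacts α E) S.descent S.descent_mul_compacts T g
  exact DFunLike.congr_fun h (descentTmul α E ξ x)

end ModAction

/-- The operator `z ↦ η ⊗ r φ(z)` on `E ⊗_A (A ⋊ G)`. -/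
def descentTheta (α : G →* RingAut A) (η : E) (φ : E.functionals) :
    Crossed α →+ AddMonoid.End (descentModule α E) :=
  AddMonoidHom.mk' (fun r => (descentTmulHom α E η).comp
    ((AddMonoidHom.mulLeft r).comp (descentEval α E φ))) fun r s => AddMonoidHom.ext fun z => by
      change descentTmulHom α E η ((r + s) * descentEval α E φ z) =
        descentTmulHom α E η (r * descentEval α E φ z) +
          descentTmulHom α E η (s * descentEval α E φ z)
      rw [add_mul, map_add]

theorem descentTheta_apply (η : E) (φ : E.functionals) (r : Crossed α) (z : descentModule α E) :
    descentTheta α η φ r z = descentTmul α E η (r * descentEval α E φ z) := rfl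

theorem theta_tmul (η : E) (φ : E.functionals) (r c : Crossed α) :
    (descentModule α E).theta (descentTmul α E η r)
      ((AddMonoidHom.mulLeft c).comp (descentEval α E φ)) = descentTheta α η φ (r * c) :=
  AddMonoidHom.ext fun z => by
    change descentTmul α E η (r * (c * _)) = descentTmul α E η (r * c * _)
    rw [mul_assoc]

/-- Elementary operators give this form only for products `r c`, with `r` in the vector and `c` in
the functional; a general element is a sum of products. -/
theorem descentTheta_mem (hA : IsQuadratik A) (η : E) (φ : E.functionals) (r : Crossed α) :
    descentTheta α η φ r ∈ (descentModule α E).compacts := by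
  induction r using Crossed.mul_induction hA with
  | h0 => rw [map_zero]; exact zero_mem _
  | hadd x y hx hy => rw [map_add]; exact add_mem hx hy
  | hneg x hx => rw [map_neg]; exact neg_mem hx
  | hmul x y =>
    rw [← theta_tmul]
    exact FModule.theta_mem _ (mulLeft_comp_descentEval_mem α E y φ)

/-- The elementary operators `θ_{η,φ}` as a biadditive map. -/
def thetaHom (E : FModule A) : E →+ E.functionals →+ E.compacts :=
  AddMonoidHom.mk' (fun η => AddMonoidHom.mk' (fun φ => ⟨E.theta η φ.1, FModule.theta_mem η φ.2⟩)
    fun _ _ => Subtype.ext (AddMonoidHom.ext fun _ => map_add (E.act η) _ _))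
    fun η ζ => AddMonoidHom.ext fun _ => Subtype.ext (AddMonoidHom.ext fun _ =>
      DFunLike.congr_fun (map_add E.act η ζ) _)

theorem thetaHom_apply (η : E) (φ : E.functionals) (ξ : E) :
    (thetaHom E η φ : AddMonoid.End E) ξ = E.act η (φ.1 ξ) := rfl

theorem compacts_induction {p : E.compacts → Prop} (h0 : p 0)
    (hadd : ∀ T U, p T → p U → p (T + U)) (hneg : ∀ T, p T → p (-T))
    (htheta : ∀ η φ, p (thetaHom E η φ)) (T : E.compacts) : p T := by
  obtain ⟨T, hT⟩ := T
  rw [FModule.mem_compacts] at hT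
  induction hT using AddSubgroup.closure_induction with
  | zero => exact h0
  | add x y hx hy hx' hy' => exact hadd ⟨x, hx⟩ ⟨y, hy⟩ (hx' hx) (hy' hy)
  | neg x hx hx' => exact hneg ⟨x, hx⟩ (hx' hx)
  | mem x hx => obtain ⟨η, φ, hφ, rfl⟩ := hx; exact htheta η ⟨φ, hφ⟩

namespace ModAction

variable (S : ModAction α E)

/-- In `η a φ(S_g ξ) ⊗ V_g x` the factor `a φ(S_g ξ)` moves across the tensor sign. The translation
identity pulls `V_g` in front of `φ'(ξ) x`, where `φ'` is the translate of `φ` by `g⁻¹`, and `a`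
combines with it to `a ⋊ g`. -/
theorem descentRep_thetaHom_act (η : E) (a : A) (φ : E.functionals) (g : G) :
    S.descentRep (Crossed.mk S.Ad (thetaHom E (E.act η a) φ) g) =
      descentTheta α η (S.translate g⁻¹ φ) (Crossed.mk α a g) :=
  descent_end_ext fun ξ x => by
    rw [descentRep_mk_tmul, descentTheta_apply, thetaHom_apply, descentEval_tmul, ← E.act_mul,
      E.act_mul, descentTmul_act, mk_mul_V_translate, descentTmul_act, Crossed.mk_mul_V, one_mul]

/-- By nondegeneracy it suffices to treat `θ_{ηa,φ} ⋊ g`, whose action is explicit. -/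
theorem descentRep_mem (hA : IsQuadratik A) (hE : E.Nondegenerate) (x : Crossed S.Ad) :
    S.descentRep x ∈ (descentModule α E).compacts := by
  induction x using Crossed.induction with
  | h0 => rw [map_zero]; exact zero_mem _
  | hadd x y hx hy => rw [map_add]; exact add_mem hx hy
  | hmk T g =>
    induction T using compacts_induction with
    | h0 => rw [Crossed.mk_zero, map_zero]; exact zero_mem _
    | hadd x y hx hy => rw [Crossed.mk_add, map_add]; exact add_mem hx hy
    | hneg x hx => rw [Crossed.mk_neg, map_neg]; exact neg_mem hx
    | htheta η φ =>
      induction η using hE.induction with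
      | h0 =>
        rw [map_zero, AddMonoidHom.zero_apply, Crossed.mk_zero, map_zero]; exact zero_mem _
      | hadd x y hx hy =>
        rw [map_add, AddMonoidHom.add_apply, Crossed.mk_add, map_add]; exact add_mem hx hy
      | hneg x hx =>
        rw [map_neg, AddMonoidHom.neg_apply, Crossed.mk_neg, map_neg]; exact neg_mem hx
      | hact η a => rw [descentRep_thetaHom_act]; exact descentTheta_mem hA _ _ _

theorem descentTheta_mem_range (η : E) (φ : E.functionals) (r : Crossed α) :
    descentTheta α η φ r ∈ S.descentRep.toAddMonoidHom.range := by
  induction r using Crossed.induction with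
  | h0 => rw [map_zero]; exact zero_mem _
  | hadd x y hx hy => rw [map_add]; exact add_mem hx hy
  | hmk a g =>
    -- Translating `φ` by `g` beforehand compensates the translation by `g⁻¹` that the
    -- representation produces.
    refine ⟨Crossed.mk S.Ad (thetaHom E (E.act η a) (S.translate g φ)) g, ?_⟩
    refine (S.descentRep_thetaHom_act η a _ g).trans ?_
    rw [translate_inv_translate]

theorem compacts_descent_le_range (T : (descentModule α E).compacts) :
    (T : AddMonoid.End (descentModule α E)) ∈ S.descentRep.toAddMonoidHom.range := by
  induction T using compacts_induction with
  | h0 => exact zero_mem _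
  | hadd x y hx hy => exact add_mem hx hy
  | hneg x hx => exact neg_mem hx
  | htheta z χ =>
    induction z using descent_induction with
    | h0 => rw [map_zero]; exact zero_mem _
    | hadd x y hx hy => rw [map_add]; exact add_mem hx hy
    | htmul η r =>
      obtain ⟨χ, hχ⟩ := χ
      have hχ' := hχ
      rw [descent_functionals] at hχ'
      induction hχ' using AddSubgroup.closure_induction with
      | zero =>
        rw [show (⟨0, hχ⟩ : (descentModule α E).functionals) = 0 from rfl, map_zero]
        exact zero_mem _
      | add x y hx hy hx' hy' =>
        rw [← descent_functionals] at hx hy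
        rw [show (⟨x + y, hχ⟩ : (descentModule α E).functionals) = ⟨x, hx⟩ + ⟨y, hy⟩ from rfl,
          map_add]
        exact add_mem (hx' hx) (hy' hy)
      | neg x hx hx' =>
        rw [← descent_functionals] at hx
        rw [show (⟨-x, hχ⟩ : (descentModule α E).functionals) = -⟨x, hx⟩ from rfl, map_neg]
        exact neg_mem (hx' hx)
      | mem χ h =>
        obtain ⟨c, φ, rfl⟩ := h
        have h := S.descentTheta_mem_range η φ (r * c)
        rw [← theta_tmul] at h
        exact h

/-- The homomorphism `σ : K_A(E) ⋊ G → K_{A ⋊ G}(E ⊗_A (A ⋊ G))`. -/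
def descentSigma (hA : IsQuadratik A) (hE : E.Nondegenerate) :
    Crossed S.Ad →ₙ+* (descentModule α E).compacts :=
  NonUnitalRingHom.codRestrict S.descentRep _ (S.descentRep_mem hA hE)

theorem isDescentIso_descentSigma (hA : IsQuadratik A) (hE : E.Nondegenerate) :
    IsDescentIso S (S.descentSigma hA hE) := S.descentRep_mk_tmul

theorem descentSigma_surjective (hA : IsQuadratik A) (hE : E.Nondegenerate) :
    Function.Surjective (S.descentSigma hA hE) := fun T => by
  obtain ⟨x, hx⟩ := S.compacts_descent_le_range T
  exact ⟨x, Subtype.ext hx⟩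

/-- On `ξ ⊗ (b ⋊ h)` a term `T ⋊ k` contributes only at `k h`, so the coefficient at `g h` isolates
the component of `x` at `g`. The factor `b` ends up inside the argument because `S_g(ξ) α_g(b) =
S_g(ξ b)`. -/
theorem coeff_descentRep (x : Crossed S.Ad) (φ : E.functionals) (ξ : E) (b : A) (g h : G) :
    Crossed.coeff (descentEval α E φ
      (S.descentRep x (descentTmul α E ξ (Crossed.mk α b h)))) (g * h) =
        φ.1 ((Crossed.coeff x g).1 (S.S g (E.act ξ b))) := by
  induction x using Crossed.induction with
  | h0 =>
    rw [map_zero]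
    exact (congrArg (fun z => Crossed.coeff z (g * h)) (map_zero (descentEval α E φ))).trans
      (map_zero φ.1).symm
  | hadd x y hx hy =>
    rw [map_add]
    exact ((congrArg (fun z => Crossed.coeff z (g * h)) (map_add (descentEval α E φ) _ _)).trans
      (congrArg₂ (· + ·) hx hy)).trans (map_add φ.1 _ _).symm
  | hmk T k =>
    rw [descentRep_mk_tmul, descentEval_tmul, Crossed.V_mk, Crossed.mk_mul_mk, one_mul, map_one,
      RingAut.one_apply, Crossed.coeff_mk_mul_of_mul]
    by_cases hk : g = k
    · subst hk
      rw [Crossed.coeff_mk_same, Crossed.coeff_mk_same, S.S_act, FModule.compacts_act,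
        E.functionals_act φ.1 φ.2]
    · rw [Crossed.coeff_mk_of_ne _ _ hk, Crossed.coeff_mk_of_ne _ _ hk]
      exact (map_zero φ.1).symm

theorem descentRep_eq_zero (hE : E.Nondegenerate) (x : Crossed S.Ad) : S.descentRep x = 0 ↔
    ∀ g ξ, ∀ φ ∈ E.functionals, φ ((Crossed.coeff x g).1 ξ) = 0 := by
  constructor
  · intro hx g ξ φ hφ
    -- The coefficient formula tests only the vectors `S_g(ζ b)`; nondegeneracy extends this to all
    -- `S_g ζ`, and `S_g` is onto.
    have h : ∀ ζ : E, φ ((Crossed.coeff x g).1 (S.S g ζ)) = 0 := by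
      refine hE.hom_ext (f := φ.comp ((Crossed.coeff x g).1.comp (S.S g))) (f' := 0) fun ζ b => ?_
      have := S.coeff_descentRep x ⟨φ, hφ⟩ ζ b g 1
      rw [hx] at this
      refine this.symm.trans ?_
      exact congrArg (fun z => Crossed.coeff z (g * 1)) (map_zero (descentEval α E ⟨φ, hφ⟩))
    rw [← S.S_apply_inv g ξ]
    exact h _
  · intro hx
    refine descent_end_ext fun ξ y => ?_
    refine Crossed.hom_ext (f := (S.descentRep x).comp (descentTmulHom α E ξ)) (f' := 0)
      (fun b h => ?_) y
    refine descent_ext fun φ => Crossed.ext fun k => ?_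
    -- Every `k` has the form `g h`, with `g = k h⁻¹`.
    have := S.coeff_descentRep x φ ξ b (k * h⁻¹) h
    rw [inv_mul_cancel_right, hx _ _ φ.1 φ.2] at this
    refine this.trans ?_
    exact (congrArg (fun z => Crossed.coeff z k) (map_zero (descentEval α E φ))).symm

theorem descentSigma_eq_zero (hA : IsQuadratik A) (hE : E.Nondegenerate) (x : Crossed S.Ad) :
    S.descentSigma hA hE x = 0 ↔
      ∀ g ξ, ∀ φ ∈ E.functionals, φ ((Crossed.coeff x g).1 ξ) = 0 := by
  rw [← S.descentRep_eq_zero hE]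
  exact Subtype.ext_iff

theorem descentSigma_bijective (hA : IsQuadratik A) (hE : E.Nondegenerate) (hs : E.Separated) :
    Function.Bijective (S.descentSigma hA hE) := by
  refine ⟨(injective_iff_map_eq_zero _).2 fun x hx => ?_, S.descentSigma_surjective hA hE⟩
  rw [descentSigma_eq_zero] at hx
  exact Crossed.ext fun g => Subtype.ext (AddMonoidHom.ext fun ξ => hs _ (hx g ξ))

end ModAction

/-- Cofullness of `E` is used twice. If `η = η' ψ(ζ)`, then `ξ φ(η) ⊗ x = ξ ⊗ φ(η') ψ(ζ) x`. Writing
`φ(η') ⋊ 1` as a sum of products `r c` turns this into a sum of `(ξ ⊗ r) · c ψ(ζ) x`, where `c ψ(ζ)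
x` is the value of a functional at `ζ ⊗ x`. -/
theorem descentModule_cofull (hA : IsQuadratik A) (hE : E.Cofull) :
    (descentModule α E).Cofull := by
  intro z
  induction z using descent_induction with
  | h0 => exact zero_mem _
  | hadd z w hz hw => exact add_mem hz hw
  | htmul ξ x =>
    set K := AddSubgroup.closure {z : descentModule α E |
      ∃ (ξ η : descentModule α E), ∃ φ ∈ (descentModule α E).functionals,
        z = (descentModule α E).act ξ (φ η)} with hK
    have key : ∀ (ξ η : E) (φ : E.functionals) (r : Crossed α),
        descentTmulHom α E ξ (r * (Crossed.mk α (φ.1 η) 1 * x)) ∈ K := by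
      intro ξ η φ r
      induction r using Crossed.mul_induction hA with
      | h0 => rw [zero_mul, map_zero]; exact zero_mem _
      | hadd r s hr hs => rw [add_mul, map_add]; exact add_mem hr hs
      | hneg r hr => rw [neg_mul, map_neg]; exact neg_mem hr
      | hmul r c =>
        refine AddSubgroup.subset_closure ⟨descentTmul α E ξ r, descentTmul α E η x, _,
          mulLeft_comp_descentEval_mem α E c φ, ?_⟩
        rw [mul_assoc]
        rfl
    have hact : ∀ (ξ η : E) (φ : E.functionals), descentTmulHom α E (E.act ξ (φ.1 η)) x ∈ K := by
      intro ξ η φ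
      have hη := hE η
      induction hη using AddSubgroup.closure_induction with
      | zero => rw [map_zero, map_zero, map_zero]; exact zero_mem _
      | add y z _ _ hy hz => rw [map_add, map_add, map_add]; exact add_mem hy hz
      | neg y _ hy => rw [map_neg, map_neg, map_neg]; exact neg_mem hy
      | mem y hy =>
        obtain ⟨η, ζ, ψ, hψ, rfl⟩ := hy
        have := key ξ ζ ⟨ψ, hψ⟩ (Crossed.mk α (φ.1 η) 1)
        rwa [descentTmulHom_apply, ← descentTmul_act, ← descentTmul_act, ← E.act_mul,
          ← E.functionals_act φ.1 φ.2] at this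
    have hξ := hE ξ
    change descentTmulHom α E ξ x ∈ K
    induction hξ using AddSubgroup.closure_induction with
    | zero => rw [map_zero]; exact zero_mem _
    | add y z _ _ hy hz => rw [map_add]; exact add_mem hy hz
    | neg y _ hy => rw [map_neg]; exact neg_mem hy
    | mem y hy =>
      obtain ⟨η, ζ, ψ, hψ, rfl⟩ := hy
      exact hact η ζ ⟨ψ, hψ⟩

end descentIso

/-! ### Conjugation of compact operators, direct sums and cofullness -/

namespace FModule

variable {A : Type u} [NonUnitalRing A] {E F : FModule A} {I : Type u}

/-- Conjugation of compact operators with an isomorphism of modules that respects functionals. -/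
def compactsConj (X : E ≃+ F) (hX : ∀ ξ a, X (E.act ξ a) = F.act (X ξ) a)
    (hφ : ∀ φ ∈ E.functionals, φ.comp X.symm.toAddMonoidHom ∈ F.functionals) :
    E.compacts →ₙ+* F.compacts where
  toFun T := ⟨X.toAddMonoidHom.comp (AddMonoidHom.comp T.1 X.symm.toAddMonoidHom), by
    induction T using compacts_induction with
    | h0 =>
      have h : X.toAddMonoidHom.comp (AddMonoidHom.comp (0 : E.compacts).1 X.symm.toAddMonoidHom) =
          (0 : F →+ F) := AddMonoidHom.ext fun z => map_zero X
      rw [h]; exact zero_mem F.compacts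
    | hadd T U hT hU =>
      have h := add_mem hT hU
      refine Eq.subst (motive := fun T => T ∈ F.compacts) (AddMonoidHom.ext fun z => ?_) h
      exact (map_add X _ _).symm
    | hneg T hT =>
      refine Eq.subst (motive := fun T => T ∈ F.compacts) (AddMonoidHom.ext fun z => ?_)
        (neg_mem hT)
      exact (map_neg X _).symm
    | htheta η φ =>
      refine Eq.subst (motive := fun T => T ∈ F.compacts) (AddMonoidHom.ext fun z => ?_)
        (theta_mem (X η) (hφ φ.1 φ.2))
      exact (hX _ _).symm⟩
  map_mul' T U := Subtype.ext <| AddMonoidHom.ext fun z =>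
    congrArg (fun w => X (T.1 w)) (X.symm_apply_apply _).symm
  map_zero' := Subtype.ext <| AddMonoidHom.ext fun _ => map_zero X
  map_add' T U := Subtype.ext <| AddMonoidHom.ext fun z =>
    map_add X (T.1 (X.symm z)) (U.1 (X.symm z))

theorem compactsConj_apply (X : E ≃+ F) (hX) (hφ) (T : E.compacts) (z : E) :
    (compactsConj X hX hφ T : AddMonoid.End F) (X z) = X ((T : AddMonoid.End E) z) :=
  congrArg (fun w => X (T.1 w)) (X.symm_apply_apply z)

theorem compactsConj_injective (X : E ≃+ F) (hX) (hφ) :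
    Function.Injective (compactsConj X hX hφ) := fun T U h =>
  Subtype.ext <| AddMonoidHom.ext fun z => X.injective <|
    (compactsConj_apply X hX hφ T z).symm.trans <| (congrArg (fun V : F.compacts =>
      (V : AddMonoid.End F) (X z)) h).trans (compactsConj_apply X hX hφ U z)

theorem compactsConj_bijective (X : E ≃+ F) (hX) (hφ)
    (hψ : ∀ ψ ∈ F.functionals, ψ.comp X.toAddMonoidHom ∈ E.functionals) :
    Function.Bijective (compactsConj X hX hφ) := by
  have hX' : ∀ ξ a, X.symm (F.act ξ a) = E.act (X.symm ξ) a := fun ξ a => by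
    rw [X.symm_apply_eq, hX, X.apply_symm_apply]
  refine ⟨compactsConj_injective X hX hφ, fun T => ⟨compactsConj X.symm hX' hψ T, ?_⟩⟩
  refine Subtype.ext <| AddMonoidHom.ext fun z => ?_
  obtain ⟨z, rfl⟩ := X.surjective z
  refine (compactsConj_apply X hX hφ _ z).trans (X.eq_symm_apply.1 ?_)
  refine Eq.trans ?_ (compactsConj_apply X.symm hX' hψ T (X z))
  rw [X.symm_apply_apply]

theorem copies_hom_ext {M : Type*} [AddGroup M] {f f' : copies A I →+ M}
    (h : ∀ i a, f (single i a) = f' (single i a)) (η : copies A I) : f η = f' η := by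
  refine Finsupp.induction_linear (motive := fun η : copies A I => f η = f' η) η ?_ ?_ h
  · exact (map_zero f).trans (map_zero f').symm
  · intro x y hx hy
    exact (map_add f x y).trans ((congrArg₂ (· + ·) hx hy).trans (map_add f' x y).symm)

theorem rowFunctional_apply_single (c : I → A) (i : I) (a : A) :
    rowFunctional A I c (single i a) = c i * a :=
  Finsupp.liftAddHom_apply_single _ _ _

/-- One copy of `A` provides enough functionals: a product `b c` is the value of left multiplication
by `b` in the coordinate `i₀` on the vector `c` in that coordinate. Hence nondegeneracy of `E` is
enough for `E ⊕ H` to be cofull. -/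
theorem act_mem_cofull (i₀ : I) (hA : IsQuadratik A) (z : E.prod (copies A I)) (a : A) :
    (E.prod (copies A I)).act z a ∈ AddSubgroup.closure
      {z : E.prod (copies A I) | ∃ (ξ η : E.prod (copies A I)),
        ∃ φ ∈ (E.prod (copies A I)).functionals, z = (E.prod (copies A I)).act ξ (φ η)} := by
  classical
  have ha := hA a
  induction ha using AddSubgroup.closure_induction with
  | zero => rw [map_zero]; exact zero_mem _
  | add x y _ _ hx hy => rw [map_add]; exact add_mem hx hy
  | neg x _ hx => rw [map_neg]; exact neg_mem hx
  | mem x hx =>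
    obtain ⟨b, c, rfl⟩ := hx
    refine AddSubgroup.subset_closure ⟨z, (AddMonoidHom.inr E (copies A I)) (single i₀ c),
      (0 : E →+ A).coprod (rowFunctional A I (Pi.single i₀ b)),
      ⟨0, zero_mem _, _, ⟨_, rfl⟩, rfl⟩, ?_⟩
    congr 1
    change b * c = 0 + rowFunctional A I (Pi.single i₀ b) (single i₀ c)
    rw [rowFunctional_apply_single, Pi.single_eq_same, zero_add]

theorem copies_nondegenerate (hA : IsQuadratik A) (I : Type u) : (copies A I).Nondegenerate := by
  intro η
  refine Finsupp.induction_linear (motive := fun η : copies A I => η ∈ AddSubgroup.closure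
    {z : copies A I | ∃ (ξ : copies A I) (a : A), z = (copies A I).act ξ a}) η
      (zero_mem (AddSubgroup.closure _)) (fun x y hx hy => add_mem hx hy) fun i a => ?_
  change single i a ∈ _
  have ha := hA a
  induction ha using AddSubgroup.closure_induction with
  | zero => rw [map_zero]; exact zero_mem _
  | add x y _ _ hx hy => rw [map_add]; exact add_mem hx hy
  | neg x _ hx => rw [map_neg]; exact neg_mem hx
  | mem x hx =>
    obtain ⟨b, c, rfl⟩ := hx
    refine AddSubgroup.subset_closure ⟨single i b, c, copies_ext fun k => ?_⟩
    rw [coord_act]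
    by_cases h : k = i
    · subst h; simp
    · rw [coord_single_of_ne h, coord_single_of_ne h, zero_mul]

theorem prod_act (ξ : E) (η : F) (a : A) :
    (E.prod F).act ((ξ, η) : E × F) a = ((E.act ξ a, F.act η a) : E × F) := rfl

theorem Nondegenerate.prod (hE : E.Nondegenerate) (hF : F.Nondegenerate) :
    (E.prod F).Nondegenerate := by
  rintro ⟨ξ, η⟩
  set K := AddSubgroup.closure {z : E.prod F | ∃ (ξ : E.prod F) (a : A), z = (E.prod F).act ξ a}
  have h1 : ∀ ξ, AddMonoidHom.inl E F ξ ∈ K := hE.induction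
    (by rw [map_zero]; exact zero_mem _) (fun x y hx hy => by rw [map_add]; exact add_mem hx hy)
    (fun x hx => by rw [map_neg]; exact neg_mem hx) fun ξ a => AddSubgroup.subset_closure
      ⟨AddMonoidHom.inl E F ξ, a, Prod.ext rfl (DFunLike.congr_fun (map_zero F.act) a).symm⟩
  have h2 : ∀ η, AddMonoidHom.inr E F η ∈ K := hF.induction
    (by rw [map_zero]; exact zero_mem _) (fun x y hx hy => by rw [map_add]; exact add_mem hx hy)
    (fun x hx => by rw [map_neg]; exact neg_mem hx) fun ξ a => AddSubgroup.subset_closure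
      ⟨AddMonoidHom.inr E F ξ, a, Prod.ext (DFunLike.congr_fun (map_zero E.act) a).symm rfl⟩
  have h := add_mem (h1 ξ) (h2 η)
  refine Eq.subst (motive := fun z => z ∈ K) (Prod.ext ?_ ?_) h
  · exact add_zero ξ
  · exact zero_add η

theorem Nondegenerate.fst (h : (E.prod F).Nondegenerate) : E.Nondegenerate := by
  intro ξ
  exact h.induction (p := fun z : E × F => z.1 ∈ AddSubgroup.closure
    {z : E | ∃ (ξ : E) (a : A), z = E.act ξ a}) (zero_mem _) (fun x y hx hy => add_mem hx hy)
    (fun x hx => neg_mem hx) (fun ξ a => AddSubgroup.subset_closure ⟨ξ.1, a, rfl⟩) (ξ, 0)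

theorem prod_copies_cofull (hA : IsQuadratik A) (i₀ : I) (hE : E.Nondegenerate) :
    (E.prod (copies A I)).Cofull :=
  (hE.prod (copies_nondegenerate hA I)).induction (zero_mem _) (fun _ _ => add_mem)
    (fun _ => neg_mem) (act_mem_cofull i₀ hA)

end FModule

/-! ### The module `(E ⊕ H) ⊗ (A ⋊ G)` in the separated case -/

section sumDecomposition

open FModule

variable {G : Type u} [Group G] {A : Type u} [NonUnitalRing A] {α : G →* RingAut A}

namespace Crossed

theorem coeff_mk_one_mul (b : A) (x : Crossed α) (g : G) :
    coeff (mk α b 1 * x) g = b * coeff x g := by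
  induction x using Crossed.induction with
  | h0 => simp
  | hadd x y hx hy => simp [mul_add, hx, hy]
  | hmk a h =>
    rw [mk_mul_mk, map_one, RingAut.one_apply, one_mul]
    by_cases hg : g = h
    · subst hg; simp
    · rw [coeff_mk_of_ne _ _ hg, coeff_mk_of_ne _ _ hg, mul_zero]

theorem coeff_mul_mk_one (b : A) (x : Crossed α) (g : G) :
    coeff (x * mk α b 1) g = coeff x g * α g b := by
  induction x using Crossed.induction with
  | h0 => simp
  | hadd x y hx hy => simp [add_mul, hx, hy]
  | hmk a h =>
    rw [mk_mul_mk, mul_one]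
    by_cases hg : g = h
    · subst hg; simp
    · rw [coeff_mk_of_ne _ _ hg, coeff_mk_of_ne _ _ hg, zero_mul]

/-- Since `b c ⋊ g = (b ⋊ g)(α_{g⁻¹}(c) ⋊ 1)`, the right factor can be taken in `A`. Elements of
this shape are the entries of the row functionals that come from `E ⊕ H`. -/
theorem mul_mk_one_induction (hA : IsQuadratik A) {p : Crossed α → Prop} (h0 : p 0)
    (hadd : ∀ x y, p x → p y → p (x + y)) (hneg : ∀ x, p x → p (-x))
    (hmul : ∀ x a, p (x * mk α a 1)) (x : Crossed α) : p x := by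
  induction x using Crossed.induction with
  | h0 => exact h0
  | hadd x y hx hy => exact hadd x y hx hy
  | hmk a g =>
    have ha := hA a
    induction ha using AddSubgroup.closure_induction with
    | zero => rw [mk_zero]; exact h0
    | add x y _ _ hx hy => rw [mk_add]; exact hadd _ _ hx hy
    | neg x _ hx => rw [mk_neg]; exact hneg _ hx
    | mem x hx =>
      obtain ⟨b, c, rfl⟩ := hx
      have h := hmul (mk α b g) (α g⁻¹ c)
      rwa [mk_mul_mk, mul_one, ← RingAut.mul_apply, ← map_mul, mul_inv_cancel, map_one,
        RingAut.one_apply] at h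

end Crossed

/-- In `ξ ⊗ x` the splitting into products takes place in `x`, as the crossed product is quadratik.
-/
theorem descentModule_nondegenerate (hA : IsQuadratik A) (E : FModule A) :
    (descentModule α E).Nondegenerate := by
  intro z
  induction z using descent_induction with
  | h0 => exact zero_mem _
  | hadd z w hz hw => exact add_mem hz hw
  | htmul ξ x =>
    change descentTmulHom α E ξ x ∈ _
    induction x using Crossed.mul_induction hA with
    | h0 => rw [map_zero]; exact zero_mem _
    | hadd x y hx hy => rw [map_add]; exact add_mem hx hy
    | hneg x hx => rw [map_neg]; exact neg_mem hx
    | hmul x y => exact AddSubgroup.subset_closure ⟨descentTmul α E ξ x, y, rfl⟩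

/-- The biadditive map `((b_i)_i, x) ↦ (b_i x)_i`. -/
def copiesMul (α : G →* RingAut A) (I : Type u) :
    copies A I →+ Crossed α →+ copies (Crossed α) I :=
  AddMonoidHom.mk' (fun η => AddMonoidHom.mk'
    (fun x => Finsupp.mapRange.addMonoidHom
      ((AddMonoidHom.mulRight x).comp (Crossed.mkHom α 1)) η)
    fun x y => copies_ext fun i => mul_add (Crossed.mk α (coord i η) 1) x y)
    fun η ζ => AddMonoidHom.ext fun x => copies_ext fun i => by
      change Crossed.mk α (coord i η + coord i ζ) 1 * x =
        Crossed.mk α (coord i η) 1 * x + Crossed.mk α (coord i ζ) 1 * x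
      rw [Crossed.mk_add, add_mul]

theorem coord_copiesMul (I : Type u) (η : copies A I) (x : Crossed α) (i : I) :
    coord i (copiesMul α I η x) = Crossed.mk α (coord i η) 1 * x := rfl

theorem copiesMul_act (I : Type u) (η : copies A I) (x r : Crossed α) :
    (copies (Crossed α) I).act (copiesMul α I η x) r = copiesMul α I η (x * r) :=
  copies_ext fun i => by
    rw [coord_act, coord_copiesMul, coord_copiesMul, mul_assoc]

theorem copiesMul_single (I : Type u) (i : I) (a : A) (x : Crossed α) :
    copiesMul α I (single i a) x = single i (Crossed.mk α a 1 * x) :=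
  copies_ext fun k => by
    rw [coord_copiesMul]
    by_cases h : k = i
    · subst h; simp
    · rw [coord_single_of_ne h, coord_single_of_ne h, Crossed.mk_zero, zero_mul]

theorem mul_rowFunctional {R : Type u} [NonUnitalRing R] {I : Type u} (r : R) (c : I → R)
    (η : copies R I) : r * rowFunctional R I c η = rowFunctional R I (fun i => r * c i) η := by
  refine copies_hom_ext (f := (AddMonoidHom.mulLeft r).comp (rowFunctional R I c)) (fun i a => ?_) η
  change r * rowFunctional R I c (single i a) = _
  rw [rowFunctional_apply_single, ← mul_assoc]
  exact (rowFunctional_apply_single (fun i => r * c i) i a).symm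

theorem rowFunctional_copiesMul (I : Type u) (c : I → A) (η : copies A I) (x : Crossed α) :
    rowFunctional (Crossed α) I (fun i => Crossed.mk α (c i) 1) (copiesMul α I η x) =
      Crossed.mk α (rowFunctional A I c η) 1 * x := by
  refine copies_hom_ext
    (f := (rowFunctional (Crossed α) I fun i => Crossed.mk α (c i) 1).comp
      ((copiesMul α I).flip x))
    (f' := (AddMonoidHom.mulRight x).comp ((Crossed.mkHom α 1).comp (rowFunctional A I c)))
    (fun i a => ?_) η
  change rowFunctional (Crossed α) I (fun i => Crossed.mk α (c i) 1)
    (copiesMul α I (single i a) x) = Crossed.mk α (rowFunctional A I c (single i a)) 1 * x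
  rw [copiesMul_single, rowFunctional_apply_single, rowFunctional_apply_single,
    ← mul_assoc, Crossed.mk_mul_mk, map_one, RingAut.one_apply, one_mul]

variable {E : FModule A} {I : Type u}

/-- The functional `φ ⊕ (c_i)_i` on `E ⊕ ⨁_{i ∈ I} A`. -/
def sumFunctional (φ : E.functionals) (c : I → A) : (E.prod (copies A I)).functionals :=
  ⟨φ.1.coprod (rowFunctional A I c), φ.1, φ.2, _, ⟨c, rfl⟩, rfl⟩

theorem sumFunctional_apply (φ : E.functionals) (c : I → A) (z : E.prod (copies A I)) :
    (sumFunctional φ c).1 z = φ.1 z.1 + rowFunctional A I c z.2 := rfl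

theorem sumFunctional_zero_right (φ : E.functionals) (z : E.prod (copies A I)) :
    (sumFunctional φ 0).1 z = φ.1 z.1 :=
  (congrArg (φ.1 z.1 + ·) (DFunLike.congr_fun (map_zero (rowFunctional A I)) z.2)).trans
    (add_zero _)

theorem exists_sumFunctional (χ : (E.prod (copies A I)).functionals) :
    ∃ φ c, χ = sumFunctional φ c := by
  obtain ⟨_, φ, hφ, _, ⟨c, rfl⟩, rfl⟩ := χ
  exact ⟨⟨φ, hφ⟩, c, rfl⟩

/-- A functional on `E ⊕ H` sees the vector `a` in the coordinate `i₀` only through left multiples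
of `a`. -/
theorem eq_zero_of_mul_eq_zero (hs : (E.prod (copies A I)).Separated) (i₀ : I) (a : A)
    (ha : ∀ b, b * a = 0) : a = 0 := by
  have h := hs ((AddMonoidHom.inr E (copies A I)) (single i₀ a)) fun χ hχ => by
    obtain ⟨φ, c, h⟩ := exists_sumFunctional ⟨χ, hχ⟩
    rw [show χ = (sumFunctional φ c).1 from congrArg Subtype.val h]
    change φ.1 0 + rowFunctional A I c (single i₀ a) = 0
    rw [rowFunctional_apply_single, ha, map_zero, zero_add]
  have h2 : single i₀ a = 0 := congrArg Prod.snd h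
  rw [← coord_single_same i₀ a, h2]
  rfl

variable (α) in
/-- The additive map `(ξ ⊕ (b_i)_i) ⊗ x ↦ (ξ ⊗ x) ⊕ (b_i x)_i`. -/
def descentSumHom (hs : (E.prod (copies A I)).Separated) :
    descentModule α (E.prod (copies A I)) →+ (descentModule α E).prod (copies (Crossed α) I) :=
  descentLift (E := E.prod (copies A I))
    (N := (descentModule α E).prod (copies (Crossed α) I))
    (AddMonoidHom.mk' (fun z : E × copies A I =>
      (descentTmulHom α E z.1).prod (copiesMul α I z.2)) fun z w => AddMonoidHom.ext fun x =>
        Prod.ext (DFunLike.congr_fun (map_add (descentTmulHom α E) z.1 w.1) x)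
          (DFunLike.congr_fun (map_add (copiesMul α I) z.2 w.2) x))
    (by
      classical
      intro n hn
      refine Prod.ext (descent_ext fun φ => ?_) (copies_ext fun i => Crossed.ext fun g =>
        eq_zero_of_mul_eq_zero hs i _ fun b => ?_)
      -- The component in `E ⊗ R` is detected by the functionals `φ ⊕ 0`.
      · refine (hn ((descentEval α E φ).comp (AddMonoidHom.fst _ _)) (sumFunctional φ 0)
          (AddMonoidHom.id _) fun z x => ?_).trans (map_zero _).symm
        change Crossed.mk α (φ.1 z.1) 1 * x = Crossed.mk α ((sumFunctional φ 0).1 z) 1 * x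
        rw [sumFunctional_zero_right]
      -- The functional with the single entry `b` at `i` controls only `b` times the coordinate `i`.
      -- Separation, in the form of `eq_zero_of_mul_eq_zero`, removes the factor `b` from each
      -- coefficient.
      · rw [← Crossed.coeff_mk_one_mul]
        refine congrArg (fun y => Crossed.coeff y g)
          (hn ((AddMonoidHom.mulLeft (Crossed.mk α b 1)).comp
            ((coord i).comp (AddMonoidHom.snd _ _))) (sumFunctional 0 (Pi.single i b))
            (AddMonoidHom.id _) fun z x => ?_)
        change Crossed.mk α b 1 * (Crossed.mk α (coord i z.2) 1 * x) =
          Crossed.mk α ((sumFunctional 0 (Pi.single i b)).1 z) 1 * x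
        rw [sumFunctional_apply, rowFunctional_single, ← mul_assoc, Crossed.mk_mul_mk, map_one,
          RingAut.one_apply, one_mul]
        change _ = Crossed.mk α (0 + b * coord i z.2) 1 * x
        rw [zero_add])

theorem descentSumHom_tmul (hs : (E.prod (copies A I)).Separated) (z : E.prod (copies A I))
    (x : Crossed α) : descentSumHom α hs (descentTmul α _ z x) =
      (descentTmul α E z.1 x, copiesMul α I z.2 x) := rfl

/-- Every evaluation on `(E ⊕ H) ⊗ R` factors through `X`. This yields injectivity of `X` and shows
how functionals are transported. -/
theorem descentEval_sum (hs : (E.prod (copies A I)).Separated) (φ : E.functionals) (c : I → A)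
    (z : descentModule α (E.prod (copies A I))) :
    descentEval α _ (sumFunctional φ c) z = descentEval α E φ (descentSumHom α hs z).1 +
      rowFunctional (Crossed α) I (fun i => Crossed.mk α (c i) 1) (descentSumHom α hs z).2 := by
  refine descent_hom_ext (f := descentEval α _ (sumFunctional φ c))
    (f' := AddMonoidHom.comp ((descentEval α E φ).coprod
      (rowFunctional (Crossed α) I fun i => Crossed.mk α (c i) 1)) (descentSumHom α hs))
    (fun z x => ?_) z
  change Crossed.mk α ((sumFunctional φ c).1 z) 1 * x =
    Crossed.mk α (φ.1 z.1) 1 * x + rowFunctional (Crossed α) I _ (copiesMul α I z.2 x)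
  rw [rowFunctional_copiesMul, sumFunctional_apply, Crossed.mk_add, add_mul]

theorem mul_descentEval_sum (hs : (E.prod (copies A I)).Separated) (φ : E.functionals) (c : I → A)
    (r : Crossed α) (z : descentModule α (E.prod (copies A I))) :
    r * descentEval α _ (sumFunctional φ c) z =
      r * descentEval α E φ (descentSumHom α hs z).1 +
        rowFunctional (Crossed α) I (fun i => r * Crossed.mk α (c i) 1)
          (descentSumHom α hs z).2 := by
  rw [descentEval_sum, mul_add, mul_rowFunctional]

theorem descentSumHom_act (hs : (E.prod (copies A I)).Separated)
    (z : descentModule α (E.prod (copies A I))) (r : Crossed α) :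
    descentSumHom α hs ((descentModule α (E.prod (copies A I))).act z r) =
      ((descentModule α E).prod (copies (Crossed α) I)).act (descentSumHom α hs z) r := by
  refine descent_hom_ext
    (f := (descentSumHom α hs).comp ((descentModule α (E.prod (copies A I))).act.flip r))
    (f' := (((descentModule α E).prod (copies (Crossed α) I)).act.flip r).comp
      (descentSumHom α hs)) (fun ξ x => ?_) z
  rw [AddMonoidHom.comp_apply, AddMonoidHom.comp_apply, AddMonoidHom.flip_apply,
    AddMonoidHom.flip_apply, descent_act_tmul, descentSumHom_tmul, descentSumHom_tmul, prod_act,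
    descent_act_tmul, copiesMul_act]

theorem coeff_mul_injective {y : Crossed α} (h : ∀ c, y * Crossed.mk α c 1 = 0)
    (hA : ∀ a : A, (∀ b, a * b = 0) → a = 0) : y = 0 :=
  Crossed.ext fun g => hA _ fun b => by
    have h' := congrArg (fun x => Crossed.coeff x g) (h (α g⁻¹ b))
    simp only [Crossed.coeff_mul_mk_one] at h'
    rwa [← RingAut.mul_apply, ← map_mul, mul_inv_cancel, map_one, RingAut.one_apply] at h'

/-- The corner operator of `a` sees only the products `a b`, so injectivity depends on the ring
alone. In this form it passes to `A ⋊ G` coefficient by coefficient. -/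
theorem cornerHom_injective_iff (hA : IsQuadratik A) (E : FModule A) (i₀ : I) :
    Function.Injective (cornerHom hA E I i₀) ↔ ∀ a : A, (∀ b, a * b = 0) → a = 0 := by
  rw [injective_iff_map_eq_zero]
  refine forall_congr' fun a => imp_congr_left ⟨fun h b => ?_, fun h => ?_⟩
  · have h' := congrArg (fun T : (E.prod (copies A I)).compacts =>
      coord i₀ (T.1 (AddMonoidHom.inr E (copies A I) (single i₀ b))).2) h
    change coord i₀ (single i₀ (a * coord i₀ (single i₀ b))) = 0 at h'
    rwa [coord_single_same, coord_single_same] at h'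
  · refine Subtype.ext <| AddMonoidHom.ext fun z => Prod.ext rfl ?_
    change single i₀ (a * coord i₀ z.2) = 0
    rw [h, map_zero]

theorem cornerHom_descent_injective (hA : IsQuadratik A) (E : FModule A) (i₀ : I)
    (h : Function.Injective (cornerHom hA E I i₀)) :
    Function.Injective (cornerHom (Crossed.quadratik α hA) (descentModule α E) I i₀) := by
  rw [cornerHom_injective_iff] at h ⊢
  exact fun y hy => coeff_mul_injective (fun c => hy _) h

theorem descentSumHom_injective (hs : (E.prod (copies A I)).Separated) :
    Function.Injective (descentSumHom α hs) := by
  refine (injective_iff_map_eq_zero _).2 fun z hz => descent_ext fun χ => ?_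
  obtain ⟨φ, c, rfl⟩ := exists_sumFunctional χ
  rw [descentEval_sum hs, hz, map_zero]
  exact (congrArg₂ (· + ·) (map_zero _) (map_zero _)).trans (add_zero _)

theorem descentSumHom_surjective (hs : (E.prod (copies A I)).Separated) (hA : IsQuadratik A) :
    Function.Surjective (descentSumHom α hs) := by
  rintro ⟨z, η⟩
  change (z, η) ∈ (descentSumHom α hs).range
  have h1 : AddMonoidHom.inl _ (copies (Crossed α) I) z ∈ (descentSumHom α hs).range := by
    induction z using descent_induction with
    | h0 => rw [map_zero]; exact zero_mem _
    | hadd x y hx hy => rw [map_add]; exact add_mem hx hy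
    | htmul ξ x =>
      refine ⟨descentTmul α _ (AddMonoidHom.inl E (copies A I) ξ) x, ?_⟩
      exact (descentSumHom_tmul hs _ _).trans
        (Prod.ext rfl (DFunLike.congr_fun (map_zero (copiesMul α I)) x))
  have h2 : AddMonoidHom.inr (descentModule α E) (copies (Crossed α) I) η ∈
      (descentSumHom α hs).range := by
    refine Finsupp.induction_linear (motive := fun η : copies (Crossed α) I =>
      AddMonoidHom.inr (descentModule α E) (copies (Crossed α) I) η ∈
        (descentSumHom α hs).range) η ?_ ?_ fun i x => ?_
    · exact zero_mem (descentSumHom α hs).range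
    · intro x y hx hy
      exact Eq.subst (motive := fun z => z ∈ (descentSumHom α hs).range)
        (map_add (AddMonoidHom.inr (descentModule α E) (copies (Crossed α) I)) x y).symm
        (add_mem hx hy)
    · change AddMonoidHom.inr _ _ (single i x) ∈ _
      induction x using Crossed.induction with
      | h0 => rw [map_zero, map_zero]; exact zero_mem _
      | hadd x y hx hy => rw [map_add, map_add]; exact add_mem hx hy
      | hmk a g =>
        have ha := hA a
        change AddMonoidHom.inr _ _ (single i (Crossed.mkHom α g a)) ∈ _
        induction ha using AddSubgroup.closure_induction with
        | zero => rw [map_zero, map_zero, map_zero]; exact zero_mem _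
        | add x y _ _ hx hy => rw [map_add, map_add, map_add]; exact add_mem hx hy
        | neg x _ hx => rw [map_neg, map_neg, map_neg]; exact neg_mem hx
        | mem x hx =>
          obtain ⟨b, c, rfl⟩ := hx
          -- The entry `b c ⋊ g` is `(b ⋊ 1)(c ⋊ g)`.
          refine ⟨descentTmul α _ (AddMonoidHom.inr E (copies A I) (single i b))
            (Crossed.mk α c g), ?_⟩
          refine (descentSumHom_tmul hs _ _).trans
            (Prod.ext (DFunLike.congr_fun (map_zero (descentTmulHom α E)) _) ?_)
          refine (copiesMul_single I i b _).trans ?_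
          rw [Crossed.mk_mul_mk, map_one, RingAut.one_apply, one_mul]
          rfl
  refine Eq.subst (motive := fun z => z ∈ (descentSumHom α hs).range) (Prod.ext ?_ ?_)
    (add_mem h1 h2)
  · exact add_zero z
  · exact zero_add η

variable (α) in
/-- The isomorphism `(E ⊕ ⨁ A) ⊗ (A ⋊ G) ≅ (E ⊗ (A ⋊ G)) ⊕ ⨁ A ⋊ G`. -/
def descentSumEquiv (hs : (E.prod (copies A I)).Separated) (hA : IsQuadratik A) :
    descentModule α (E.prod (copies A I)) ≃+ (descentModule α E).prod (copies (Crossed α) I) :=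
  AddEquiv.ofBijective (descentSumHom α hs)
    ⟨descentSumHom_injective hs, descentSumHom_surjective hs hA⟩

/-- `r (φ ⊕ (c_i))` becomes `r φ ⊕ (r (c_i ⋊ 1))`, a legitimate functional for every `I` because
arbitrary families are allowed in the target. -/
theorem comp_descentSumEquiv_symm_mem (hs : (E.prod (copies A I)).Separated) (hA : IsQuadratik A)
    {χ : descentModule α (E.prod (copies A I)) →+ Crossed α}
    (hχ : χ ∈ (descentModule α (E.prod (copies A I))).functionals) :
    χ.comp (descentSumEquiv α hs hA).symm.toAddMonoidHom ∈
      ((descentModule α E).prod (copies (Crossed α) I)).functionals := by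
  rw [descent_functionals] at hχ
  induction hχ using AddSubgroup.closure_induction with
  | zero => rw [AddMonoidHom.zero_comp]; exact zero_mem _
  | add x y _ _ hx hy => rw [AddMonoidHom.add_comp]; exact add_mem hx hy
  | neg x _ hx => exact neg_mem hx
  | mem x hx =>
    obtain ⟨r, χ, rfl⟩ := hx
    obtain ⟨φ, c, rfl⟩ := exists_sumFunctional χ
    refine ⟨_, mulLeft_comp_descentEval_mem α E r φ, _, ⟨fun i => r * Crossed.mk α (c i) 1, rfl⟩,
      AddMonoidHom.ext fun w => ?_⟩
    obtain ⟨z, rfl⟩ := (descentSumEquiv α hs hA).surjective w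
    refine (congrArg (fun z => r * descentEval α _ (sumFunctional φ c) z)
      ((descentSumEquiv α hs hA).symm_apply_apply z)).trans ?_
    exact mul_descentEval_sum hs φ c r z

/-- For finite `I` a family is the sum of its single entries, each entry is a sum of elements `r (a
⋊ 1)`, and the latter come from `r` times the functional `a` in one coordinate. In general, the
entries of a finite sum of families `(r (c_i ⋊ 1))` have supports in one finite subset of `G`,
whereas an arbitrary family need not. -/
theorem comp_descentSumEquiv_mem [Finite I] (hs : (E.prod (copies A I)).Separated)
    (hA : IsQuadratik A) {χ : (descentModule α E).prod (copies (Crossed α) I) →+ Crossed α}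
    (hχ : χ ∈ ((descentModule α E).prod (copies (Crossed α) I)).functionals) :
    χ.comp (descentSumEquiv α hs hA).toAddMonoidHom ∈
      (descentModule α (E.prod (copies A I))).functionals := by
  classical
  have := Fintype.ofFinite I
  obtain ⟨φ, hφ, _, ⟨d, rfl⟩, rfl⟩ := hχ
  have key : ∀ (φ : E.functionals) (c : I → A) (r : Crossed α),
      (AddMonoidHom.coprod ((AddMonoidHom.mulLeft r).comp (descentEval α E φ))
        (rowFunctional (Crossed α) I fun i => r * Crossed.mk α (c i) 1)).comp
        (descentSumHom α hs) ∈ (descentModule α (E.prod (copies A I))).functionals := by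
    intro φ c r
    refine Eq.subst (motive := fun χ => χ ∈ (descentModule α (E.prod (copies A I))).functionals)
      (AddMonoidHom.ext fun z => ?_)
      (mulLeft_comp_descentEval_mem α (E.prod (copies A I)) r (sumFunctional φ c))
    exact mul_descentEval_sum hs φ c r z
  have h1 : AddMonoidHom.comp (φ.comp (AddMonoidHom.fst _ (copies (Crossed α) I)))
      (descentSumHom α hs) ∈ (descentModule α (E.prod (copies A I))).functionals := by
    rw [descent_functionals] at hφ
    induction hφ using AddSubgroup.closure_induction with
    | zero => exact zero_mem _
    | add x y _ _ hx hy => exact add_mem hx hy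
    | neg x _ hx => exact neg_mem hx
    | mem x hx =>
      obtain ⟨r, φ, rfl⟩ := hx
      refine Eq.subst (motive := fun χ => χ ∈
        (descentModule α (E.prod (copies A I))).functionals) (AddMonoidHom.ext fun z => ?_)
        (key φ 0 r)
      change _ + rowFunctional (Crossed α) I (fun i => r * Crossed.mk α 0 1) _ = _
      rw [Crossed.mk_zero, mul_zero, show (fun _ : I => (0 : Crossed α)) = 0 from rfl, map_zero]
      exact add_zero _
  let L : (I → Crossed α) →+ (descentModule α (E.prod (copies A I)) →+ Crossed α) :=
    AddMonoidHom.mk' (fun d => AddMonoidHom.comp ((rowFunctional (Crossed α) I d).comp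
      (AddMonoidHom.snd (descentModule α E) _)) (descentSumHom α hs)) fun d d' =>
        AddMonoidHom.ext fun z => DFunLike.congr_fun (map_add (rowFunctional (Crossed α) I) d d') _
  have h2 : L d ∈ (descentModule α (E.prod (copies A I))).functionals := by
    rw [← Finset.univ_sum_single d, map_sum]
    refine sum_mem fun i _ => ?_
    change L (AddMonoidHom.single (fun _ => Crossed α) i (d i)) ∈ _
    induction d i using Crossed.mul_mk_one_induction hA with
    | h0 => rw [map_zero, map_zero]; exact zero_mem _
    | hadd x y hx hy => rw [map_add, map_add]; exact add_mem hx hy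
    | hneg x hx => rw [map_neg, map_neg]; exact neg_mem hx
    | hmul r a =>
      refine Eq.subst (motive := fun χ => χ ∈
        (descentModule α (E.prod (copies A I))).functionals) (AddMonoidHom.ext fun z => ?_)
        (key 0 (Pi.single i a) r)
      have hd : (fun k => r * Crossed.mk α ((Pi.single i a : I → A) k) 1) =
          Pi.single i (r * Crossed.mk α a 1) := by
        funext k
        by_cases hk : k = i
        · subst hk; simp
        · simp [hk]
      have h0 : ∀ w, descentEval α E 0 w = 0 := descent_hom_ext (f' := 0) fun ξ x => by
        change Crossed.mk α 0 1 * x = 0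
        rw [Crossed.mk_zero, zero_mul]
      change r * descentEval α E 0 _ + rowFunctional (Crossed α) I _ _ = _
      rw [hd, h0, mul_zero, zero_add]
      rfl
  refine Eq.subst (motive := fun χ => χ ∈ (descentModule α (E.prod (copies A I))).functionals)
    ?_ (add_mem h1 h2)
  rfl

/-- The homomorphism `T ↦ X T X⁻¹` for the isomorphism `X` that splits off `⨁ A ⋊ G`. -/
def descentSumConj (hs : (E.prod (copies A I)).Separated) (hA : IsQuadratik A) :
    (descentModule α (E.prod (copies A I))).compacts →ₙ+*
      ((descentModule α E).prod (copies (Crossed α) I)).compacts :=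
  compactsConj (descentSumEquiv α hs hA) (descentSumHom_act hs)
    (fun _ => comp_descentSumEquiv_symm_mem hs hA)

/-- In the coordinate `i₀` the action of `e(b) ⋊ g` on `ξ ⊗ y` produces `(b α_g(ξ_{i₀}) ⋊ 1) V_g y =
(b ⋊ g)(ξ_{i₀} ⋊ 1) y`. That `i₀` is distinguished gives the coordinate `α_g(ξ_{i₀})` after
translation by `g`. -/
theorem descentSumConj_corner (hs : (E.prod (copies A I)).Separated) (hA : IsQuadratik A)
    (hE : (E.prod (copies A I)).Nondegenerate) (S : ModAction α E) {i₀ : I}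
    (U : ModAction α (copies A I)) (hU : U.IsDistinguished i₀) (x : Crossed α) :
    descentSumConj hs hA ((S.prod U).descentSigma hA hE
      (Crossed.map (cornerHom hA E I i₀) (cornerHom_equivariant hA S U hU) x)) =
        cornerHom (Crossed.quadratik α hA) (descentModule α E) I i₀ x := by
  induction x using Crossed.induction with
  | h0 => simp only [map_zero]
  | hadd x y hx hy => simp only [map_add, hx, hy]
  | hmk b g =>
    rw [Crossed.map_mk]
    refine Subtype.ext <| AddMonoidHom.ext fun w => ?_
    obtain ⟨z, rfl⟩ := (descentSumEquiv α hs hA).surjective w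
    refine (compactsConj_apply _ _ _ _ z).trans ?_
    refine descent_hom_ext
      (f := (descentSumHom α hs).comp ((S.prod U).descentRep
        (Crossed.mk (S.prod U).Ad (cornerHom hA E I i₀ b) g)))
      (f' := AddMonoidHom.comp (cornerOp (descentModule α E) I i₀ (Crossed.mk α b g))
        (descentSumHom α hs)) (fun ξ y => ?_) z
    refine (congrArg (descentSumHom α hs) ((S.prod U).descentRep_mk_tmul _ g ξ y)).trans ?_
    refine (descentSumHom_tmul hs _ _).trans ?_
    refine Prod.ext (DFunLike.congr_fun (map_zero (descentTmulHom α E)) _) ?_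
    change copiesMul α I (single i₀ (b * coord i₀ (U.S g ξ.2))) (Crossed.V α g y) =
      single i₀ (Crossed.mk α b g * (Crossed.mk α (coord i₀ ξ.2) 1 * y))
    rw [copiesMul_single, hU.coord_S, Crossed.mk_mul_V, ← mul_assoc, Crossed.mk_mul_mk, one_mul,
      mul_one]

end sumDecomposition

open FModule

/-! ### Isomorphisms of functional modules -/

namespace FModule

variable {A : Type u} [NonUnitalRing A] {E F : FModule A} {I : Type u}

/-- An isomorphism of functional modules. -/
def IsModuleIso (X : E ≃+ F) : Prop :=
  (∀ ξ a, X (E.act ξ a) = F.act (X ξ) a) ∧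
    ∀ ψ : F →+ A, ψ ∈ F.functionals ↔ ψ.comp X.toAddMonoidHom ∈ E.functionals

theorem IsModuleIso.comp_symm_mem {X : E ≃+ F} (hX : IsModuleIso X) {φ : E →+ A}
    (hφ : φ ∈ E.functionals) :
    φ.comp X.symm.toAddMonoidHom ∈ F.functionals := by
  rw [hX.2]
  refine Eq.subst (motive := fun φ => φ ∈ E.functionals) (AddMonoidHom.ext fun z => ?_) hφ
  exact congrArg φ (X.symm_apply_apply z).symm

/-- The isomorphism of rings of compact operators induced by an isomorphism of modules. -/
def compactsEquiv (X : E ≃+ F) (hX : IsModuleIso X) : E.compacts ≃+* F.compacts :=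
  RingEquiv.ofBijective (compactsConj X hX.1 fun _ => hX.comp_symm_mem)
    (compactsConj_bijective X hX.1 _ fun ψ hψ => (hX.2 ψ).1 hψ)

theorem compactsEquiv_apply (X : E ≃+ F) (hX : IsModuleIso X) (T : E.compacts) (z : E) :
    (compactsEquiv X hX T : AddMonoid.End F) (X z) = X ((T : AddMonoid.End E) z) :=
  compactsConj_apply X hX.1 (fun _ => hX.comp_symm_mem) T z

end FModule

/-! ### Formal sums `ξ ⋊ g`: a faithful module for `K_A(E) ⋊ G` -/

section crossModule

theorem cross_hom_ext {G E : Type*} [AddGroup E] {M : Type*} [AddGroup M] {f f' : (G →₀ E) →+ M}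
    (h : ∀ g ξ, f (Finsupp.single g ξ) = f' (Finsupp.single g ξ)) (z : G →₀ E) : f z = f' z :=
  Finsupp.induction_linear z (by simp) (fun x y hx hy => by simp [hx, hy]) h

variable {G : Type u} [Group G] {A : Type u} [NonUnitalRing A] (α : G →* RingAut A)
  (E : FModule A)

/-- The right action of `A ⋊ G` on the formal sums of elements `ξ ⋊ g` with `ξ ∈ E`,
`(ξ ⋊ g) (b ⋊ h) = ξ α_g(b) ⋊ g h`. -/
def crossAct : (G →₀ E) →+ Crossed α →+ (G →₀ E) :=
  Finsupp.liftAddHom fun g => AddMonoidHom.mk' (fun ξ => Crossed.lift α fun h =>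
    (Finsupp.singleAddHom (g * h)).comp ((E.act ξ).comp (α g : A ≃+ A).toAddMonoidHom)) (by
      intro ξ η
      refine AddMonoidHom.ext fun x => Crossed.hom_ext (fun b h => ?_) x
      simp)

theorem crossAct_single (g h : G) (ξ : E) (b : A) :
    crossAct α E (Finsupp.single g ξ) (Crossed.mk α b h) =
      Finsupp.single (g * h) (E.act ξ (α g b)) := by
  rw [crossAct, Finsupp.liftAddHom_apply_single]
  exact Crossed.lift_mk _ _ _ _

variable {E} in
/-- The map `ξ ⋊ g ↦ φ(ξ) ⋊ g`. -/
def crossEval (φ : E →+ A) : (G →₀ E) →+ Crossed α := Finsupp.mapRange.addMonoidHom φ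

variable {E} in
theorem crossEval_single (φ : E →+ A) (g : G) (ξ : E) :
    crossEval α φ (Finsupp.single g ξ) = Crossed.mk α (φ ξ) g :=
  Finsupp.mapRange_single (hf := map_zero φ)

theorem crossEval_act {φ : E →+ A} (hφ : φ ∈ E.functionals) (z : G →₀ E) (x : Crossed α) :
    crossEval α φ (crossAct α E z x) = crossEval α φ z * x := by
  refine cross_hom_ext (f := (crossEval α φ).comp ((crossAct α E).flip x))
    (f' := (AddMonoidHom.mulRight x).comp (crossEval α φ)) (fun g ξ => ?_) z
  refine Crossed.hom_ext (f := (crossEval α φ).comp (crossAct α E (Finsupp.single g ξ)))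
    (f' := AddMonoidHom.mulLeft (crossEval α φ (Finsupp.single g ξ))) (fun b h => ?_) x
  simp [crossAct_single, crossEval_single, Crossed.mk_mul_mk, E.functionals_act φ hφ]

variable {E} in
-- The group element is pulled out as `V_k` and the coefficient is absorbed into `φ`, so left
-- multiples of functionals `V_g ∘ φ` are again sums of such functionals.
theorem mk_mul_crossEval (a : A) (k : G) (φ : E →+ A) (z : G →₀ E) :
    Crossed.mk α a k * crossEval α φ z =
      Crossed.V α k (crossEval α ((AddMonoidHom.mulLeft (α k⁻¹ a)).comp φ) z) := by
  refine cross_hom_ext (f := (AddMonoidHom.mulLeft (Crossed.mk α a k)).comp (crossEval α φ))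
    (f' := (Crossed.V α k).comp (crossEval α ((AddMonoidHom.mulLeft (α k⁻¹ a)).comp φ)))
    (fun g ξ => ?_) z
  simp [crossEval_single, Crossed.mk_mul_mk, Crossed.V_mk]

/-- The module of formal sums of elements `ξ ⋊ g` with `ξ ∈ E`; its functionals are the finite
sums of functionals `ξ ⋊ h ↦ α_g(φ(ξ)) ⋊ g h`. -/
def crossModule : FModule (Crossed α) where
  carrier := G →₀ E
  act := crossAct α E
  act_mul z x y := by
    refine cross_hom_ext (f := (crossAct α E).flip (x * y))
      (f' := ((crossAct α E).flip y).comp ((crossAct α E).flip x)) (fun g ξ => ?_) z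
    refine Crossed.hom_ext
      (f := (crossAct α E (Finsupp.single g ξ)).comp (AddMonoidHom.mulRight y))
      (f' := ((crossAct α E).flip y).comp (crossAct α E (Finsupp.single g ξ))) (fun b h => ?_) x
    refine Crossed.hom_ext
      (f := (crossAct α E (Finsupp.single g ξ)).comp (AddMonoidHom.mulLeft (Crossed.mk α b h)))
      (f' := crossAct α E (crossAct α E (Finsupp.single g ξ) (Crossed.mk α b h)))
      (fun c k => ?_) y
    simp [crossAct_single, Crossed.mk_mul_mk, E.act_mul, mul_assoc, RingAut.mul_apply]
  -- With `V_g` instead of left multiplications by ring elements, every `φ` itself occurs, not only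
  -- multiples `a φ`. Hence `θ_{η,φ} ⋊ g` becomes elementary without splitting `η` or `φ` into
  -- products.
  functionals := AddSubgroup.closure
    {χ | ∃ (g : G), ∃ φ ∈ E.functionals, χ = (Crossed.V α g).comp (crossEval α φ)}
  functionals_act := by
    intro χ hχ z x
    induction hχ using AddSubgroup.closure_induction with
    | zero => simp
    | add x y _ _ hx hy => simp only [AddMonoidHom.add_apply, hx, hy, add_mul]
    | neg x _ hx => simp only [AddMonoidHom.neg_apply, hx, neg_mul]
    | mem χ h =>
      obtain ⟨g, φ, hφ, rfl⟩ := h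
      simp only [AddMonoidHom.comp_apply, crossEval_act α E hφ, Crossed.V_mul_right]
  functionals_smul := by
    intro r χ hχ
    induction hχ using AddSubgroup.closure_induction with
    | zero => rw [AddMonoidHom.comp_zero]; exact zero_mem _
    | add x y _ _ hx hy => rw [AddMonoidHom.comp_add]; exact add_mem hx hy
    | neg x _ hx =>
      have : (AddMonoidHom.mulLeft r).comp (-x) = -(AddMonoidHom.mulLeft r).comp x := by
        ext; simp
      rw [this]; exact neg_mem hx
    | mem χ h =>
      obtain ⟨g, φ, hφ, rfl⟩ := h
      change (AddMonoidHom.mul r).comp _ ∈ _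
      induction r using Crossed.induction with
      | h0 => rw [map_zero, AddMonoidHom.zero_comp]; exact zero_mem _
      | hadd x y hx hy => rw [map_add, AddMonoidHom.add_comp]; exact add_mem hx hy
      | hmk a k =>
        refine AddSubgroup.subset_closure
          ⟨k * g, _, E.functionals_smul (α (k * g)⁻¹ a) φ hφ, AddMonoidHom.ext fun z => ?_⟩
        change Crossed.mk α a k * Crossed.V α g (crossEval α φ z) = _
        rw [Crossed.mk_mul_V, mk_mul_crossEval]
        rfl

theorem crossModule_act_single (g h : G) (ξ : E) (b : A) :
    (crossModule α E).act (Finsupp.single g ξ : G →₀ E) (Crossed.mk α b h) =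
      (Finsupp.single (g * h) (E.act ξ (α g b)) : G →₀ E) := crossAct_single α E g h ξ b

theorem V_comp_crossEval_mem (g : G) {φ : E →+ A} (hφ : φ ∈ E.functionals) :
    (Crossed.V α g).comp (crossEval α φ) ∈ (crossModule α E).functionals :=
  AddSubgroup.subset_closure ⟨g, φ, hφ, rfl⟩

variable {α E}

theorem crossModule_nondegenerate (hE : E.Nondegenerate) : (crossModule α E).Nondegenerate := by
  intro z
  set K := AddSubgroup.closure {z : crossModule α E | ∃ (ξ : crossModule α E) (x : Crossed α),
    z = (crossModule α E).act ξ x} with hK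
  refine Finsupp.induction_linear (motive := fun z : G →₀ E => (show crossModule α E from z) ∈ K)
    z (zero_mem K) (fun x y hx hy => add_mem hx hy) fun g ξ => ?_
  let f : E →+ crossModule α E := (Finsupp.singleAddHom g : E →+ (G →₀ E))
  change f ξ ∈ K
  induction ξ using hE.induction with
  | h0 => rw [map_zero]; exact zero_mem _
  | hadd x y hx hy => rw [map_add]; exact add_mem hx hy
  | hneg x hx => rw [map_neg]; exact neg_mem hx
  | hact ξ a =>
    -- `ξ a ⋊ g = (ξ ⋊ g)(α_{g⁻¹}(a) ⋊ 1)`.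
    refine AddSubgroup.subset_closure
      ⟨(Finsupp.single g ξ : G →₀ E), Crossed.mk α (α g⁻¹ a) 1, ?_⟩
    rw [crossModule_act_single, ← RingAut.mul_apply, ← map_mul]
    simp only [mul_inv_cancel, map_one, RingAut.one_apply, mul_one]
    rfl

namespace ModAction

variable (S : ModAction α E)

variable (E) in
/-- The action `ξ ⋊ h ↦ T(ξ) ⋊ h` of the compact operators. -/
def crossOp : E.compacts →ₙ+* AddMonoid.End (G →₀ E) where
  toFun T := Finsupp.mapRange.addMonoidHom T.1
  map_mul' _ _ := AddMonoidHom.ext fun _ => Finsupp.ext fun _ => rfl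
  map_zero' := AddMonoidHom.ext fun _ => Finsupp.ext fun _ => rfl
  map_add' _ _ := AddMonoidHom.ext fun _ => Finsupp.ext fun _ => rfl

omit [Group G] in
theorem crossOp_single (T : E.compacts) (h : G) (ξ : E) :
    crossOp E T (Finsupp.single h ξ) = Finsupp.single h ((T : AddMonoid.End E) ξ) :=
  Finsupp.mapRange_single (hf := map_zero T.1)

/-- The additive map `ξ ⋊ h ↦ S_g(ξ) ⋊ g h`. -/
def crossShiftHom (g : G) : (G →₀ E) →+ (G →₀ E) :=
  Finsupp.liftAddHom fun h => (Finsupp.singleAddHom (g * h)).comp (S.S g)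

theorem crossShiftHom_single (g h : G) (ξ : E) :
    S.crossShiftHom g (Finsupp.single h ξ) = Finsupp.single (g * h) (S.S g ξ) :=
  Finsupp.liftAddHom_apply_single _ _ _

/-- The action `ξ ⋊ h ↦ S_g(ξ) ⋊ g h`. -/
def crossShift : G →* AddMonoid.End (G →₀ E) where
  toFun g := S.crossShiftHom g
  map_one' := AddMonoidHom.ext <| cross_hom_ext fun h ξ => by
    rw [crossShiftHom_single, one_mul, map_one]; rfl
  map_mul' g k := AddMonoidHom.ext <| cross_hom_ext fun h ξ => by
    refine Eq.trans ?_ (congrArg (S.crossShiftHom g) (S.crossShiftHom_single k h ξ)).symm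
    rw [crossShiftHom_single, crossShiftHom_single, map_mul, mul_assoc]; rfl

theorem crossShift_single (g h : G) (ξ : E) :
    S.crossShift g (Finsupp.single h ξ) = Finsupp.single (g * h) (S.S g ξ) :=
  S.crossShiftHom_single g h ξ

theorem crossShift_mul_crossOp (g : G) (T : E.compacts) :
    S.crossShift g * crossOp E T = crossOp E (S.Ad g T) * S.crossShift g :=
  AddMonoidHom.ext <| cross_hom_ext fun h ξ => by
    refine (congrArg (S.crossShift g) (crossOp_single T h ξ)).trans ?_
    refine Eq.trans ?_ (congrArg (crossOp E (S.Ad g T)) (S.crossShift_single g h ξ)).symm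
    rw [crossShift_single, crossOp_single]
    change Finsupp.single (g * h) (S.S g ((T : AddMonoid.End E) ξ)) =
      Finsupp.single (g * h) (S.S g ((T : AddMonoid.End E) (S.S g⁻¹ (S.S g ξ))))
    rw [S.S_inv_apply]

/-- The action of `K_A(E) ⋊ G` on formal sums, `(T ⋊ g) (ξ ⋊ h) = T(S_g(ξ)) ⋊ g h`. -/
def crossRep : Crossed S.Ad →ₙ+* AddMonoid.End (G →₀ E) :=
  Crossed.covariantHom S.Ad (crossOp E) S.crossShift S.crossShift_mul_crossOp

theorem crossRep_mk_single (T : E.compacts) (g h : G) (ξ : E) :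
    S.crossRep (Crossed.mk S.Ad T g) (Finsupp.single h ξ) =
      Finsupp.single (g * h) ((T : AddMonoid.End E) (S.S g ξ)) := by
  have h' := Crossed.covariantHom_mk S.Ad (crossOp E) S.crossShift S.crossShift_mul_crossOp T g
  refine (DFunLike.congr_fun h' (Finsupp.single h ξ)).trans ?_
  refine (congrArg (crossOp E T) (S.crossShift_single g h ξ)).trans ?_
  exact crossOp_single _ _ _

theorem crossRep_apply (x : Crossed S.Ad) (g : G) (ξ : E) :
    S.crossRep x (Finsupp.single 1 ξ) g = (Crossed.coeff x g).1 (S.S g ξ) := by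
  induction x using Crossed.induction with
  | h0 => rw [map_zero]; rfl
  | hadd x y hx hy => rw [map_add]; exact congrArg₂ (· + ·) hx hy
  | hmk T k =>
    rw [crossRep_mk_single, mul_one]
    by_cases hk : g = k
    · subst hk
      rw [Crossed.coeff_mk_same, Finsupp.single_eq_same]
    · rw [Crossed.coeff_mk_of_ne _ _ hk, Finsupp.single_eq_of_ne hk]
      rfl

/-- On `ξ ⋊ 1` the components `T_g S_g ξ` land at distinct group elements. No null vectors were
divided out, so each `T_g` is recovered without separation by functionals. -/
theorem crossRep_injective : Function.Injective S.crossRep := fun x y h =>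
  Crossed.ext fun g => Subtype.ext <| AddMonoidHom.ext fun ξ => by
    have h' := S.crossRep_apply x g (S.S g⁻¹ ξ)
    rw [h, crossRep_apply, S.S_apply_inv] at h'
    exact h'.symm

/-- Elementary operators on formal sums are thus single terms of the crossed product: the group part
`k` of the vector and `g` of the functional enter only through `k g` and the translation of `φ`. -/
theorem crossRep_thetaHom (η : E) (φ : E.functionals) (k g : G) :
    S.crossRep (Crossed.mk S.Ad (thetaHom E η (S.translate (k * g) φ)) (k * g)) =
      (crossModule α E).theta (Finsupp.single k η : G →₀ E)
        ((Crossed.V α g).comp (crossEval α φ.1)) :=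
  AddMonoidHom.ext <| cross_hom_ext fun h ξ => by
    refine (S.crossRep_mk_single _ _ _ _).trans ?_
    rw [thetaHom_apply, translate_apply, S.S_inv_apply]
    change _ = crossAct α E (Finsupp.single k η)
      (Crossed.V α g (crossEval α φ.1 (Finsupp.single h ξ)))
    rw [crossEval_single, Crossed.V_mk, crossAct_single, map_mul, RingAut.mul_apply, mul_assoc]

theorem crossRep_mem (x : Crossed S.Ad) :
    S.crossRep x ∈ (crossModule α E).compacts := by
  induction x using Crossed.induction with
  | h0 => rw [map_zero]; exact zero_mem (crossModule α E).compacts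
  | hadd x y hx hy => rw [map_add]; exact add_mem (S := NonUnitalSubring _) hx hy
  | hmk T g =>
    induction T using compacts_induction with
    | h0 => rw [Crossed.mk_zero, map_zero]; exact zero_mem (crossModule α E).compacts
    | hadd x y hx hy => rw [Crossed.mk_add, map_add]; exact add_mem (S := NonUnitalSubring _) hx hy
    | hneg x hx => rw [Crossed.mk_neg, map_neg]; exact neg_mem (S := NonUnitalSubring _) hx
    | htheta η φ =>
      -- With `k = 1` and `φ` translated back by `g⁻¹`, an arbitrary term `θ_{η,φ} ⋊ g` is reached.
      have h := S.crossRep_thetaHom η (S.translate g⁻¹ φ) 1 g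
      have h2 : S.translate g (S.translate g⁻¹ φ) = φ := by
        have := S.translate_inv_translate g⁻¹ φ
        rwa [inv_inv] at this
      rw [one_mul, h2] at h
      rw [h]
      exact theta_mem _ (V_comp_crossEval_mem α E g (S.translate g⁻¹ φ).2)

/-- The homomorphism `K_A(E) ⋊ G → K_{A ⋊ G}(E ⋊ G)`. -/
def crossCompacts : Crossed S.Ad →ₙ+* (crossModule α E).compacts :=
  NonUnitalRingHom.codRestrict S.crossRep _ S.crossRep_mem

theorem crossCompacts_surjective : Function.Surjective S.crossCompacts := by
  intro T
  change T ∈ S.crossCompacts.toAddMonoidHom.range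
  induction T using compacts_induction with
  | h0 => exact zero_mem _
  | hadd x y hx hy => exact add_mem hx hy
  | hneg x hx => exact neg_mem hx
  | htheta z χ =>
    refine Finsupp.induction_linear (motive := fun z : G →₀ E =>
      thetaHom (crossModule α E) z χ ∈ S.crossCompacts.toAddMonoidHom.range) z ?_ ?_ fun k η => ?_
    · exact Eq.subst (motive := fun T => T ∈ S.crossCompacts.toAddMonoidHom.range)
        (DFunLike.congr_fun (map_zero (thetaHom (crossModule α E))) χ).symm (zero_mem _)
    · intro x y hx hy
      exact Eq.subst (motive := fun T => T ∈ S.crossCompacts.toAddMonoidHom.range)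
        (DFunLike.congr_fun (map_add (thetaHom (crossModule α E)) x y) χ).symm (add_mem hx hy)
    · obtain ⟨χ, hχ⟩ := χ
      have hχ' := hχ
      induction hχ' using AddSubgroup.closure_induction with
      | zero =>
        exact Eq.subst (motive := fun T => T ∈ S.crossCompacts.toAddMonoidHom.range)
          (map_zero (thetaHom (crossModule α E) _)).symm (zero_mem _)
      | add x y hx hy hx' hy' =>
        exact Eq.subst (motive := fun T => T ∈ S.crossCompacts.toAddMonoidHom.range)
          (map_add (thetaHom (crossModule α E) _) ⟨x, hx⟩ ⟨y, hy⟩).symm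
          (add_mem (hx' hx) (hy' hy))
      | neg x hx hx' =>
        exact Eq.subst (motive := fun T => T ∈ S.crossCompacts.toAddMonoidHom.range)
          (map_neg (thetaHom (crossModule α E) _) ⟨x, hx⟩).symm (neg_mem (hx' hx))
      | mem χ h =>
        obtain ⟨g, φ, hφ, rfl⟩ := h
        exact ⟨_, Subtype.ext (S.crossRep_thetaHom η ⟨φ, hφ⟩ k g)⟩

/-- The isomorphism `K_A(E) ⋊ G ≅ K_{A ⋊ G}(E ⋊ G)`. -/
def crossCompactsEquiv : Crossed S.Ad ≃+* (crossModule α E).compacts :=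
  RingEquiv.ofBijective S.crossCompacts
    ⟨fun _ _ h => S.crossRep_injective (congrArg Subtype.val h), S.crossCompacts_surjective⟩

end ModAction

/-! ### Splitting off the distinguished coordinate -/

section split

variable {M E₀ : FModule A} (X : M ≃+ E₀.prod (self A))

/-- The first component of `X`. -/
def splitFst : M →+ E₀ := AddMonoidHom.comp (AddMonoidHom.fst E₀ (self A)) X.toAddMonoidHom

/-- The second component of `X`. -/
def splitSnd : M →+ A := AddMonoidHom.comp (AddMonoidHom.snd E₀ (self A)) X.toAddMonoidHom

variable (α) in
/-- The additive map `ξ ⋊ g ↦ (X(ξ)₁ ⋊ g) ⊕ (X(ξ)₂ ⋊ g)`. -/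
def crossSplitHom : crossModule α M →+ (crossModule α E₀).prod (copies (Crossed α) PUnit) :=
  AddMonoidHom.prod (M := G →₀ M) (N := G →₀ E₀)
    (Finsupp.mapRange.addMonoidHom (splitFst X))
    ((single PUnit.unit).comp (crossEval α (splitSnd X)))

theorem crossSplitHom_single (g : G) (ξ : M) :
    crossSplitHom α X (Finsupp.single g ξ : G →₀ M) =
      ((Finsupp.single g (splitFst X ξ), single PUnit.unit (Crossed.mk α (splitSnd X ξ) g)) :
        (G →₀ E₀) × copies (Crossed α) PUnit) :=
  Prod.ext (Finsupp.mapRange_single (hf := map_zero (splitFst X)))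
    (congrArg (single PUnit.unit) (crossEval_single α _ g ξ))

theorem crossSplitHom_coord (z : crossModule α M) : coord PUnit.unit (crossSplitHom α X z).2 =
    crossEval α (splitSnd X) z :=
  coord_single_same _ _

theorem crossSplitHom_bijective : Function.Bijective (crossSplitHom α X) := by
  constructor
  · intro z w h
    refine Finsupp.ext fun g => X.injective (Prod.ext ?_ ?_)
    · exact congrArg (fun y : (G →₀ E₀) × copies (Crossed α) PUnit => y.1 g) h
    · have h2 : crossEval α (splitSnd X) z = crossEval α (splitSnd X) w := by
        rw [← crossSplitHom_coord, h, crossSplitHom_coord]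
      exact congrArg (fun y => Crossed.coeff y g) h2
  · rintro ⟨z, η⟩
    refine ⟨(Finsupp.mapRange.addMonoidHom (X.symm.toAddMonoidHom.comp (AddMonoidHom.inl E₀ (self A)))
        (show G →₀ E₀ from z) +
      Finsupp.mapRange.addMonoidHom (M := A)
        (X.symm.toAddMonoidHom.comp (AddMonoidHom.inr E₀ (self A)))
        (coord PUnit.unit η : Crossed α) : G →₀ M), Prod.ext (Finsupp.ext fun g => ?_)
          (copies_ext fun i => ?_)⟩
    · change (X (X.symm _ + X.symm _)).1 = _
      rw [← map_add, X.apply_symm_apply]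
      exact add_zero _
    · refine (crossSplitHom_coord X _).trans (Crossed.ext fun g => ?_)
      change (X (X.symm _ + X.symm _)).2 = _
      rw [← map_add, X.apply_symm_apply]
      exact zero_add _

variable (α) in
/-- The isomorphism `M ⋊ G ≅ (E₀ ⋊ G) ⊕ (A ⋊ G)` induced by `M ≅ E₀ ⊕ A`. -/
def crossSplit : crossModule α M ≃+ (crossModule α E₀).prod (copies (Crossed α) PUnit) :=
  AddEquiv.ofBijective (crossSplitHom α X) (crossSplitHom_bijective X)

theorem copies_act_single {R : Type u} [NonUnitalRing R] {I : Type u} (i : I) (a b : R) :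
    (copies R I).act (single i a) b = single i (a * b) :=
  copies_ext fun k => by
    rw [coord_act]
    by_cases h : k = i
    · subst h; simp
    · rw [coord_single_of_ne h, coord_single_of_ne h, zero_mul]

theorem rowFunctional_punit {R : Type u} [NonUnitalRing R] (d : PUnit.{u + 1} → R)
    (η : copies R PUnit.{u + 1}) :
    rowFunctional R PUnit d η = d PUnit.unit * coord PUnit.unit η := by
  have h : η = single PUnit.unit (coord PUnit.unit η) :=
    copies_ext fun _ => (coord_single_same _ _).symm
  conv_lhs => rw [h]
  exact rowFunctional_apply_single _ _ _

theorem FModule.IsModuleIso.exists_split {X : M ≃+ E₀.prod (self A)} (hX : IsModuleIso X) {φ : M →+ A}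
    (hφ : φ ∈ M.functionals) :
    ∃ φ₀ ∈ E₀.functionals, ∃ a : A, ∀ ξ, φ ξ = φ₀ (splitFst X ξ) + a * splitSnd X ξ := by
  obtain ⟨φ₀, hφ₀, _, ⟨a, rfl⟩, h⟩ := hX.comp_symm_mem hφ
  refine ⟨φ₀, hφ₀, a, fun ξ => ?_⟩
  have h' := DFunLike.congr_fun h (X ξ)
  refine Eq.trans ?_ h'
  exact congrArg φ (X.symm_apply_apply ξ).symm

theorem FModule.IsModuleIso.fst_mem {X : M ≃+ E₀.prod (self A)} (hX : IsModuleIso X) {φ : E₀ →+ A}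
    (hφ : φ ∈ E₀.functionals) :
    φ.comp (splitFst X) ∈ M.functionals := by
  refine Eq.subst (motive := fun χ => χ ∈ M.functionals) (AddMonoidHom.ext fun z => ?_)
    ((hX.2 (φ.coprod (0 : A →+ A))).1 ⟨φ, hφ, 0, zero_mem _, rfl⟩)
  exact add_zero _

theorem FModule.IsModuleIso.snd_mem {X : M ≃+ E₀.prod (self A)} (hX : IsModuleIso X) (a : A) :
    (AddMonoidHom.mulLeft a).comp (splitSnd X) ∈
      M.functionals := by
  refine Eq.subst (motive := fun χ => χ ∈ M.functionals) (AddMonoidHom.ext fun z => ?_)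
    ((hX.2 ((0 : E₀ →+ A).coprod (AddMonoidHom.mulLeft a))).1 ⟨0, zero_mem _, _, ⟨a, rfl⟩, rfl⟩)
  exact zero_add _

theorem crossSplitHom_act (hX : IsModuleIso X) (z : crossModule α M) (x : Crossed α) :
    crossSplitHom α X ((crossModule α M).act z x) =
      ((crossModule α E₀).prod (copies (Crossed α) PUnit)).act (crossSplitHom α X z) x := by
  refine cross_hom_ext (G := G) (E := M)
    (f := (crossSplitHom α X).comp ((crossModule α M).act.flip x))
    (f' := (((crossModule α E₀).prod (copies (Crossed α) PUnit)).act.flip x).comp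
      (crossSplitHom α X)) (fun g ξ => ?_) z
  refine Crossed.hom_ext
    (f := (crossSplitHom α X).comp ((crossModule α M).act (Finsupp.single g ξ : G →₀ M)))
    (f' := ((crossModule α E₀).prod (copies (Crossed α) PUnit)).act
      (crossSplitHom α X (Finsupp.single g ξ : G →₀ M))) (fun b h => ?_) x
  refine (congrArg (crossSplitHom α X) (crossModule_act_single α M g h ξ b)).trans ?_
  have h1 : splitFst X (M.act ξ (α g b)) = E₀.act (splitFst X ξ) (α g b) :=
    congrArg Prod.fst (hX.1 ξ (α g b))
  have h2 : splitSnd X (M.act ξ (α g b)) = splitSnd X ξ * α g b :=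
    congrArg Prod.snd (hX.1 ξ (α g b))
  rw [crossSplitHom_single, crossSplitHom_single, h1, h2, ← Crossed.mk_mul_mk]
  exact Prod.ext (crossModule_act_single α E₀ g h (splitFst X ξ) b).symm
    (copies_act_single PUnit.unit _ _).symm

/-- Here splitting off a single coordinate pays: a functional on one copy of `A ⋊ G` is one element,
a finite sum of terms `a ⋊ k`, and `(a ⋊ k)` times the split coordinate is `V_k` applied to its left
multiple by `α_{k⁻¹}(a)`. -/
theorem crossSplitHom_comp_mem (hX : IsModuleIso X)
    {ψ : (crossModule α E₀).prod (copies (Crossed α) PUnit) →+ Crossed α}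
    (hψ : ψ ∈ ((crossModule α E₀).prod (copies (Crossed α) PUnit)).functionals) :
    AddMonoidHom.comp ψ (crossSplitHom α X) ∈ (crossModule α M).functionals := by
  obtain ⟨ψ, hψ, _, ⟨d, rfl⟩, rfl⟩ := hψ
  have h1 : AddMonoidHom.comp (ψ.comp (AddMonoidHom.fst _ (copies (Crossed α) PUnit)))
      (crossSplitHom α X) ∈ (crossModule α M).functionals := by
    induction hψ using AddSubgroup.closure_induction with
    | zero => exact zero_mem _
    | add x y _ _ hx hy => exact add_mem hx hy
    | neg x _ hx => exact neg_mem hx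
    | mem x hx =>
      obtain ⟨g, φ, hφ, rfl⟩ := hx
      refine Eq.subst (motive := fun χ => χ ∈ (crossModule α M).functionals)
        (AddMonoidHom.ext fun z => congrArg (Crossed.V α g) ?_)
        (V_comp_crossEval_mem α M g (hX.fst_mem hφ))
      exact Crossed.ext fun k => rfl
  have h2 : (AddMonoidHom.mulLeft (d PUnit.unit)).comp
      (crossEval α (splitSnd X)) ∈
        (crossModule α M).functionals := by
    let L : Crossed α →+ ((G →₀ M) →+ Crossed α) :=
      (AddMonoidHom.compHom.flip (crossEval α (splitSnd X))).comp AddMonoidHom.mul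
    change L (d PUnit.unit) ∈ (crossModule α M).functionals
    induction d PUnit.unit using Crossed.induction with
    | h0 => rw [map_zero]; exact zero_mem (crossModule α M).functionals
    | hadd x y hx hy =>
      rw [map_add]
      exact (crossModule α M).functionals.add_mem hx hy
    | hmk a k =>
      refine Eq.subst (motive := fun χ => χ ∈ (crossModule α M).functionals)
        (AddMonoidHom.ext fun z => ?_) (V_comp_crossEval_mem α M k (hX.snd_mem (α k⁻¹ a)))
      exact (mk_mul_crossEval α a k _ z).symm
  refine Eq.subst (motive := fun χ => χ ∈ (crossModule α M).functionals)
    (AddMonoidHom.ext fun z => ?_) (add_mem h1 h2)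
  refine congrArg (ψ (crossSplitHom α X z).1 + ·) ?_
  refine Eq.trans ?_ (rowFunctional_punit d (crossSplitHom α X z).2).symm
  rw [crossSplitHom_coord]
  rfl

theorem exists_comp_crossSplitHom (hX : IsModuleIso X) {χ : crossModule α M →+ Crossed α}
    (hχ : χ ∈ (crossModule α M).functionals) :
    ∃ ψ ∈ ((crossModule α E₀).prod (copies (Crossed α) PUnit)).functionals,
      AddMonoidHom.comp ψ (crossSplitHom α X) = χ := by
  induction hχ using AddSubgroup.closure_induction with
  | zero => exact ⟨0, zero_mem _, rfl⟩
  | add x y _ _ hx hy =>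
    obtain ⟨x, hx, rfl⟩ := hx
    obtain ⟨y, hy, rfl⟩ := hy
    exact ⟨_, add_mem hx hy, rfl⟩
  | neg x _ hx =>
    obtain ⟨x, hx, rfl⟩ := hx
    exact ⟨_, neg_mem hx, rfl⟩
  | mem x hx =>
    obtain ⟨g, φ, hφ, rfl⟩ := hx
    obtain ⟨φ₀, hφ₀, a, h⟩ := hX.exists_split hφ
    -- If `φ = φ₀ + a ·`, the second summand gives `V_g(a b ⋊ k) = (α_g(a) ⋊ g)(b ⋊ k)`.
    refine ⟨_, ⟨_, V_comp_crossEval_mem α E₀ g hφ₀, _, ⟨fun _ => Crossed.mk α (α g a) g, rfl⟩,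
      rfl⟩, AddMonoidHom.ext <| cross_hom_ext fun k ξ => ?_⟩
    refine (congrArg (AddMonoidHom.coprod ((Crossed.V α g).comp (crossEval α φ₀))
      (rowFunctional (Crossed α) PUnit fun _ => Crossed.mk α (α g a) g))
      (crossSplitHom_single X k ξ)).trans ?_
    change Crossed.V α g (crossEval α φ₀ (Finsupp.single k (splitFst X ξ))) +
      rowFunctional (Crossed α) PUnit (fun _ => Crossed.mk α (α g a) g)
        (single PUnit.unit (Crossed.mk α (splitSnd X ξ) k)) =
      Crossed.V α g (crossEval α φ (Finsupp.single k ξ))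
    rw [rowFunctional_apply_single, crossEval_single, crossEval_single, Crossed.V_mk,
      Crossed.V_mk, Crossed.mk_mul_mk, ← map_mul, ← Crossed.mk_add, ← map_add, h]

theorem crossSplit_isModuleIso (hX : IsModuleIso X) : IsModuleIso (crossSplit α X) := by
  refine ⟨crossSplitHom_act X hX, fun ψ => ⟨crossSplitHom_comp_mem X hX, fun h => ?_⟩⟩
  obtain ⟨ψ', hψ', h'⟩ := exists_comp_crossSplitHom X hX h
  refine Eq.subst (motive := fun χ => χ ∈
    ((crossModule α E₀).prod (copies (Crossed α) PUnit)).functionals)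
    (AddMonoidHom.ext fun w => ?_) hψ'
  obtain ⟨z, rfl⟩ := (crossSplit α X).surjective w
  exact DFunLike.congr_fun h' z

end split

/-! ### Separating the coordinate `i₀` from the other copies of `A` -/

section coordinate

variable {I : Type u} (i₀ : I)

/-- The restriction `(b_i)_i ↦ (b_i)_{i ≠ i₀}`. -/
def removeCoord : copies A I →+ copies A {i // i ≠ i₀} :=
  (Finsupp.subtypeDomainAddMonoidHom : (I →₀ A) →+ ({i // i ≠ i₀} →₀ A))

theorem coord_removeCoord (η : copies A I) (i : {i // i ≠ i₀}) :
    coord i (removeCoord i₀ η) = coord i.1 η := rfl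

theorem removeCoord_single_same (a : A) : removeCoord i₀ (single i₀ a) = 0 :=
  copies_ext fun i => coord_single_of_ne i.2 a

theorem removeCoord_single (i : {i // i ≠ i₀}) (a : A) :
    removeCoord i₀ (single i.1 a) = single i a :=
  copies_ext fun k => by
    rw [coord_removeCoord]
    by_cases h : k = i
    · subst h; rw [coord_single_same, coord_single_same]
    · rw [coord_single_of_ne h, coord_single_of_ne fun h' => h (Subtype.ext h')]

theorem exists_removeCoord (ζ : copies A {i // i ≠ i₀}) (a : A) :
    ∃ η : copies A I, removeCoord i₀ η = ζ ∧ coord i₀ η = a := by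
  classical
  obtain ⟨η, hη⟩ : ∃ η : copies A I, removeCoord i₀ η = ζ :=
    ⟨Finsupp.extendDomain (P := fun i => i ≠ i₀) (M := A) ζ,
      Finsupp.subtypeDomain_extendDomain (M := A) ζ⟩
  -- Any lift of `ζ` may be corrected in the coordinate `i₀`, which the restriction ignores.
  refine ⟨η + single i₀ (a - coord i₀ η), ?_, ?_⟩
  · rw [map_add, removeCoord_single_same, add_zero, hη]
  · rw [map_add, coord_single_same, add_sub_cancel]

/-- The map `ξ ⊕ (b_i)_i ↦ (ξ ⊕ (b_i)_{i ≠ i₀}) ⊕ b_{i₀}`. -/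
def splitCoordHom (E : FModule A) :
    E.prod (copies A I) →+ (E.prod (copies A {i // i ≠ i₀})).prod (self A) :=
  AddMonoidHom.prod (M := E × copies A I) (N := E × copies A {i // i ≠ i₀}) (P := A)
    ((AddMonoidHom.fst E (copies A I)).prod
      ((removeCoord i₀).comp (AddMonoidHom.snd E (copies A I))))
    ((coord i₀).comp (AddMonoidHom.snd E (copies A I)))

theorem splitCoordHom_bijective (E : FModule A) : Function.Bijective (splitCoordHom i₀ E) := by
  constructor
  · rintro ⟨ξ, η⟩ ⟨ξ', η'⟩ h
    refine Prod.ext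
      (congrArg (fun y : (E × copies A {i // i ≠ i₀}) × A => y.1.1) h) (copies_ext fun i => ?_)
    by_cases hi : i = i₀
    · subst hi
      exact congrArg (fun y : (E × copies A {k // k ≠ i}) × A => y.2) h
    · exact congrArg (fun y : (E × copies A {i // i ≠ i₀}) × A => coord ⟨i, hi⟩ y.1.2) h
  · rintro ⟨⟨ξ, ζ⟩, a⟩
    obtain ⟨η, rfl, rfl⟩ := exists_removeCoord i₀ ζ a
    exact ⟨((ξ, η) : E × copies A I), rfl⟩

/-- The isomorphism `E ⊕ ⨁_{i ∈ I} A ≅ (E ⊕ ⨁_{i ≠ i₀} A) ⊕ A`. -/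
def splitCoord (E : FModule A) :
    E.prod (copies A I) ≃+ (E.prod (copies A {i // i ≠ i₀})).prod (self A) :=
  AddEquiv.ofBijective (splitCoordHom i₀ E) (splitCoordHom_bijective i₀ E)

theorem rowFunctional_split (c : I → A) (η : copies A I) :
    rowFunctional A I c η =
      rowFunctional A {i // i ≠ i₀} (fun i => c i) (removeCoord i₀ η) + c i₀ * coord i₀ η := by
  let f : copies A {i // i ≠ i₀} →+ A := rowFunctional A {i // i ≠ i₀} fun i => c i
  refine copies_hom_ext (f := rowFunctional A I c)
    (f' := f.comp (removeCoord i₀) + (AddMonoidHom.mulLeft (c i₀)).comp (coord i₀))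
    (fun i a => ?_) η
  change rowFunctional A I c (single i a) =
    f (removeCoord i₀ (single i a)) + c i₀ * coord i₀ (single i a)
  rw [rowFunctional_apply_single]
  by_cases hi : i = i₀
  · subst hi
    rw [removeCoord_single_same, coord_single_same, map_zero, zero_add]
  · rw [removeCoord_single i₀ ⟨i, hi⟩, coord_single_of_ne (Ne.symm hi), mul_zero, add_zero]
    exact (rowFunctional_apply_single (fun k : {k // k ≠ i₀} => c k) ⟨i, hi⟩ a).symm

theorem splitCoord_isModuleIso (E : FModule A) : IsModuleIso (splitCoord i₀ E) := by
  classical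
  refine ⟨fun z a => Prod.ext (Prod.ext rfl (copies_ext fun _ => rfl)) rfl, fun ψ => ⟨?_, ?_⟩⟩
  · rintro ⟨_, ⟨φ, hφ, _, ⟨d, rfl⟩, rfl⟩, _, ⟨a, rfl⟩, rfl⟩
    -- The family on `I` is assembled from `d` away from `i₀` and the multiplier `a` at `i₀`.
    refine ⟨φ, hφ, _, ⟨fun i => if h : i ≠ i₀ then d ⟨i, h⟩ else a, rfl⟩,
      AddMonoidHom.ext fun z => ?_⟩
    refine Eq.trans ?_ (congrArg (φ z.1 + ·) (rowFunctional_split i₀ _ z.2).symm)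
    have h : (fun i : {i // i ≠ i₀} => if h : i.1 ≠ i₀ then d ⟨i, h⟩ else a) = d :=
      funext fun i => dif_pos i.2
    rw [h, dif_neg (not_not.2 rfl)]
    exact add_assoc _ _ _
  · rintro ⟨φ, hφ, _, ⟨c, rfl⟩, h⟩
    refine ⟨_, ⟨φ, hφ, _, ⟨fun i => c i, rfl⟩, rfl⟩, _, ⟨c i₀, rfl⟩, AddMonoidHom.ext fun w => ?_⟩
    obtain ⟨z, rfl⟩ := (splitCoord i₀ E).surjective w
    refine (DFunLike.congr_fun h z).trans ?_
    refine (congrArg (φ z.1 + ·) (rowFunctional_split i₀ c z.2)).trans ?_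
    exact (add_assoc _ _ _).symm

end coordinate

/-! ### The corner homomorphism on formal sums -/

section corner

variable {I : Type u} {i₀ : I} {U : ModAction α (copies A I)}

/-- On `ξ ⋊ h` both operators for `b ⋊ g` have the entry `b α_g(ξ_{i₀}) ⋊ g h` in the split
coordinate and vanish in the complement. -/
theorem crossSplit_corner (hA : IsQuadratik A) (S : ModAction α E) (hU : U.IsDistinguished i₀)
    (x : Crossed α) :
    compactsEquiv (crossSplit α (splitCoord i₀ E)) (crossSplit_isModuleIso _ (splitCoord_isModuleIso i₀ E))
      ((S.prod U).crossCompacts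
        (Crossed.map (cornerHom hA E I i₀) (cornerHom_equivariant hA S U hU) x)) =
      cornerHom (Crossed.quadratik α hA) (crossModule α (E.prod (copies A {i // i ≠ i₀})))
        PUnit.{u + 1} PUnit.unit x := by
  induction x using Crossed.induction with
  | h0 => simp only [map_zero]
  | hadd x y hx hy => simp only [map_add, hx, hy]
  | hmk b g =>
    rw [Crossed.map_mk]
    refine Subtype.ext <| AddMonoidHom.ext fun w => ?_
    obtain ⟨z, rfl⟩ := (crossSplit α (splitCoord i₀ E)).surjective w
    refine (compactsEquiv_apply _ _ _ z).trans ?_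
    refine cross_hom_ext (G := G) (E := E.prod (copies A I))
      (f := (crossSplitHom α (splitCoord i₀ E)).comp ((S.prod U).crossRep
        (Crossed.mk (S.prod U).Ad (cornerHom hA E I i₀ b) g)))
      (f' := AddMonoidHom.comp
        (cornerOp (crossModule α (E.prod (copies A {i // i ≠ i₀}))) PUnit.{u + 1} PUnit.unit
          (Crossed.mk α b g)) (crossSplitHom α (splitCoord i₀ E))) (fun h ξ => ?_) z
    refine (congrArg (crossSplitHom α (splitCoord i₀ E))
      ((S.prod U).crossRep_mk_single _ g h ξ)).trans ?_
    refine (crossSplitHom_single (splitCoord i₀ E) _ _).trans ?_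
    refine Eq.trans ?_ (congrArg (cornerOp (crossModule α (E.prod (copies A {i // i ≠ i₀})))
      PUnit.{u + 1} PUnit.unit (Crossed.mk α b g))
      (crossSplitHom_single (splitCoord i₀ E) h ξ)).symm
    refine Prod.ext ?_ ?_
    · have h0 : splitFst (splitCoord i₀ E)
          (cornerOp E I i₀ b ((S.prod U).S g ξ)) = 0 :=
        Prod.ext rfl (removeCoord_single_same i₀ _)
      exact (congrArg (Finsupp.single (g * h)) h0).trans (Finsupp.single_zero _)
    · change single PUnit.unit (Crossed.mk α
          (coord i₀ (single i₀ (b * coord i₀ (U.S g ξ.2)))) (g * h)) =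
        single PUnit.unit (Crossed.mk α b g *
          coord PUnit.unit (single PUnit.unit (Crossed.mk α (coord i₀ ξ.2) h)))
      rw [coord_single_same, coord_single_same, Crossed.mk_mul_mk, hU.coord_S]

end corner

end crossModule

/-! ### Descent of corner embeddings -/

section descent

variable {G : Type u} [Group G]

theorem Crossed.map_surjective {A B : Type u} [NonUnitalRing A] [NonUnitalRing B]
    {α : G →* RingAut A} {β : G →* RingAut B} (π : A →ₙ+* B) (hπ : ∀ g a, π (α g a) = β g (π a))
    (h : Function.Surjective π) : Function.Surjective (Crossed.map π hπ) := fun y => by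
  change y ∈ (Crossed.map π hπ).toAddMonoidHom.range
  induction y using Crossed.induction with
  | h0 => exact zero_mem _
  | hadd x y hx hy => exact add_mem hx hy
  | hmk b g =>
    obtain ⟨a, rfl⟩ := h b
    exact ⟨Crossed.mk α a g, Crossed.map_mk π hπ a g⟩

/-- The trivial action of the trivial group on a functional module. -/
def ModAction.trivial {A : Type u} [NonUnitalRing A] (E : FModule A) :
    ModAction (1 : PUnit.{u + 1} →* RingAut A) E where
  S := 1
  S_act _ _ _ := rfl
  invariant _ _ hφ := hφ

/-- The complement consists of formal sums over `E` together with the copies of `A` at `i ≠ i₀`, and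
the new index set is a point. The acting group is now trivial, so equivariance holds by definition.
-/
theorem isCorner_descHom {A K : QRing G} (e : EHom A K) (he : IsCorner e) :
    IsCorner (descHom e) := by
  obtain ⟨E, S, I, i₀, U, hU, hE, κ, hκ, hκe⟩ := he
  let κ' : Crossed K.action ≃+* Crossed (S.prod U).Ad :=
    RingEquiv.ofBijective (Crossed.map (κ : K →ₙ+* (E.prod (copies A I)).compacts) hκ)
      ⟨Crossed.map_injective _ hκ κ.injective, Crossed.map_surjective _ hκ κ.surjective⟩
  refine ⟨crossModule A.action (E.prod (copies A {i // i ≠ i₀})), ModAction.trivial _,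
    PUnit.{u + 1}, PUnit.unit, ModAction.trivial _, ⟨fun _ _ => rfl, fun _ _ h => h⟩,
    prod_copies_cofull (Crossed.quadratik _ A.quadratik) PUnit.unit
      (crossModule_nondegenerate (hE.nondegenerate.fst.prod (copies_nondegenerate A.quadratik _))),
    (κ'.trans (S.prod U).crossCompactsEquiv).trans
      (compactsEquiv (crossSplit A.action (splitCoord i₀ E))
        (crossSplit_isModuleIso _ (splitCoord_isModuleIso i₀ E))), fun _ _ => rfl, fun x => ?_⟩
  refine Eq.trans ?_ (crossSplit_corner A.quadratik S hU x)
  refine congrArg (fun y => compactsEquiv (crossSplit A.action (splitCoord i₀ E))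
    (crossSplit_isModuleIso _ (splitCoord_isModuleIso i₀ E)) ((S.prod U).crossCompacts y)) ?_
  refine Crossed.ext fun g => ?_
  refine (Crossed.coeff_map _ hκ _ g).trans ?_
  refine (congrArg κ (Crossed.coeff_map e.toHom e.equivariant x g)).trans ?_
  exact (hκe _).trans (Crossed.coeff_map (cornerHom A.quadratik E I i₀) _ x g).symm

end descent

/-! ### The descent functor -/

section descentFunctor

variable {G : Type u} [Group G]

theorem EHom.ext_apply {A B : QRing G} {f f' : EHom A B} (h : ∀ a, f.toHom a = f'.toHom a) :
    f = f' := EHom.ext (NonUnitalRingHom.ext h)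

theorem descHom_comp {A B C : QRing G} (f : EHom A B) (h : EHom B C) :
    (descHom f).comp (descHom h) = descHom (f.comp h) :=
  EHom.ext_apply fun x => Crossed.ext fun g => by
    refine (Crossed.coeff_map h.toHom h.equivariant _ g).trans ?_
    refine (congrArg h.toHom (Crossed.coeff_map f.toHom f.equivariant x g)).trans ?_
    exact (Crossed.coeff_map (f.comp h).toHom (f.comp h).equivariant x g).symm

theorem descHom_id (A : QRing G) : descHom (EHom.id A) = EHom.id (descObj A) :=
  EHom.ext_apply fun x => Crossed.ext fun g =>
    Crossed.coeff_map (EHom.id A).toHom (EHom.id A).equivariant x g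

/-- The homomorphism `(A × B) ⋊ G → A ⋊ G × B ⋊ G`. -/
def descProd (A B : QRing G) : EHom (descObj (A.prod B)) ((descObj A).prod (descObj B)) where
  toHom := NonUnitalRingHom.prod (descHom (EHom.fst A B)).toHom (descHom (EHom.snd A B)).toHom
  equivariant _ _ := rfl

/-- The image of `f` is invariant under `G`, so orthogonality to `f(b)` for all `b` includes
orthogonality to its translates, which occur in the crossed product. -/
theorem descHom_mul_eq_zero {A B C : QRing G} (e : EHom A C) (f : EHom B C)
    (h : ∀ a b, e.toHom a * f.toHom b = 0) (x : Crossed A.action) (y : Crossed B.action) :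
    Crossed.map e.toHom e.equivariant x * Crossed.map f.toHom f.equivariant y = 0 := by
  induction x using Crossed.induction with
  | h0 => rw [map_zero, zero_mul]
  | hadd x x' hx hx' => rw [map_add, add_mul, hx, hx', add_zero]
  | hmk a g =>
    induction y using Crossed.induction with
    | h0 => rw [map_zero, mul_zero]
    | hadd y y' hy hy' => rw [map_add, mul_add, hy, hy', add_zero]
    | hmk b k =>
      rw [Crossed.map_mk, Crossed.map_mk, Crossed.mk_mul_mk, ← f.equivariant, h, Crossed.mk_zero]

theorem add_mul_add_of_mul_eq_zero {R : Type u} [NonUnitalRing R] {x y x' y' : R}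
    (h1 : x * y' = 0) (h2 : y * x' = 0) : x * x' + y * y' = (x + y) * (x' + y') := by
  rw [add_mul, mul_add, mul_add, h1, h2, add_zero, zero_add]

/-- The homomorphism `A ⋊ G × B ⋊ G → (A × B) ⋊ G`. -/
def descProdInv (A B : QRing G) : EHom ((descObj A).prod (descObj B)) (descObj (A.prod B)) where
  toHom :=
    { __ := AddMonoidHom.coprod (descHom (EHom.inl A B)).toHom.toAddMonoidHom
        (descHom (EHom.inr A B)).toHom.toAddMonoidHom
      map_mul' := by
        rintro ⟨x, y⟩ ⟨x', y'⟩
        set i := Crossed.map (EHom.inl A B).toHom (EHom.inl A B).equivariant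
        set k := Crossed.map (EHom.inr A B).toHom (EHom.inr A B).equivariant
        -- The sum of the two inclusions is multiplicative because their images annihilate each
        -- other.
        have h1 : ∀ x y, i x * k y = 0 := descHom_mul_eq_zero (EHom.inl A B) (EHom.inr A B)
          fun a b => Prod.ext (mul_zero a) (zero_mul b)
        have h2 : ∀ x y, k y * i x = 0 := fun x y =>
          descHom_mul_eq_zero (EHom.inr A B) (EHom.inl A B)
            (fun b a => Prod.ext (zero_mul a) (mul_zero b)) y x
        change i (x * x') + k (y * y') = (i x + k y) * (i x' + k y')
        exact (congrArg₂ (· + ·) (map_mul i x x') (map_mul k y y')).trans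
          (add_mul_add_of_mul_eq_zero (h1 x y') (h2 x' y)) }
  equivariant _ _ := rfl

theorem descHom_inl (A B : QRing G) :
    (EHom.inl (descObj A) (descObj B)).comp (descProdInv A B) = descHom (EHom.inl A B) :=
  EHom.ext_apply fun x =>
    (congrArg ((descHom (EHom.inl A B)).toHom x + ·) (map_zero (descHom (EHom.inr A B)).toHom)).trans
      (add_zero _)

theorem descHom_inr (A B : QRing G) :
    (EHom.inr (descObj A) (descObj B)).comp (descProdInv A B) = descHom (EHom.inr A B) :=
  EHom.ext_apply fun x =>
    (congrArg (· + (descHom (EHom.inr A B)).toHom x) (map_zero (descHom (EHom.inl A B)).toHom)).trans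
      (zero_add _)

theorem descProd_comp_inv (A B : QRing G) :
    (descProd A B).comp (descProdInv A B) = EHom.id (descObj (A.prod B)) :=
  EHom.ext_apply fun x => by
    refine Crossed.hom_ext (f := ((descProd A B).comp (descProdInv A B)).toHom.toAddMonoidHom)
      (f' := AddMonoidHom.id (Crossed (A.prod B).action)) (fun a g => ?_) x
    change Crossed.map (EHom.inl A B).toHom (EHom.inl A B).equivariant
        (Crossed.map (EHom.fst A B).toHom (EHom.fst A B).equivariant (Crossed.mk _ a g)) +
      Crossed.map (EHom.inr A B).toHom (EHom.inr A B).equivariant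
        (Crossed.map (EHom.snd A B).toHom (EHom.snd A B).equivariant (Crossed.mk _ a g)) =
      Crossed.mk _ a g
    rw [Crossed.map_mk, Crossed.map_mk, Crossed.map_mk, Crossed.map_mk, ← Crossed.mk_add]
    exact congrArg (fun a => Crossed.mk (A.prod B).action a g)
      (Prod.ext (add_zero a.1) (zero_add a.2))

/-! ### Homotopies of crossed products -/

section homotopy

variable {B : Type u} [NonUnitalRing B] (β : G →* RingAut B)

/-- The map `b ⊗ c ↦ (b ⋊ g) ⊗ c`. -/
def crossTensor (g : G) :
    B ⊗[ℤ] C(unitInterval, ℂ) →ₗ[ℤ] Crossed β ⊗[ℤ] C(unitInterval, ℂ) :=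
  TensorProduct.map (Crossed.mkHom β g).toIntLinearMap LinearMap.id

theorem tensor_zero_mul (u : B ⊗[ℤ] C(unitInterval, ℂ)) : 0 * u = 0 :=
  MulZeroClass.zero_mul u

theorem tensor_mul_zero (u : B ⊗[ℤ] C(unitInterval, ℂ)) : u * 0 = 0 :=
  MulZeroClass.mul_zero u

theorem tensor_add_mul (u v w : B ⊗[ℤ] C(unitInterval, ℂ)) : (u + v) * w = u * w + v * w :=
  NonUnitalNonAssocSemiring.right_distrib u v w

theorem tensor_mul_add (u v w : B ⊗[ℤ] C(unitInterval, ℂ)) : u * (v + w) = u * v + u * w :=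
  NonUnitalNonAssocSemiring.left_distrib u v w

/-- As `G` acts trivially on `C([0,1], ℂ)`, the crossed product `(B ⊗ C[0,1]) ⋊ G` maps to `(B ⋊ G)
⊗ C[0,1]`; this is the multiplicativity of that map on its generators. -/
theorem crossTensor_mul (g h : G) (u v : B ⊗[ℤ] C(unitInterval, ℂ)) :
    crossTensor β g u * crossTensor β h v = crossTensor β (g * h)
      (u * TensorProduct.map (AddMonoidHom.toIntLinearMap (β g : B ≃+ B).toAddMonoidHom)
        LinearMap.id v) := by
  induction u using TensorProduct.induction_on with
  | zero => rw [map_zero, tensor_zero_mul, tensor_zero_mul, map_zero]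
  | add u u' hu hu' => rw [map_add, tensor_add_mul, tensor_add_mul, map_add, hu, hu']
  | tmul b c =>
    induction v using TensorProduct.induction_on with
    | zero => rw [map_zero, map_zero, tensor_mul_zero, tensor_mul_zero, map_zero]
    | add v v' hv hv' =>
      rw [map_add, map_add, tensor_mul_add, tensor_mul_add, map_add, hv, hv']
    | tmul b' c' =>
      change (Crossed.mk β b g ⊗ₜ[ℤ] c) * (Crossed.mk β b' h ⊗ₜ[ℤ] c') =
        crossTensor β (g * h) ((b ⊗ₜ[ℤ] c) * (β g b' ⊗ₜ[ℤ] c'))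
      rw [Algebra.TensorProduct.tmul_mul_tmul, Algebra.TensorProduct.tmul_mul_tmul,
        Crossed.mk_mul_mk]
      rfl

theorem evalAt_crossTensor (t : unitInterval) (g : G) (u : B ⊗[ℤ] C(unitInterval, ℂ)) :
    evalAt (Crossed β) t (crossTensor β g u) =
      TensorProduct.map (Crossed.mkHom β g).toIntLinearMap LinearMap.id (evalAt B t u) := by
  induction u using TensorProduct.induction_on with
  | zero => simp only [map_zero]
  | add u u' hu hu' => simp only [map_add, hu, hu']
  | tmul b c => rfl

end homotopy

theorem homotopic_descHom {A B : QRing G} {f₀ f₁ : EHom A B} (h : Homotopic f₀ f₁) :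
    Homotopic (descHom f₀) (descHom f₁) := by
  obtain ⟨f, hf, h₀, h₁⟩ := h
  let l : Crossed A.action →+ Crossed B.action ⊗[ℤ] C(unitInterval, ℂ) :=
    Crossed.lift A.action fun g => (crossTensor B.action g).toAddMonoidHom.comp f.toAddMonoidHom
  have hl : ∀ a g, l (Crossed.mk A.action a g) = crossTensor B.action g (f a) :=
    fun a g => Crossed.lift_mk _ _ _ _
  have hmul : ∀ x y, l (x * y) = l x * l y := fun x y => by
    induction x using Crossed.induction with
    | h0 => rw [zero_mul, map_zero, tensor_zero_mul]
    | hadd x x' hx hx' => rw [add_mul, map_add, map_add, tensor_add_mul, hx, hx']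
    | hmk a g =>
      induction y using Crossed.induction with
      | h0 => rw [mul_zero, map_zero, tensor_mul_zero]
      | hadd y y' hy hy' => rw [mul_add, map_add, map_add, tensor_mul_add, hy, hy']
      | hmk b k => rw [Crossed.mk_mul_mk, hl, hl, hl, crossTensor_mul, map_mul, hf]
  have heval : ∀ (t : unitInterval) (e : EHom A B),
      (∀ a, evalAt B t (f a) = e.toHom a ⊗ₜ[ℤ] (1 : ℂ)) → ∀ x : Crossed A.action,
        evalAt (Crossed B.action) t (l x) =
          Crossed.map e.toHom e.equivariant x ⊗ₜ[ℤ] (1 : ℂ) := fun t e he x => by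
    induction x using Crossed.induction with
    | h0 => rw [map_zero, map_zero, map_zero, TensorProduct.zero_tmul]
    | hadd x y hx hy => rw [map_add, map_add, map_add, TensorProduct.add_tmul, hx, hy]
    | hmk a g => rw [hl, evalAt_crossTensor, he, Crossed.map_mk]; rfl
  refine ⟨{ l with map_mul' := hmul }, fun g x => ?_, heval 0 f₀ h₀, heval 1 f₁ h₁⟩
  exact (DFunLike.congr_fun (TensorProduct.map_id (R := ℤ) (M := Crossed B.action)
    (N := C(unitInterval, ℂ))) (l x)).symm

/-- The value of the descent functor on words. -/
def descWord : {A B : QRing G} → Word G A B → Word PUnit.{u + 1} (descObj A) (descObj B)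
  | _, _, .hom f => .hom (descHom f)
  | _, _, .cornerInv e he => .cornerInv (descHom e) (isCorner_descHom e he)
  | _, _, .delta s => .delta (descSplit s)
  | _, _, .one A => .one (descObj A)
  | _, _, .comp x y => .comp (descWord x) (descWord y)
  | _, _, .zero A B => .zero (descObj A) (descObj B)
  | _, _, .add x y => .add (descWord x) (descWord y)
  | _, _, .neg x => .neg (descWord x)

/-- The biproduct relation for `A ⋊ G` and `B ⋊ G` is inserted between the maps to and from `A ⋊ G ×
B ⋊ G`, whose composite on `(A × B) ⋊ G` is the identity. -/
theorem rel_biprod_descWord (A B : QRing G) : Rel (descWord (Word.one (A.prod B)))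
    (descWord (((Word.hom (EHom.fst A B)).comp (Word.hom (EHom.inl A B))).add
      ((Word.hom (EHom.snd A B)).comp (Word.hom (EHom.inr A B))))) := by
  have h := Rel.comp_congr (Rel.comp_congr (Rel.refl (Word.hom (descProd A B)))
    (Rel.biprod (descObj A) (descObj B))) (Rel.refl (Word.hom (descProdInv A B)))
  have h1 : Rel (((Word.hom (descProd A B)).comp (Word.one _)).comp (Word.hom (descProdInv A B)))
      (Word.one (descObj (A.prod B))) :=
    (Rel.comp_congr (Rel.comp_one _) (Rel.refl _)).trans <| (Rel.hom_comp _ _).trans <| by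
      rw [descProd_comp_inv]
      exact Rel.hom_id _
  refine (h1.symm.trans h).trans ?_
  refine (Rel.comp_congr (Rel.comp_add _ _ _) (Rel.refl _)).trans ?_
  refine (Rel.add_comp _ _ _).trans ?_
  refine Rel.add_congr ?_ ?_
  · refine (Rel.comp_congr (Rel.comp_assoc _ _ _).symm (Rel.refl _)).trans ?_
    refine (Rel.comp_assoc _ _ _).trans (Rel.comp_congr (Rel.hom_comp _ _) ?_)
    refine (Rel.hom_comp _ _).trans ?_
    rw [descHom_inl]
    exact Rel.refl _
  · refine (Rel.comp_congr (Rel.comp_assoc _ _ _).symm (Rel.refl _)).trans ?_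
    refine (Rel.comp_assoc _ _ _).trans (Rel.comp_congr (Rel.hom_comp _ _) ?_)
    refine (Rel.hom_comp _ _).trans ?_
    rw [descHom_inr]
    exact Rel.refl _

theorem rel_descWord {A B : QRing G} {x y : Word G A B} (h : Rel x y) :
    Rel (descWord x) (descWord y) := by
  induction h with
  | refl x => exact Rel.refl _
  | symm _ ih => exact ih.symm
  | trans _ _ ih ih' => exact ih.trans ih'
  | comp_congr _ _ ih ih' => exact Rel.comp_congr ih ih'
  | add_congr _ _ ih ih' => exact Rel.add_congr ih ih'
  | neg_congr _ ih => exact Rel.neg_congr ih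
  | comp_assoc x y z => exact Rel.comp_assoc _ _ _
  | one_comp x => exact Rel.one_comp _
  | comp_one x => exact Rel.comp_one _
  | add_assoc x y z => exact Rel.add_assoc _ _ _
  | add_comm x y => exact Rel.add_comm _ _
  | zero_add x => exact Rel.zero_add _
  | neg_add x => exact Rel.neg_add _
  | comp_add x y z => exact Rel.comp_add _ _ _
  | add_comp x y z => exact Rel.add_comp _ _ _
  | hom_comp f h =>
    refine (Rel.hom_comp _ _).trans ?_
    rw [descHom_comp]
    exact Rel.refl _
  | hom_id A =>
    change Rel (Word.hom (descHom (EHom.id A))) _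
    rw [descHom_id]
    exact Rel.hom_id _
  | biprod A B => exact rel_biprod_descWord A B
  | homotopy f₀ f₁ h => exact Rel.homotopy _ _ (homotopic_descHom h)
  | corner_left e he => exact Rel.corner_left _ _
  | corner_right e he => exact Rel.corner_right _ _
  | split_left s => exact Rel.split_left (descSplit s)
  | split_right s => exact Rel.split_right (descSplit s)

variable (G) in
/-- The descent functor `j^G`. -/
def descentFunctor : GK G ⥤ GK PUnit.{u + 1} where
  obj A := ⟨descObj A.ring⟩
  map {A B} x := Quotient.map descWord (fun _ _ h => rel_descWord h) x
  map_id _ := rfl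
  map_comp := by rintro A B C ⟨x⟩ ⟨y⟩; rfl

theorem isDescentFunctor_descentFunctor : IsDescentFunctor (descentFunctor G) where
  additive := ⟨by rintro A B ⟨x⟩ ⟨y⟩; rfl⟩
  obj_eq _ := rfl
  map_ofHom π := ((Category.id_comp _).trans (Category.comp_id (GK.ofHom (descHom π)))).symm
  map_cornerInv {A K} e he := by
    -- Invertibility comes from the formal inverse in `GK`, available because the descended map is
    -- itself a corner embedding.
    have h1 : GK.ofHom (descHom e) ≫ GK.cornerInv (descHom e) (isCorner_descHom e he) = 𝟙 _ :=
      Quotient.sound (Rel.corner_left _ _)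
    have h2 : GK.cornerInv (descHom e) (isCorner_descHom e he) ≫ GK.ofHom (descHom e) = 𝟙 _ :=
      Quotient.sound (Rel.corner_right _ _)
    have h : IsIso (GK.ofHom (descHom e)) := ⟨_, h1, h2⟩
    refine ⟨h, ?_⟩
    refine Eq.trans ?_ ((Category.id_comp _).trans
      (Category.comp_id (inv (GK.ofHom (descHom e))))).symm
    exact (IsIso.inv_eq_of_hom_inv_id h1).symm
  map_delta s := ((Category.id_comp _).trans (Category.comp_id (GK.delta (descSplit s)))).symm

/-- Functoriality and additivity propagate the prescribed values from the generators to all words,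
which forces uniqueness. -/
theorem IsDescentFunctor.map_cls {F : GK G ⥤ GK PUnit.{u + 1}} (hF : IsDescentFunctor F)
    {A B : QRing G} (x : Word G A B) :
    F.map (GK.cls x : (⟨A⟩ : GK G) ⟶ ⟨B⟩) = eqToHom (hF.obj_eq A) ≫
      (GK.cls (descWord x) : (⟨descObj A⟩ : GK PUnit.{u + 1}) ⟶ ⟨descObj B⟩) ≫
        eqToHom (hF.obj_eq B).symm := by
  have := hF.additive
  induction x with
  | hom f => exact hF.map_ofHom f
  | cornerInv e he =>
    obtain ⟨h, h'⟩ := hF.map_cornerInv e he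
    refine h'.trans ?_
    congr 2
    have h1 : GK.ofHom (descHom e) ≫ GK.cornerInv (descHom e) (isCorner_descHom e he) = 𝟙 _ :=
      Quotient.sound (Rel.corner_left _ _)
    exact IsIso.inv_eq_of_hom_inv_id h1
  | delta s => exact hF.map_delta s
  | one A =>
    refine (F.map_id _).trans ?_
    symm
    change _ ≫ 𝟙 _ ≫ _ = _
    simp
  | comp x y hx hy =>
    refine (F.map_comp (GK.cls x : (⟨_⟩ : GK G) ⟶ ⟨_⟩) (GK.cls y : (⟨_⟩ : GK G) ⟶ ⟨_⟩)).trans ?_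
    rw [hx, hy]
    simp only [Category.assoc, eqToHom_trans_assoc, eqToHom_refl, Category.id_comp]
    exact congrArg (fun f => eqToHom (hF.obj_eq _) ≫ f) (Category.assoc _ _ _).symm
  | zero A B =>
    refine (F.map_zero _ _).trans ?_
    symm
    change _ ≫ 0 ≫ _ = _
    simp
  | add x y hx hy =>
    refine (F.map_add (f := (GK.cls x : (⟨_⟩ : GK G) ⟶ ⟨_⟩))
      (g := (GK.cls y : (⟨_⟩ : GK G) ⟶ ⟨_⟩))).trans ?_
    rw [hx, hy, ← Preadditive.comp_add, ← Preadditive.add_comp]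
    rfl
  | neg x hx =>
    refine (F.map_neg (f := (GK.cls x : (⟨_⟩ : GK G) ⟶ ⟨_⟩))).trans ?_
    rw [hx, ← Preadditive.comp_neg, ← Preadditive.neg_comp]
    rfl

theorem existsUnique_isDescentFunctor :
    ∃! F : GK G ⥤ GK PUnit.{u + 1}, IsDescentFunctor F := by
  refine ⟨descentFunctor G, isDescentFunctor_descentFunctor, fun F hF => ?_⟩
  refine CategoryTheory.Functor.ext (fun A => hF.obj_eq A.ring) ?_
  rintro A B ⟨x⟩
  exact hF.map_cls x

end descentFunctor

end

end GKT

theorem mainTheorem7 {G : Type u} [Group G] :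
    -- the isomorphism `σ : K_B(E) ⋊ G ≅ K_{B ⋊ G}(E ⊗_B (B ⋊ G))`
    (∀ (B : QRing G) (E : FModule B) (S : ModAction B.action E), E.Cofull →
      (descentModule B.action E).Cofull ∧
      ∃ σ : Crossed S.Ad →ₙ+* (descentModule B.action E).compacts,
        IsDescentIso S σ ∧
        Function.Surjective σ ∧
        (∀ x : Crossed S.Ad, σ x = 0 ↔
          ∀ g ξ, ∀ φ ∈ E.functionals, φ ((Crossed.coeff x g).1 ξ) = 0) ∧
        (E.Separated → Function.Bijective σ)) ∧
    -- the commuting diagram for a corner embedding `e : B → K_B(E ⊕ H_B)`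
    (∀ (B : QRing G) (E : FModule B) (S : ModAction B.action E) (I : Type u) (i₀ : I)
      (U : ModAction B.action (FModule.copies B I)) (hU : U.IsDistinguished i₀),
      (E.prod (FModule.copies B I)).Cofull → (E.prod (FModule.copies B I)).Separated →
      ((descentModule B.action E).prod (FModule.copies (Crossed B.action) I)).Cofull ∧
      ∃ (σ : Crossed (S.prod U).Ad ≃+*
            (descentModule B.action (E.prod (FModule.copies B I))).compacts)
        (X : descentModule B.action (E.prod (FModule.copies B I)) ≃+
            (descentModule B.action E).prod (FModule.copies (Crossed B.action) I))
        (π : (descentModule B.action (E.prod (FModule.copies B I))).compacts →ₙ+*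
            ((descentModule B.action E).prod (FModule.copies (Crossed B.action) I)).compacts),
        IsDescentIso (S.prod U) σ ∧
        (∀ (ξ : E) (η : FModule.copies B I) (x : Crossed B.action),
          (X (descentTmul B.action (E.prod (FModule.copies B I)) (ξ, η) x)).1 =
            descentTmul B.action E ξ x ∧
          ∀ i, FModule.coord i
            (X (descentTmul B.action (E.prod (FModule.copies B I)) (ξ, η) x)).2 =
              Crossed.mk B.action (FModule.coord i η) 1 * x) ∧
        (∀ T z, (π T : AddMonoid.End _) (X z) = X ((T : AddMonoid.End _) z)) ∧
        Function.Injective π ∧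
        (Finite I → Function.Bijective π) ∧
        (∀ x : Crossed B.action,
          π (σ (Crossed.map (cornerHom B.quadratik E I i₀)
              (cornerHom_equivariant B.quadratik S U hU) x)) =
            cornerHom (Crossed.quadratik B.action B.quadratik)
              (descentModule B.action E) I i₀ x) ∧
        (Function.Injective (cornerHom B.quadratik E I i₀) →
          Function.Injective (cornerHom (Crossed.quadratik B.action B.quadratik)
            (descentModule B.action E) I i₀))) ∧
    -- descent maps corner embeddings to corner embeddings (up to isomorphism)
    (∀ (A K : QRing G) (e : EHom A K), IsCorner e → IsCorner (descHom e)) ∧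
    -- the descent functor is well-defined
    (∃! F : GK G ⥤ GK PUnit.{u + 1}, IsDescentFunctor F) := by
  refine ⟨fun B E S hE => ?_, fun B E S I i₀ U hU hc hs => ?_, fun A K e he => isCorner_descHom e he,
    existsUnique_isDescentFunctor⟩
  · exact ⟨descentModule_cofull B.quadratik hE, S.descentSigma B.quadratik hE.nondegenerate,
      S.isDescentIso_descentSigma B.quadratik hE.nondegenerate,
      S.descentSigma_surjective B.quadratik hE.nondegenerate,
      S.descentSigma_eq_zero B.quadratik hE.nondegenerate,
      S.descentSigma_bijective B.quadratik hE.nondegenerate⟩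
  · refine ⟨FModule.prod_copies_cofull (Crossed.quadratik B.action B.quadratik) i₀
        (descentModule_nondegenerate B.quadratik E),
      RingEquiv.ofBijective ((S.prod U).descentSigma B.quadratik hc.nondegenerate)
        ((S.prod U).descentSigma_bijective B.quadratik hc.nondegenerate hs),
      descentSumEquiv B.action hs B.quadratik, descentSumConj hs B.quadratik,
      (S.prod U).isDescentIso_descentSigma B.quadratik hc.nondegenerate,
      fun ξ η x => ⟨rfl, fun i => rfl⟩, fun T z => FModule.compactsConj_apply _ _ _ T z,
      FModule.compactsConj_injective _ _ _, fun hI => ?_,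
      descentSumConj_corner hs B.quadratik hc.nondegenerate S U hU,
      cornerHom_descent_injective B.quadratik E i₀⟩
    exact FModule.compactsConj_bijective _ _ _ fun _ => comp_descentSumEquiv_mem hs B.quadratik
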